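/- Let $d\ge 1$ and let $\mathcal A$ be a finite-dimensional $C^*$-algebra, realized as a unital $*$-subalgebra of a matrix algebra $M_N(\mathbb C)$, $N\ge 1$. For finite $\Lambda\subset\mathbb Z^d$ let $\mathcal O_\Lambda=\bigotimes_{x\in\Lambda}\mathcal A$, let $\mathrm{tr}$ be the trace on $\mathcal O_\Lambda$ inherited from $M_N(\mathbb C)^{\otimes\Lambda}$, and let $\mathcal O$ be the $C^*$-inductive limit (norm closure) of $\bigcup_\Lambda\mathcal O_\Lambda$, with the action $\tau_x$ of lattice translations. An interaction $\Psi=\{\psi_X\}$ assigns to every finite $X\subset\mathbb Z^d$ a self-adjoint $\psi_X\in\mathcal O_X$, with $\tau_x(\psi_X)=\psi_{X+x}$; put $\|\Psi\|=\sum_{X\ni 0}|X|^{-1}\|\psi_X\|$. Let $\Lambda(n)=\{z\in\mathbb Z^d: 0\le z_i\le n-1\}$. Let $\Phi=\{\phi_X\}$ and $\Psi=\{\psi_X\}$ be interactions with $\|\Phi\|<\infty$ and $\|\Psi\|<\infty$, and set $H_\Lambda=\sum_{X\subset\Lambda}\phi_X$, $K_\Lambda=\sum_{X\subset\Lambda}\psi_X$.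 Suppose that $[K_{\Lambda(n)},H_{\Lambda(n)}]=0$ for all $n$. Let $\omega^{(\Phi)}$ be a state on $\mathcal O$ for which there is a function $c:\mathbb N\to[0,\infty)$ with $\lim_{m\to\infty}c(m)/m^d=0$ such that, for every cube $C\subset\mathbb Z^d$ of side length $m$ and every nonnegative $A\in\mathcal O_C$, $$e^{-c(m)}\,\omega^{(\Phi)}(A)\;\le\;\frac{\mathrm{tr}(A\,e^{-H_C})}{\mathrm{tr}(e^{-H_C})}\;\le\; e^{c(m)}\,\omega^{(\Phi)}(A).$$ Then the Borel probability measures on $\mathbb R$ given by $$\mu_n(A)=\omega^{(\Phi)}\bigl(\mathbf I_A(|\Lambda(n)|^{-1}K_{\Lambda(n)})\bigr),$$ where $\mathbf I_A(\cdot)$ denotes the spectral projection for the Borel set $A$, satisfy a large deviation principle on the scale $|\Lambda(n)|$ with rate function $-s$, for a concave function $s:\mathbb R\to[-\infty,0]$. That is, $-s$ is lower semicontinuous with compact level sets, $\limsup_n|\Lambda(n)|^{-1}\log\mu_n(C)\le\sup_{x\in C}s(x)$ for every closed $C$, and $\liminf_n|\Lambda(n)|^{-1}\log\mu_n(O)\ge\sup_{x\in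 O}s(x)$ for every open $O$. Moreover, the limit $$P(\alpha)=\lim_{n\to\infty}|\Lambda(n)|^{-1}\log\mathrm{tr}\bigl(e^{-H_{\Lambda(n)}+\alpha K_{\Lambda(n)}}\bigr)$$ exists (and is finite) for every $\alpha\in\mathbb R$, and for all $\alpha, x\in\mathbb R$ $$\sup_{x'\in\mathbb R}\bigl(\alpha x'+s(x')\bigr)=P(\alpha)-P(0),\qquad s(x)=\inf_{\alpha'\in\mathbb R}\bigl(P(\alpha')-P(0)-\alpha' x\bigr).$$ -/

import Mathlib

open Filter Topology MeasureTheory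
open scoped ENNReal

noncomputable section

/-- Configurations of the `d`-dimensional lattice, with site labels in `Fin N`. -/
abbrev Config (d N : ℕ) : Type := (Fin d → ℤ) → Fin N

/-- The Hilbert space `ℓ²` of square-summable functions on configurations. -/
abbrev ConfigSpace (d N : ℕ) : Type := lp (fun _ : Config d N => ℂ) 2

/-- Bounded operators on `ConfigSpace d N`. All matrices on finitely many sites act on this space
(faithfully, hence isometrically), so it is an ambient C*-algebra for the observables. -/
abbrev ConfigOp (d N : ℕ) : Type := ConfigSpace d N →L[ℂ] ConfigSpace d N

/-- For `g` injective on `S`, the operator `f ↦ 1_S · (f ∘ g)` (a partial isometry). -/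
def partialShift {d N : ℕ} (S : Set (Config d N)) (g : Config d N → Config d N)
    (hg : Set.InjOn g S) : ConfigOp d N :=
  have key : ∀ (f : ConfigSpace d N) (s : Finset (Config d N)),
      ∑ σ ∈ s, ‖S.indicator (fun σ => f (g σ)) σ‖ ^ (2 : ℝ≥0∞).toReal
        ≤ ‖f‖ ^ (2 : ℝ≥0∞).toReal := by
    classical
    intro f s
    have h2 : (0 : ℝ) < (2 : ℝ≥0∞).toReal := by norm_num
    calc ∑ σ ∈ s, ‖S.indicator (fun σ => f (g σ)) σ‖ ^ (2 : ℝ≥0∞).toReal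
        = ∑ σ ∈ s.filter (· ∈ S), ‖f (g σ)‖ ^ (2 : ℝ≥0∞).toReal := by
          rw [Finset.sum_filter]
          refine Finset.sum_congr rfl fun σ _ => ?_
          by_cases h : σ ∈ S <;> simp [h]
      _ = ∑ σ ∈ (s.filter (· ∈ S)).image g, ‖f σ‖ ^ (2 : ℝ≥0∞).toReal := by
          rw [Finset.sum_image]
          intro a ha b hb hab
          exact hg (by simpa using (Finset.mem_filter.1 ha).2)
            (by simpa using (Finset.mem_filter.1 hb).2) hab
      _ ≤ ‖f‖ ^ (2 : ℝ≥0∞).toReal := lp.sum_rpow_le_norm_rpow h2 f _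
  LinearMap.mkContinuous
    { toFun := fun f => ⟨S.indicator (fun σ => f (g σ)), memℓp_gen' (key f)⟩
      map_add' := fun f f' => by
        ext σ
        change S.indicator (fun σ => (f + f') (g σ)) σ =
          S.indicator (fun σ => f (g σ)) σ + S.indicator (fun σ => f' (g σ)) σ
        by_cases h : σ ∈ S <;> simp [h]
      map_smul' := fun c f => by
        ext σ
        by_cases h : σ ∈ S <;> simp [h] }
    1
    (fun f => by
      rw [one_mul]
      exact lp.norm_le_of_forall_sum_le (by norm_num) (norm_nonneg f) (key f))

/-- The copy at the site `x` of a one-site matrix `a`: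
`(a_x f)(σ) = ∑ⱼ a (σ x) j · f (σ with the label at x replaced by j)`. -/
def siteOp {d N : ℕ} (x : Fin d → ℤ) (a : Matrix (Fin N) (Fin N) ℂ) : ConfigOp d N :=
  ∑ i, ∑ j, a i j • partialShift {σ | σ x = i} (fun σ => Function.update σ x j) (by
    intro σ hσ τ hτ h
    funext y
    by_cases hy : y = x
    · subst hy
      exact hσ.trans hτ.symm
    · simpa [hy] using congrFun h y)

/-- The unitary `(U_x f)(σ) = f (y ↦ σ (y + x))` implementing the lattice translation by `x`. -/
def shiftOp {d N : ℕ} (x : Fin d → ℤ) : ConfigOp d N :=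
  partialShift Set.univ (fun σ y => σ (y + x)) (by
    intro σ _ τ _ h
    funext y
    simpa using congrFun h (y - x))

/-- Lattice translation of observables, `τ_x A = U_x A U_x⁻¹`; it maps `a_y` to `a_{y+x}`. -/
def latticeTranslate {d N : ℕ} (x : Fin d → ℤ) (A : ConfigOp d N) : ConfigOp d N :=
  shiftOp x * A * shiftOp (-x)

/-- The local algebra `𝒪_Λ = ⨂_{x ∈ Λ} 𝔄`, generated by the copies of the one-site algebra `𝔄`
(a finite-dimensional C*-algebra, given as a unital *-algebra of matrices) at the sites of `Λ`. -/
def localAlg {d N : ℕ} (𝔄 : StarSubalgebra ℂ (Matrix (Fin N) (Fin N) ℂ))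
    (Λ : Finset (Fin d → ℤ)) : StarSubalgebra ℂ (ConfigOp d N) :=
  StarAlgebra.adjoin ℂ {T | ∃ x ∈ Λ, ∃ a ∈ 𝔄, T = siteOp x a}

/-- The quasi-local C*-algebra `𝒪`: the norm closure of the union of the local algebras. -/
def quasiLocal (d : ℕ) {N : ℕ} (𝔄 : StarSubalgebra ℂ (Matrix (Fin N) (Fin N) ℂ)) :
    StarSubalgebra ℂ (ConfigOp d N) :=
  (⨆ Λ : Finset (Fin d → ℤ), localAlg 𝔄 Λ).topologicalClosure

theorem localAlg_mono {d N : ℕ} (𝔄 : StarSubalgebra ℂ (Matrix (Fin N) (Fin N) ℂ))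
    {Λ Λ' : Finset (Fin d → ℤ)} (h : Λ ⊆ Λ') : localAlg 𝔄 Λ ≤ localAlg 𝔄 Λ' :=
  StarAlgebra.adjoin_mono fun _ ⟨x, hx, a, ha, hT⟩ => ⟨x, h hx, a, ha, hT⟩

theorem localAlg_le {d N : ℕ} (𝔄 : StarSubalgebra ℂ (Matrix (Fin N) (Fin N) ℂ))
    (Λ : Finset (Fin d → ℤ)) : localAlg 𝔄 Λ ≤ quasiLocal d 𝔄 :=
  (le_iSup (fun Λ => localAlg 𝔄 Λ) Λ).trans (StarSubalgebra.le_topologicalClosure _)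

/-- A translation-invariant interaction `X ↦ ψ_X = ψ_X* ∈ 𝒪_X`, `τ_x ψ_X = ψ_{X+x}`. -/
structure Interaction (d : ℕ) {N : ℕ} (𝔄 : StarSubalgebra ℂ (Matrix (Fin N) (Fin N) ℂ)) where
  term : Finset (Fin d → ℤ) → ConfigOp d N
  term_mem : ∀ X, term X ∈ localAlg 𝔄 X
  selfAdjoint : ∀ X, IsSelfAdjoint (term X)
  translation : ∀ (x : Fin d → ℤ) (X : Finset (Fin d → ℤ)),
    latticeTranslate x (term X) = term (X.map (addRightEmbedding x))

namespace Interaction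

variable {d N : ℕ} {𝔄 : StarSubalgebra ℂ (Matrix (Fin N) (Fin N) ℂ)}

/-- `‖Ψ‖ = ∑_{X ∋ 0} |X|⁻¹ ‖ψ_X‖ < ∞`. -/
def NormFinite (Ψ : Interaction d 𝔄) : Prop :=
  Summable fun X : {X : Finset (Fin d → ℤ) // 0 ∈ X} => ((X.1.card : ℝ))⁻¹ * ‖Ψ.term X.1‖

/-- The Hamiltonian `K_Λ = ∑_{X ⊆ Λ} ψ_X`. -/
def hamiltonian (Ψ : Interaction d 𝔄) (Λ : Finset (Fin d → ℤ)) : ConfigOp d N :=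
  ∑ X ∈ Λ.powerset, Ψ.term X

theorem hamiltonian_mem (Ψ : Interaction d 𝔄) (Λ : Finset (Fin d → ℤ)) :
    Ψ.hamiltonian Λ ∈ localAlg 𝔄 Λ :=
  sum_mem fun X hX => localAlg_mono 𝔄 (Finset.mem_powerset.1 hX) (Ψ.term_mem X)

end Interaction

/-- A state on the quasi-local algebra: a positive normalized linear functional. -/
structure QuasiLocalState (d : ℕ) {N : ℕ}
    (𝔄 : StarSubalgebra ℂ (Matrix (Fin N) (Fin N) ℂ)) where
  toFun : quasiLocal d 𝔄 →ₗ[ℂ] ℂ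
  map_one : toFun 1 = 1
  nonneg : ∀ A, 0 ≤ (toFun (star A * A)).re ∧ (toFun (star A * A)).im = 0

/-- The configuration equal to `σ` on `Λ` and to the label `0` outside `Λ`. -/
def extendConfig {d N : ℕ} [NeZero N] (Λ : Finset (Fin d → ℤ)) (σ : Λ → Fin N) : Config d N :=
  fun y => if h : y ∈ Λ then σ ⟨y, h⟩ else 0

/-- The (unnormalized) matrix trace on `𝒪_Λ`, a sum of diagonal matrix elements. An element of
`𝒪_Λ` acts as a matrix indexed by `Λ → Fin N` and as the identity on the labels outside `Λ`, so
the labels outside `Λ` are irrelevant. -/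
def localTrace {d N : ℕ} [NeZero N] (Λ : Finset (Fin d → ℤ)) (A : ConfigOp d N) : ℂ :=
  open scoped Classical in
  ∑ σ : Λ → Fin N, A (lp.single 2 (extendConfig Λ σ) (1 : ℂ)) (extendConfig Λ σ)

/-- The cube of side length `m` with lowest corner `a`. -/
def cube {d : ℕ} (a : Fin d → ℤ) (m : ℕ) : Finset (Fin d → ℤ) :=
  Fintype.piFinset fun i => Finset.Ico (a i) (a i + m)

/-- The finite-volume Gibbs expectation `tr (A e^{-H_Λ}) / tr (e^{-H_Λ})`. -/
def gibbs {d N : ℕ} [NeZero N] {𝔄 : StarSubalgebra ℂ (Matrix (Fin N) (Fin N) ℂ)}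
    (Φ : Interaction d 𝔄) (Λ : Finset (Fin d → ℤ)) (A : ConfigOp d N) : ℂ :=
  localTrace Λ (A * NormedSpace.exp (-Φ.hamiltonian Λ)) /
    localTrace Λ (NormedSpace.exp (-Φ.hamiltonian Λ))

/-- The decoupling bound: with some `c(m) ≥ 0`, `c(m) = o(m^d)`, for every cube `C` of side length
`m` and every nonnegative `A ∈ 𝒪_C`,
`e^{-c(m)} ω(A) ≤ tr (A e^{-H_C}) / tr (e^{-H_C}) ≤ e^{c(m)} ω(A)`.
(All three members are real numbers, so their real parts may be compared.) -/
def GibbsDecoupled {d N : ℕ} [NeZero N] {𝔄 : StarSubalgebra ℂ (Matrix (Fin N) (Fin N) ℂ)}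
    (Φ : Interaction d 𝔄) (ω : QuasiLocalState d 𝔄) : Prop :=
  ∃ c : ℕ → ℝ, (∀ m, 0 ≤ c m) ∧ Tendsto (fun m => c m / (m : ℝ) ^ d) atTop (𝓝 0) ∧
    ∀ (m : ℕ) (a : Fin d → ℤ) (A : quasiLocal d 𝔄),
      (A : ConfigOp d N) ∈ localAlg 𝔄 (cube a m) → (A : ConfigOp d N).IsPositive →
        Real.exp (-c m) * (ω.toFun A).re ≤ (gibbs Φ (cube a m) A).re ∧
        (gibbs Φ (cube a m) A).re ≤ Real.exp (c m) * (ω.toFun A).re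

/-- The spectral projection `I_B(T)` of a self-adjoint local observable `T`. (The spectrum of such
a `T` is a finite set of real numbers, so the indicator function is continuous on it.) -/
def spectralProj {d N : ℕ} (B : Set ℝ) (T : ConfigOp d N) : ConfigOp d N :=
  cfc (fun z : ℂ => B.indicator (fun _ => (1 : ℂ)) z.re) T

theorem spectralProj_mem {d N : ℕ} {𝔄 : StarSubalgebra ℂ (Matrix (Fin N) (Fin N) ℂ)}
    (B : Set ℝ) {T : ConfigOp d N} (hT : T ∈ quasiLocal d 𝔄) :
    spectralProj B T ∈ quasiLocal d 𝔄 :=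
  StarAlgebra.elemental.le_of_mem (StarSubalgebra.isClosed_topologicalClosure _) hT
    (cfc_mem_elemental _ T)

/-- The density `|Λ|⁻¹ K_Λ` as an element of `𝒪`. -/
theorem Interaction.density_mem {d N : ℕ} {𝔄 : StarSubalgebra ℂ (Matrix (Fin N) (Fin N) ℂ)}
    (Ψ : Interaction d 𝔄) (Λ : Finset (Fin d → ℤ)) :
    ((((Λ.card : ℝ)⁻¹ : ℝ) : ℂ) • Ψ.hamiltonian Λ) ∈ quasiLocal d 𝔄 :=
  SMulMemClass.smul_mem _ (localAlg_le 𝔄 Λ (Ψ.hamiltonian_mem Λ))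

/-- The spectral projection `I_B(|Λ|⁻¹ K_Λ)`, as an element of the quasi-local algebra. -/
def Interaction.densityProj {d N : ℕ} {𝔄 : StarSubalgebra ℂ (Matrix (Fin N) (Fin N) ℂ)}
    (Ψ : Interaction d 𝔄) (Λ : Finset (Fin d → ℤ)) (B : Set ℝ) : quasiLocal d 𝔄 :=
  ⟨spectralProj B ((((Λ.card : ℝ)⁻¹ : ℝ) : ℂ) • Ψ.hamiltonian Λ),
    spectralProj_mem B (Ψ.density_mem Λ)⟩

/-- The large deviation principle for Borel probability measures `μ_n` on `ℝ` on the scale `v_n`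
with rate function `I`. -/
structure LargeDeviationPrinciple (μ : ℕ → ProbabilityMeasure ℝ) (v : ℕ → ℝ)
    (I : ℝ → EReal) : Prop where
  scale_mono : Monotone v
  scale_tendsto : Tendsto v atTop atTop
  nonneg : ∀ x, 0 ≤ I x
  lowerSemicontinuous : LowerSemicontinuous I
  compact_levels : ∀ a : ℝ, IsCompact {x | I x ≤ (a : EReal)}
  upper : ∀ C : Set ℝ, IsClosed C →
    limsup (fun n => (((v n)⁻¹ : ℝ) : EReal) * ENNReal.log ((μ n : Measure ℝ) C)) atTop
      ≤ -⨅ x ∈ C, I x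
  lower : ∀ O : Set ℝ, IsOpen O →
    -(⨅ x ∈ O, I x)
      ≤ liminf (fun n => (((v n)⁻¹ : ℝ) : EReal) * ENNReal.log ((μ n : Measure ℝ) O)) atTop

/-- Concavity of a function with values in `[-∞, 0]`. -/
def ConcaveEReal (s : ℝ → EReal) : Prop :=
  ∀ (x y a b : ℝ), 0 < a → 0 < b → a + b = 1 →
    (a : EReal) * s x + (b : EReal) * s y ≤ s (a * x + b * y)

end

/-! Two facts give the thermodynamic limit. By the Peierls-Bogoliubov inequality (`partitionFn_le`),
`log tr e^A` is 1-Lipschitz in the operator norm for self-adjoint local `A`. Because the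
interactions have finite norm, replacing the Hamiltonians of a large cube by sums over disjoint
tiles of a large fixed side `m` costs at most `ε` per site (`eventually_norm_sub_tiled_le`).
Partition functions of the tiled system factorise, so the free energy density of all sufficiently
large cubes lies within `ε (1 + |α|)` of the one of side `m`. Hence `P` exists, and the error grows
at most linearly in `α`.

Commutation of `K` and `H` turns the partition function into `∑ w_i e^{α k_i}`, with nonnegative
weights on the eigenvalues of `K`. Normalised, these weights are the Gibbs distribution of `K`,
which the decoupling bound identifies with the distribution in `ω` up to subexponential factors.
Therefore `P` is convex, the upper bound is Chernoff's inequality plus compactness, and the first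
Legendre identity is Fenchel-Moreau duality.

The lower bound cannot rest on Gärtner-Ellis, since `P` may have kinks. The free energy at fixed
finite side `m` is differentiable, however, and the tiled system behaves like a sum of independent
copies: an exponential tilt concentrates it at the derivative (`eventually_half_le_sum_near`). A
lower bound `P α - α x ≥ P 0 + b` passes to side `m` up to a small linear error, and minimising a
perturbed function finds a tangent with slope near `x` and intercept near `P 0 + b`
(`exists_hasDerivAt_near`).

It remains to return from the tiles to the true cube. The tiled and true operators need not commute,
so their spectral projections are not compared. The localisation of `K` near `v x` is instead put
into the exponent as a Gaussian penalty `-(c/v) (K - v x)²`, which the Peierls-Bogoliubov inequality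
can transfer. For suitable `c` the weight far from `v x` is negligible
(`eventually_le_local_weight`). -/

noncomputable section

/-! ### Matrices on finitely many sites as operators on `ℓ²` -/

section LocalEmbedding

variable {d N : ℕ}

theorem partialShift_apply (S : Set (Config d N)) (g : Config d N → Config d N)
    (hg : Set.InjOn g S) (f : ConfigSpace d N) (σ : Config d N) :
    (partialShift S g hg f) σ = S.indicator (fun σ => f (g σ)) σ := rfl

theorem norm_partialShift_le (S : Set (Config d N)) (g : Config d N → Config d N)
    (hg : Set.InjOn g S) : ‖partialShift S g hg‖ ≤ 1 := by
  unfold partialShift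
  exact LinearMap.mkContinuous_norm_le _ zero_le_one _

/-- The basis vector of `ℓ²` at a configuration. -/
def basisVec (σ : Config d N) : ConfigSpace d N :=
  open scoped Classical in lp.single 2 σ (1 : ℂ)

open scoped Classical in
theorem basisVec_apply (σ τ : Config d N) :
    (basisVec σ) τ = if τ = σ then (1 : ℂ) else 0 := by
  rw [basisVec, lp.single_apply]
  by_cases h : τ = σ
  · subst h; simp
  · simp [h]

theorem norm_basisVec (σ : Config d N) : ‖basisVec σ‖ = 1 := by
  classical
  rw [basisVec, lp.norm_single (by norm_num)]
  simp

/-- Matrix elements of an operator. -/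
def matElem (A : ConfigOp d N) (σ τ : Config d N) : ℂ := A (basisVec τ) σ

theorem norm_matElem_le (A : ConfigOp d N) (σ τ : Config d N) : ‖matElem A σ τ‖ ≤ ‖A‖ := by
  calc ‖matElem A σ τ‖ ≤ ‖A (basisVec τ)‖ := lp.norm_apply_le_norm (by norm_num) _ _
    _ ≤ ‖A‖ * ‖basisVec τ‖ := A.le_opNorm _
    _ = ‖A‖ := by rw [norm_basisVec, mul_one]

theorem ext_matElem {A B : ConfigOp d N} (h : ∀ σ τ, matElem A σ τ = matElem B σ τ) : A = B := by
  classical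
  refine lp.ext_continuousLinearMap (p := 2) (by norm_num) fun τ => ?_
  ext
  simp only [ContinuousLinearMap.comp_apply, lp.singleContinuousLinearMap_apply]
  rename_i σ
  have := h σ τ
  simp only [matElem, basisVec] at this
  convert this

theorem matElem_star (A : ConfigOp d N) (σ τ : Config d N) :
    matElem (star A) σ τ = star (matElem A τ σ) := by
  classical
  have h1 : ∀ (f : ConfigSpace d N) (σ : Config d N), f σ = inner ℂ (basisVec σ) f := by
    intro f σ
    have := lp.inner_single_left (𝕜 := ℂ) σ (1 : ℂ) f
    rw [basisVec]
    convert this.symm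
    simp
  rw [matElem, matElem, h1, h1, ContinuousLinearMap.star_eq_adjoint,
    ContinuousLinearMap.adjoint_inner_right]
  exact (inner_conj_symm _ _).symm

/-- The restriction of a configuration to a finite region. -/
def restrictConfig (Λ : Finset (Fin d → ℤ)) (σ : Config d N) : Λ → Fin N := fun y => σ y

/-- The configuration `σ` with the labels in `Λ` replaced by those of `t`. -/
def patchConfig (Λ : Finset (Fin d → ℤ)) (σ : Config d N) (t : Λ → Fin N) : Config d N :=
  fun y => if h : y ∈ Λ then t ⟨y, h⟩ else σ y

@[simp] theorem restrict_patch (Λ : Finset (Fin d → ℤ)) (σ : Config d N) (t : Λ → Fin N) :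
    restrictConfig Λ (patchConfig Λ σ t) = t := by
  funext y; simp [restrictConfig, patchConfig]

@[simp] theorem patch_restrict (Λ : Finset (Fin d → ℤ)) (σ : Config d N) :
    patchConfig Λ σ (restrictConfig Λ σ) = σ := by
  funext y; simp [restrictConfig, patchConfig]

@[simp] theorem patch_patch (Λ : Finset (Fin d → ℤ)) (σ : Config d N) (t u : Λ → Fin N) :
    patchConfig Λ (patchConfig Λ σ t) u = patchConfig Λ σ u := by
  funext y; by_cases h : y ∈ Λ <;> simp [patchConfig, h]

theorem patch_eq_self_iff (Λ : Finset (Fin d → ℤ)) (σ : Config d N) (t : Λ → Fin N) :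
    patchConfig Λ σ t = σ ↔ t = restrictConfig Λ σ :=
  ⟨fun h => by rw [← restrict_patch Λ σ t, h], fun h => by rw [h, patch_restrict]⟩

theorem patch_injOn (Λ : Finset (Fin d → ℤ)) (s t : Λ → Fin N) :
    Set.InjOn (fun σ : Config d N => patchConfig Λ σ t) {σ | restrictConfig Λ σ = s} := by
  intro σ hσ τ hτ h
  funext y
  by_cases hy : y ∈ Λ
  · exact congrFun (hσ.trans hτ.symm) ⟨y, hy⟩
  · simpa [patchConfig, hy] using congrFun h y

/-- The operator on `ℓ²` acting as the matrix `M` on the labels in `Λ`. -/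
def localOp (Λ : Finset (Fin d → ℤ)) (M : Matrix (Λ → Fin N) (Λ → Fin N) ℂ) : ConfigOp d N :=
  ∑ s, ∑ t, M s t • partialShift {σ | restrictConfig Λ σ = s}
    (fun σ => patchConfig Λ σ t) (patch_injOn Λ s t)

theorem localOp_apply (Λ : Finset (Fin d → ℤ)) (M : Matrix (Λ → Fin N) (Λ → Fin N) ℂ)
    (f : ConfigSpace d N) (σ : Config d N) :
    localOp Λ M f σ = ∑ t, M (restrictConfig Λ σ) t * f (patchConfig Λ σ t) := by
  simp only [localOp, _root_.sum_apply, _root_.smul_apply,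
    lp.coeFn_sum, Finset.sum_apply, lp.coeFn_smul, Pi.smul_apply, partialShift_apply, smul_eq_mul]
  rw [Finset.sum_eq_single (restrictConfig Λ σ)]
  · exact Finset.sum_congr rfl fun t _ => by
      rw [Set.indicator_of_mem (by simp)]
  · intro s _ hs
    exact Finset.sum_eq_zero fun t _ => by
      rw [Set.indicator_of_notMem (by simpa using hs.symm), mul_zero]
  · simp

open scoped Classical in
-- The condition says that `σ` and `τ` agree outside `Λ`, where the operator acts as the identity.
theorem matElem_localOp (Λ : Finset (Fin d → ℤ)) (M : Matrix (Λ → Fin N) (Λ → Fin N) ℂ)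
    (σ τ : Config d N) :
    matElem (localOp Λ M) σ τ = if patchConfig Λ σ (restrictConfig Λ τ) = τ then
      M (restrictConfig Λ σ) (restrictConfig Λ τ) else 0 := by
  rw [matElem, localOp_apply, Finset.sum_eq_single (restrictConfig Λ τ)]
  · simp only [basisVec_apply]; split_ifs <;> simp
  · intro t _ ht
    rw [basisVec_apply, if_neg, mul_zero]
    rintro rfl
    simp at ht
  · simp

/-- The matrices on the sites of `Λ`, as operators on `ℓ²`. -/
def localEmbed (d N : ℕ) (Λ : Finset (Fin d → ℤ)) :
    Matrix (Λ → Fin N) (Λ → Fin N) ℂ →⋆ₐ[ℂ] ConfigOp d N where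
  toFun := localOp Λ
  map_one' := by
    ext f σ
    rw [localOp_apply, Finset.sum_eq_single (restrictConfig Λ σ)]
    · simp
    · intro t _ ht; rw [Matrix.one_apply_ne ht.symm, zero_mul]
    · simp
  map_mul' M M' := by
    ext f σ
    rw [_root_.mul_apply_eq_comp, localOp_apply, localOp_apply]
    simp only [localOp_apply, Matrix.mul_apply, Finset.sum_mul, Finset.mul_sum, restrict_patch,
      patch_patch]
    rw [Finset.sum_comm]
    simp only [mul_assoc]
  map_zero' := by
    ext f σ
    rw [localOp_apply]; simp
  map_add' M M' := by
    ext f σ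
    rw [_root_.add_apply, lp.coeFn_add, Pi.add_apply]
    simp only [localOp_apply, Matrix.add_apply, add_mul, Finset.sum_add_distrib]
  commutes' c := by
    ext f σ
    rw [localOp_apply, Finset.sum_eq_single (restrictConfig Λ σ)]
    · simp [Algebra.algebraMap_eq_smul_one]
    · intro t _ ht
      rw [Matrix.algebraMap_matrix_apply, if_neg ht.symm, zero_mul]
    · simp
  map_star' M := by
    classical
    refine ext_matElem fun σ τ => ?_
    rw [matElem_star, matElem_localOp, matElem_localOp]
    have : patchConfig Λ σ (restrictConfig Λ τ) = τ ↔
        patchConfig Λ τ (restrictConfig Λ σ) = σ := by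
      constructor <;> intro h <;> rw [← h] <;> simp
    by_cases h : patchConfig Λ σ (restrictConfig Λ τ) = τ
    · rw [if_pos h, if_pos (this.1 h), Matrix.star_apply]
    · rw [if_neg h, if_neg (fun h' => h (this.2 h')), star_zero]

theorem localEmbed_apply (Λ : Finset (Fin d → ℤ)) (M : Matrix (Λ → Fin N) (Λ → Fin N) ℂ)
    (f : ConfigSpace d N) (σ : Config d N) :
    localEmbed d N Λ M f σ = ∑ t, M (restrictConfig Λ σ) t * f (patchConfig Λ σ t) :=
  localOp_apply Λ M f σ

theorem siteOp_apply (x : Fin d → ℤ) (a : Matrix (Fin N) (Fin N) ℂ)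
    (f : ConfigSpace d N) (σ : Config d N) :
    siteOp x a f σ = ∑ j, a (σ x) j * f (Function.update σ x j) := by
  simp only [siteOp, _root_.sum_apply, _root_.smul_apply,
    lp.coeFn_sum, Finset.sum_apply, lp.coeFn_smul, Pi.smul_apply, smul_eq_mul]
  rw [Finset.sum_eq_single (σ x)]
  · exact Finset.sum_congr rfl fun t _ => congrArg (a (σ x) t * ·) <|
      Set.indicator_of_mem (s := {τ : Config d N | τ x = σ x}) (a := σ) rfl
        (fun τ => f (Function.update τ x t))
  · intro s _ hs
    exact Finset.sum_eq_zero fun t _ => (congrArg (a s t * ·) <|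
      Set.indicator_of_notMem (s := {τ : Config d N | τ x = s}) (a := σ) hs.symm
        (fun τ => f (Function.update τ x t))).trans (mul_zero _)
  · simp

theorem siteOp_mem_range {Λ : Finset (Fin d → ℤ)} {x : Fin d → ℤ} (hx : x ∈ Λ)
    (a : Matrix (Fin N) (Fin N) ℂ) : siteOp x a ∈ (localEmbed d N Λ).range := by
  classical
  -- The preimage is `a` at `x` tensored with the identity: an entry survives only if `s` and `t`
  -- agree off `x`.
  refine ⟨Matrix.of fun s t => if t = Function.update s ⟨x, hx⟩ (t ⟨x, hx⟩) then
    a (s ⟨x, hx⟩) (t ⟨x, hx⟩) else 0, ?_⟩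
  ext f σ
  change localEmbed d N Λ _ f σ = _
  rw [localEmbed_apply, siteOp_apply]
  simp only [Matrix.of_apply, ite_mul, zero_mul]
  rw [← Finset.sum_filter]
  symm
  refine Finset.sum_bij (fun j _ => Function.update (restrictConfig Λ σ) ⟨x, hx⟩ j) ?_ ?_ ?_ ?_
  · intro j _; simp
  · intro i _ j _ h
    simpa using congrFun h ⟨x, hx⟩
  · intro t ht
    exact ⟨t ⟨x, hx⟩, Finset.mem_univ _, ((Finset.mem_filter.1 ht).2).symm⟩
  · intro j _
    simp only [Function.update_self]
    refine congrArg (a (σ x) j * ·) (congrArg (f : Config d N → ℂ) ?_)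
    funext y
    by_cases hy : y = x
    · subst hy; simp [patchConfig, hx]
    · by_cases hyΛ : y ∈ Λ
      · have : (⟨y, hyΛ⟩ : Λ) ≠ ⟨x, hx⟩ := fun h => hy (congrArg Subtype.val h)
        simp [patchConfig, hyΛ, hy, this, restrictConfig]
      · simp [patchConfig, hyΛ, hy]

/-- This lets the spectral and trace arguments run in the full matrix algebra over `Λ`, whatever the
one-site algebra is. -/
theorem localAlg_le_range (𝔄 : StarSubalgebra ℂ (Matrix (Fin N) (Fin N) ℂ))
    (Λ : Finset (Fin d → ℤ)) : localAlg 𝔄 Λ ≤ (localEmbed d N Λ).range := by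
  refine StarAlgebra.adjoin_le ?_
  rintro T ⟨x, hx, a, -, rfl⟩
  exact siteOp_mem_range hx a

end LocalEmbedding

/-! ### Disjoint regions: commutation and factorisation of the trace -/

section LocalTrace

variable {d N : ℕ}

theorem patch_patch_comm {Λ Λ' : Finset (Fin d → ℤ)} (h : Disjoint Λ Λ') (σ : Config d N)
    (t : Λ → Fin N) (u : Λ' → Fin N) :
    patchConfig Λ' (patchConfig Λ σ t) u = patchConfig Λ (patchConfig Λ' σ u) t := by
  funext y
  by_cases h1 : y ∈ Λ
  · have h2 : y ∉ Λ' := Finset.disjoint_left.1 h h1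
    simp [patchConfig, h1, h2]
  · by_cases h2 : y ∈ Λ' <;> simp [patchConfig, h1, h2]

theorem restrict_patch_of_disjoint {Λ Λ' : Finset (Fin d → ℤ)} (h : Disjoint Λ Λ')
    (σ : Config d N) (t : Λ → Fin N) :
    restrictConfig Λ' (patchConfig Λ σ t) = restrictConfig Λ' σ := by
  funext y
  have h2 : (y : Fin d → ℤ) ∉ Λ := Finset.disjoint_right.1 h y.2
  simp [patchConfig, restrictConfig, h2]

theorem localEmbed_mul_apply {Λ Λ' : Finset (Fin d → ℤ)} (h : Disjoint Λ Λ')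
    (M : Matrix (Λ → Fin N) (Λ → Fin N) ℂ) (M' : Matrix (Λ' → Fin N) (Λ' → Fin N) ℂ)
    (f : ConfigSpace d N) (σ : Config d N) :
    (localEmbed d N Λ M * localEmbed d N Λ' M') f σ =
      ∑ t, ∑ u, M (restrictConfig Λ σ) t * (M' (restrictConfig Λ' σ) u *
        f (patchConfig Λ' (patchConfig Λ σ t) u)) := by
  rw [mul_apply_eq_comp, localEmbed_apply]
  refine Finset.sum_congr rfl fun t _ => ?_
  rw [localEmbed_apply, Finset.mul_sum]
  simp only [restrict_patch_of_disjoint h]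

/-- The two operators read and replace disjoint sets of labels, so the patches can be made in either
order. -/
theorem commute_of_mem_range {Λ Λ' : Finset (Fin d → ℤ)} (h : Disjoint Λ Λ')
    {A B : ConfigOp d N} (hA : A ∈ (localEmbed d N Λ).range)
    (hB : B ∈ (localEmbed d N Λ').range) : Commute A B := by
  obtain ⟨M, rfl⟩ := hA
  obtain ⟨M', rfl⟩ := hB
  ext f σ
  change (localEmbed d N Λ M * localEmbed d N Λ' M') f σ =
    (localEmbed d N Λ' M' * localEmbed d N Λ M) f σ
  rw [localEmbed_mul_apply h, localEmbed_mul_apply h.symm, Finset.sum_comm]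
  refine Finset.sum_congr rfl fun u _ => Finset.sum_congr rfl fun t _ => ?_
  rw [patch_patch_comm h]
  ring

variable [NeZero N]

theorem localTrace_eq (Λ : Finset (Fin d → ℤ)) (A : ConfigOp d N) :
    localTrace Λ A = ∑ σ : Λ → Fin N, matElem A (extendConfig Λ σ) (extendConfig Λ σ) := by
  classical
  simp only [localTrace, matElem, basisVec]
  

@[simp] theorem restrict_extend (Λ : Finset (Fin d → ℤ)) (σ : Λ → Fin N) :
    restrictConfig Λ (extendConfig Λ σ) = σ := by
  funext y; simp [restrictConfig, extendConfig]

theorem localTrace_localEmbed (Λ : Finset (Fin d → ℤ)) (M : Matrix (Λ → Fin N) (Λ → Fin N) ℂ) :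
    localTrace Λ (localEmbed d N Λ M) = M.trace := by
  rw [localTrace_eq, Matrix.trace]
  refine Finset.sum_congr rfl fun σ _ => ?_
  refine (matElem_localOp Λ M _ _).trans ?_
  rw [patch_restrict, if_pos rfl, restrict_extend, Matrix.diag_apply]

theorem localTrace_one (Λ : Finset (Fin d → ℤ)) :
    localTrace Λ (1 : ConfigOp d N) = (N : ℂ) ^ Λ.card := by
  rw [← map_one (localEmbed d N Λ), localTrace_localEmbed, Matrix.trace_one]
  simp

/-- The trace is multiplicative over disjoint regions. -/
theorem localTrace_mul {Λ Λ' : Finset (Fin d → ℤ)} (h : Disjoint Λ Λ')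
    {A B : ConfigOp d N} (hA : A ∈ (localEmbed d N Λ).range)
    (hB : B ∈ (localEmbed d N Λ').range) :
    localTrace (Λ ∪ Λ') (A * B) = localTrace Λ A * localTrace Λ' B := by
  classical
  obtain ⟨M, rfl⟩ := hA
  obtain ⟨M', rfl⟩ := hB
  change localTrace (Λ ∪ Λ') (localEmbed d N Λ M * localEmbed d N Λ' M') =
    localTrace Λ (localEmbed d N Λ M) * localTrace Λ' (localEmbed d N Λ' M')
  -- On the diagonal only the patches that return to `σ` contribute, that is, those by the
  -- restrictions of `σ` itself.
  have key : ∀ σ : Config d N, matElem (localEmbed d N Λ M * localEmbed d N Λ' M') σ σ =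
      M (restrictConfig Λ σ) (restrictConfig Λ σ) *
        M' (restrictConfig Λ' σ) (restrictConfig Λ' σ) := by
    intro σ
    rw [matElem, localEmbed_mul_apply h, Finset.sum_eq_single (restrictConfig Λ σ),
      Finset.sum_eq_single (restrictConfig Λ' σ)]
    · simp [basisVec_apply]
    · intro u _ hu
      rw [patch_restrict, basisVec_apply, if_neg, mul_zero, mul_zero]
      rwa [patch_eq_self_iff]
    · simp
    · intro t _ ht
      refine Finset.sum_eq_zero fun u _ => ?_
      rw [basisVec_apply, if_neg, mul_zero, mul_zero]
      intro h'
      apply ht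
      rw [patch_patch_comm h] at h'
      have := congrArg (restrictConfig Λ) h'
      rwa [restrict_patch] at this
    · simp
  rw [localTrace_localEmbed, localTrace_localEmbed, localTrace_eq, Matrix.trace, Matrix.trace,
    Fintype.sum_mul_sum, ← Fintype.sum_prod_type']
  simp only [key]
  -- Labels on the disjoint union correspond to pairs of labels, which turns the double sum into a
  -- single trace.
  refine Finset.sum_bij' (fun σ _ => (restrictConfig Λ (extendConfig (Λ ∪ Λ') σ),
    restrictConfig Λ' (extendConfig (Λ ∪ Λ') σ)))
    (fun p _ => restrictConfig (Λ ∪ Λ') (patchConfig Λ' (extendConfig Λ p.1) p.2))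
    (by simp) (by simp) ?_ ?_ ?_
  · intro σ _
    funext ⟨y, hy⟩
    by_cases h2 : y ∈ Λ'
    · simp [patchConfig, h2, restrictConfig, extendConfig]
    · have h1 : y ∈ Λ := by simpa [h2] using hy
      simp [patchConfig, h1, h2, restrictConfig, extendConfig]
  · rintro ⟨t, u⟩ _
    ext1
    · funext ⟨y, hy⟩
      have h2 : y ∉ Λ' := Finset.disjoint_left.1 h hy
      simp [patchConfig, hy, h2, restrictConfig, extendConfig]
    · funext ⟨y, hy⟩
      simp [patchConfig, hy, restrictConfig, extendConfig]
  · intro σ _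
    simp [Matrix.diag]

end LocalTrace

/-! ### Lattice translations -/

section Translation

variable {d N : ℕ}

theorem shiftOp_apply (x : Fin d → ℤ) (f : ConfigSpace d N) (σ : Config d N) :
    shiftOp x f σ = f (fun y => σ (y + x)) :=
  Set.indicator_of_mem (Set.mem_univ σ) (fun σ : Config d N => f (fun y => σ (y + x)))

theorem shiftOp_mul_neg (x : Fin d → ℤ) : (shiftOp x * shiftOp (-x) : ConfigOp d N) = 1 := by
  ext f σ
  rw [mul_apply_eq_comp, shiftOp_apply, shiftOp_apply]
  simp

/-- Translation as an invertible operator. -/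
def shiftUnit (d N : ℕ) (x : Fin d → ℤ) : (ConfigOp d N)ˣ where
  val := shiftOp x
  inv := shiftOp (-x)
  val_inv := shiftOp_mul_neg x
  inv_val := by simpa using shiftOp_mul_neg (N := N) (-x)

theorem latticeTranslate_eq (x : Fin d → ℤ) (A : ConfigOp d N) :
    latticeTranslate x A = shiftUnit d N x * A * ↑(shiftUnit d N x)⁻¹ := rfl

theorem latticeTranslate_exp (x : Fin d → ℤ) (A : ConfigOp d N) :
    latticeTranslate x (NormedSpace.exp A) = NormedSpace.exp (latticeTranslate x A) := by
  let _ : NormedAlgebra ℚ (ConfigOp d N) := NormedAlgebra.restrictScalars ℚ ℂ _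
  rw [latticeTranslate_eq, latticeTranslate_eq, NormedSpace.exp_units_conj]

theorem latticeTranslate_add (x : Fin d → ℤ) (A B : ConfigOp d N) :
    latticeTranslate x (A + B) = latticeTranslate x A + latticeTranslate x B := by
  simp only [latticeTranslate, mul_add, add_mul]

theorem latticeTranslate_neg (x : Fin d → ℤ) (A : ConfigOp d N) :
    latticeTranslate x (-A) = -latticeTranslate x A := by
  simp only [latticeTranslate, mul_neg, neg_mul]

theorem latticeTranslate_mul (x : Fin d → ℤ) (A B : ConfigOp d N) :
    latticeTranslate x (A * B) = latticeTranslate x A * latticeTranslate x B := by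
  simp [latticeTranslate_eq, mul_assoc]

theorem latticeTranslate_smul (x : Fin d → ℤ) (c : ℂ) (A : ConfigOp d N) :
    latticeTranslate x (c • A) = c • latticeTranslate x A := by
  simp only [latticeTranslate, mul_smul_comm, smul_mul_assoc]

theorem latticeTranslate_sum {ι : Type*} (x : Fin d → ℤ) (s : Finset ι) (A : ι → ConfigOp d N) :
    latticeTranslate x (∑ i ∈ s, A i) = ∑ i ∈ s, latticeTranslate x (A i) := by
  simp only [latticeTranslate, Finset.mul_sum, Finset.sum_mul]

theorem norm_latticeTranslate_le (x : Fin d → ℤ) (A : ConfigOp d N) :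
    ‖latticeTranslate x A‖ ≤ ‖A‖ := by
  have h1 : ‖(shiftOp x : ConfigOp d N)‖ ≤ 1 := norm_partialShift_le _ _ _
  have h2 : ‖(shiftOp (-x) : ConfigOp d N)‖ ≤ 1 := norm_partialShift_le _ _ _
  calc ‖latticeTranslate x A‖ ≤ ‖shiftOp x * A‖ * ‖(shiftOp (-x) : ConfigOp d N)‖ :=
        norm_mul_le _ _
    _ ≤ ‖shiftOp x * A‖ := mul_le_of_le_one_right (norm_nonneg _) h2
    _ ≤ ‖(shiftOp x : ConfigOp d N)‖ * ‖A‖ := norm_mul_le _ _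
    _ ≤ ‖A‖ := mul_le_of_le_one_left (norm_nonneg _) h1

theorem shiftOp_basisVec (x : Fin d → ℤ) (σ : Config d N) :
    shiftOp x (basisVec σ) = basisVec (fun y => σ (y - x)) := by
  classical
  ext τ
  rw [shiftOp_apply, basisVec_apply, basisVec_apply]
  congr 1
  refine propext ⟨fun h => ?_, fun h => ?_⟩
  · rw [← h]; simp
  · rw [h]; simp

theorem matElem_latticeTranslate (x : Fin d → ℤ) (A : ConfigOp d N) (σ τ : Config d N) :
    matElem (latticeTranslate x A) σ τ = matElem A (fun y => σ (y + x)) (fun y => τ (y + x)) := by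
  rw [matElem, matElem, latticeTranslate, mul_apply_eq_comp, mul_apply_eq_comp, shiftOp_apply,
    shiftOp_basisVec]
  simp

/-- Translation permutes basis vectors, and the constant default label outside the region is
unaffected by it. -/
theorem localTrace_latticeTranslate [NeZero N] (x : Fin d → ℤ) (Λ : Finset (Fin d → ℤ))
    (A : ConfigOp d N) :
    localTrace (Λ.map (addRightEmbedding x)) (latticeTranslate x A) = localTrace Λ A := by
  classical
  rw [localTrace_eq, localTrace_eq]
  have hmem : ∀ y : Fin d → ℤ, y + x ∈ Λ.map (addRightEmbedding x) ↔ y ∈ Λ := by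
    intro y; simp
  have hmem' : ∀ y : Fin d → ℤ, y ∈ Λ.map (addRightEmbedding x) ↔ y - x ∈ Λ := by
    intro y; rw [← hmem, sub_add_cancel]
  refine Finset.sum_bij' (fun σ _ y => σ ⟨y + x, (hmem y).2 y.2⟩)
    (fun σ _ y => σ ⟨y - x, (hmem' y).1 y.2⟩) (by simp) (by simp) ?_ ?_ ?_
  · intro σ _; funext y; simp
  · intro σ _; funext y; simp
  · intro σ _
    rw [matElem_latticeTranslate]
    have : (fun y => extendConfig (Λ.map (addRightEmbedding x)) σ (y + x)) =
        extendConfig Λ (fun y : Λ => σ ⟨y + x, (hmem y).2 y.2⟩) := by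
      funext y
      by_cases hy : y ∈ Λ
      · rw [extendConfig, extendConfig, dif_pos hy, dif_pos ((hmem y).2 hy)]
      · rw [extendConfig, extendConfig, dif_neg hy, dif_neg (fun h => hy ((hmem y).1 h))]
    rw [this]

end Translation

/-! ### Functional calculus by diagonalisation -/

section DiagonalCalculus

variable {d N : ℕ}

/-- Matrices diagonal in the orthonormal basis given by the columns of `U`. -/
def unitaryDiag {V : Type*} [Fintype V] [DecidableEq V] (U : Matrix.unitaryGroup V ℂ) :
    (V → ℂ) →⋆ₐ[ℂ] Matrix V V ℂ where
  toFun f := U * Matrix.diagonal f * star (U : Matrix V V ℂ)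
  map_one' := by
    rw [show (1 : V → ℂ) = fun _ => 1 from rfl, Matrix.diagonal_one, mul_one,
      Unitary.mul_star_self_of_mem U.2]
  map_mul' f g := by
    have : star (U : Matrix V V ℂ) * U = 1 := Unitary.coe_star_mul_self U
    calc (U : Matrix V V ℂ) * Matrix.diagonal (f * g) * star (U : Matrix V V ℂ)
        = U * Matrix.diagonal f * 1 * Matrix.diagonal g * star (U : Matrix V V ℂ) := by
          rw [mul_one, mul_assoc (U : Matrix V V ℂ) (Matrix.diagonal f),
            Matrix.diagonal_mul_diagonal]; rfl
      _ = _ := by rw [← this]; simp only [mul_assoc]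
  map_zero' := by
    rw [show (0 : V → ℂ) = fun _ => 0 from rfl, Matrix.diagonal_zero, mul_zero, zero_mul]
  map_add' f g := by
    rw [← add_mul, ← mul_add, Matrix.diagonal_add]; rfl
  commutes' c := by
    have h : Matrix.diagonal (algebraMap ℂ (V → ℂ) c) = c • (1 : Matrix V V ℂ) := by
      rw [← Matrix.diagonal_one, ← Matrix.diagonal_smul]
      congr 1; funext i; simp
    rw [h, mul_smul_comm, mul_one, smul_mul_assoc, Unitary.mul_star_self_of_mem U.2,
      Algebra.algebraMap_eq_smul_one]
  map_star' f := by
    simp only [star_mul, Matrix.star_eq_conjTranspose, Matrix.diagonal_conjTranspose,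
      mul_assoc, Matrix.conjTranspose_conjTranspose]

theorem unitaryDiag_apply {V : Type*} [Fintype V] [DecidableEq V] (U : Matrix.unitaryGroup V ℂ)
    (f : V → ℂ) : unitaryDiag U f = U * Matrix.diagonal f * star (U : Matrix V V ℂ) := rfl

theorem sum_norm_sq_row {V : Type*} [Fintype V] [DecidableEq V] (C : Matrix.unitaryGroup V ℂ)
    (i : V) : ∑ j, ‖(C : Matrix V V ℂ) i j‖ ^ 2 = 1 := by
  have h0 : (C : Matrix V V ℂ) * star (C : Matrix V V ℂ) = 1 := Unitary.mul_star_self_of_mem C.2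
  have h := congrFun (congrFun h0 i) i
  rw [Matrix.mul_apply, Matrix.one_apply_eq] at h
  have h2 : ∀ j, (C : Matrix V V ℂ) i j * star (C : Matrix V V ℂ) j i =
      ((‖(C : Matrix V V ℂ) i j‖ ^ 2 : ℝ) : ℂ) := by
    intro j
    rw [Matrix.star_apply]
    simpa using Complex.mul_conj' ((C : Matrix V V ℂ) i j)
  simp only [h2] at h
  exact_mod_cast h

theorem sum_norm_sq_col {V : Type*} [Fintype V] [DecidableEq V] (C : Matrix.unitaryGroup V ℂ)
    (j : V) : ∑ i, ‖(C : Matrix V V ℂ) i j‖ ^ 2 = 1 := by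
  rw [← sum_norm_sq_row (star C) j]
  refine Finset.sum_congr rfl fun i _ => ?_
  rw [Unitary.coe_star, Matrix.star_apply, norm_star]

/-- Passing to the basis `U` replaces `W` by the unitary `U* W`. A diagonal entry is then an average
of `g` with the squared moduli of a row of that unitary. -/
theorem conj_unitaryDiag_diag {V : Type*} [Fintype V] [DecidableEq V]
    (U W : Matrix.unitaryGroup V ℂ) (g : V → ℂ) (i : V) :
    (star (U : Matrix V V ℂ) * unitaryDiag W g * U) i i =
      ∑ j, ((‖((star U * W : Matrix.unitaryGroup V ℂ) : Matrix V V ℂ) i j‖ ^ 2 : ℝ) : ℂ) * g j := by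
  have h : star (U : Matrix V V ℂ) * unitaryDiag W g * U =
      ((star U * W : Matrix.unitaryGroup V ℂ) : Matrix V V ℂ) * Matrix.diagonal g *
        star ((star U * W : Matrix.unitaryGroup V ℂ) : Matrix V V ℂ) := by
    simp [unitaryDiag_apply, mul_assoc]
  rw [h, Matrix.mul_apply]
  refine Finset.sum_congr rfl fun j _ => ?_
  rw [Matrix.mul_diagonal, Matrix.star_apply]
  generalize ((star U * W : Matrix.unitaryGroup V ℂ) : Matrix V V ℂ) i j = z
  have := Complex.mul_conj' z
  push_cast
  rw [← this]
  simp only [RCLike.star_def]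
  ring

theorem trace_unitaryDiag_mul {V : Type*} [Fintype V] [DecidableEq V]
    (U W : Matrix.unitaryGroup V ℂ) (f g : V → ℂ) :
    (unitaryDiag U f * unitaryDiag W g).trace =
      ∑ i, f i * ∑ j,
        ((‖((star U * W : Matrix.unitaryGroup V ℂ) : Matrix V V ℂ) i j‖ ^ 2 : ℝ) : ℂ) * g j := by
  have : (unitaryDiag U f * unitaryDiag W g).trace =
      (Matrix.diagonal f * (star (U : Matrix V V ℂ) * unitaryDiag W g * U)).trace := by
    rw [unitaryDiag_apply U f, mul_assoc, mul_assoc, Matrix.trace_mul_comm]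
    simp only [mul_assoc]
  rw [this, Matrix.trace]
  refine Finset.sum_congr rfl fun i _ => ?_
  rw [Matrix.diag_apply, Matrix.diagonal_mul, conj_unitaryDiag_diag]

/-- Functions of a local observable that is diagonal in the basis `U`. -/
def localDiag (d : ℕ) {N : ℕ} {Λ : Finset (Fin d → ℤ)}
    (U : Matrix.unitaryGroup (Λ → Fin N) ℂ) : ((Λ → Fin N) → ℂ) →⋆ₐ[ℂ] ConfigOp d N :=
  (localEmbed d N Λ).comp (unitaryDiag U)

variable {Λ : Finset (Fin d → ℤ)}

theorem continuous_localDiag (U : Matrix.unitaryGroup (Λ → Fin N) ℂ) :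
    Continuous (localDiag d U) :=
  (localDiag d U).toAlgHom.toLinearMap.continuous_of_finiteDimensional

theorem exists_localDiag {T : ConfigOp d N} (hT : T ∈ (localEmbed d N Λ).range)
    (hsa : IsSelfAdjoint T) : ∃ (U : Matrix.unitaryGroup (Λ → Fin N) ℂ) (k : (Λ → Fin N) → ℝ),
      T = localDiag d U (fun i => (k i : ℂ)) := by
  obtain ⟨M, hM⟩ := hT
  change localEmbed d N Λ M = T at hM
  -- The preimage `M` is not assumed Hermitian. Its Hermitian part has the same image, because `T`
  -- is self-adjoint.
  have hH : ((2⁻¹ : ℂ) • (M + star M)).IsHermitian := by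
    rw [Matrix.IsHermitian, ← Matrix.star_eq_conjTranspose, star_smul, star_add, star_star,
      add_comm]
    simp
  refine ⟨hH.eigenvectorUnitary, hH.eigenvalues, ?_⟩
  have h1 := hH.spectral_theorem
  rw [Unitary.conjStarAlgAut_apply] at h1
  have h2 : localEmbed d N Λ ((2⁻¹ : ℂ) • (M + star M)) = T := by
    rw [map_smul, map_add, map_star, hM, hsa.star_eq, ← two_smul ℂ T, smul_smul]
    simp
  rw [← h2]
  change _ = localEmbed d N Λ (unitaryDiag _ _)
  rw [unitaryDiag_apply]
  conv_lhs => rw [h1]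
  rfl

theorem exp_localDiag (U : Matrix.unitaryGroup (Λ → Fin N) ℂ) (k : (Λ → Fin N) → ℝ) :
    NormedSpace.exp (localDiag d U (fun i => (k i : ℂ))) =
      localDiag d U (fun i => ((Real.exp (k i) : ℝ) : ℂ)) := by
  let _ : NormedAlgebra ℚ ((Λ → Fin N) → ℂ) := NormedAlgebra.restrictScalars ℚ ℂ _
  let _ : Algebra ℚ (ConfigOp d N) := RestrictScalars.algebra ℚ ℂ _
  rw [← NormedSpace.map_exp (localDiag d U) (continuous_localDiag U)]
  congr 1
  funext i
  have := Pi.coe_exp (𝔸 := fun _ : Λ → Fin N => ℂ) (fun i => (k i : ℂ)) i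
  rw [this, ← Complex.exp_eq_exp_ℂ, Complex.ofReal_exp]

theorem spectralProj_localDiag (U : Matrix.unitaryGroup (Λ → Fin N) ℂ) (k : (Λ → Fin N) → ℝ)
    (B : Set ℝ) :
    spectralProj B (localDiag d U (fun i => (k i : ℂ))) =
      localDiag d U (fun i => B.indicator (fun _ => (1 : ℂ)) (k i)) := by
  have hfin : ∀ i, spectrum ℂ (k i : ℂ) = {(k i : ℂ)} := fun i =>
    spectrum.scalar_eq (A := ℂ) (𝕜 := ℂ) (k i : ℂ)
  -- Finiteness of the spectrum makes the indicator function continuous on it, as the continuous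
  -- functional calculus requires.
  have hf : (⋃ i, spectrum ℂ ((fun i => (k i : ℂ)) i)).Finite := by
    simp only [hfin]
    exact Set.finite_iUnion fun i => Set.finite_singleton _
  have hn : IsStarNormal (fun i => (k i : ℂ)) := ⟨mul_comm _ _⟩
  rw [spectralProj, ← StarAlgHom.map_cfc (localDiag d U) _ _ (by
    rw [Pi.spectrum_eq]; exact hf.continuousOn _) (continuous_localDiag U) hn]
  · congr 1
    rw [cfc_map_pi (S := ℂ) _ _ (hf.continuousOn _) hn (fun i => ⟨mul_comm _ _⟩)]
    funext i
    have := cfc_algebraMap (A := ℂ) (p := IsStarNormal) (k i : ℂ)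
      (fun z : ℂ => B.indicator (fun _ => (1 : ℂ)) z.re)
    simpa using this

/-- Finite dimension gives closedness, so exponential series and functional calculus do not leave
the local algebra. -/
theorem isClosed_of_le_range (S : StarSubalgebra ℂ (ConfigOp d N))
    (h : S ≤ (localEmbed d N Λ).range) : IsClosed (S : Set (ConfigOp d N)) := by
  have h1 : S.toSubalgebra.toSubmodule ≤
      LinearMap.range (localEmbed d N Λ).toAlgHom.toLinearMap := by
    intro T hT
    obtain ⟨M, hM⟩ := h hT
    exact ⟨M, hM⟩
  have : FiniteDimensional ℂ S.toSubalgebra.toSubmodule :=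
    Submodule.finiteDimensional_of_le h1
  exact S.toSubalgebra.toSubmodule.closed_of_finiteDimensional

theorem exp_mem_of_le_range {S : StarSubalgebra ℂ (ConfigOp d N)}
    (h : S ≤ (localEmbed d N Λ).range) {T : ConfigOp d N} (hT : T ∈ S) :
    NormedSpace.exp T ∈ S := by
  rw [NormedSpace.exp_eq_tsum ℂ]
  exact tsum_mem (isClosed_of_le_range S h) fun i => SMulMemClass.smul_mem _ (pow_mem hT i)

end DiagonalCalculus

/-! ### The Peierls-Bogoliubov inequality and spectral weights -/

section TraceInequality

/-- The transition probabilities between the orthonormal bases of columns of `U` and `W`. -/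
def overlap {V : Type*} [Fintype V] [DecidableEq V] (U W : Matrix.unitaryGroup V ℂ) (i j : V) : ℝ :=
  ‖((star U * W : Matrix.unitaryGroup V ℂ) : Matrix V V ℂ) i j‖ ^ 2

section Overlap

variable {V : Type*} [Fintype V] [DecidableEq V] (U W : Matrix.unitaryGroup V ℂ)

theorem overlap_nonneg (i j : V) : 0 ≤ overlap U W i j := sq_nonneg _

theorem sum_overlap_right (i : V) : ∑ j, overlap U W i j = 1 := sum_norm_sq_row _ i

theorem sum_overlap_left (j : V) : ∑ i, overlap U W i j = 1 := sum_norm_sq_col _ j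

end Overlap

variable {d N : ℕ} [NeZero N] {Λ : Finset (Fin d → ℤ)}

theorem localTrace_localDiag (U : Matrix.unitaryGroup (Λ → Fin N) ℂ) (f : (Λ → Fin N) → ℂ) :
    localTrace Λ (localDiag d U f) = ∑ i, f i := by
  change localTrace Λ (localEmbed d N Λ (unitaryDiag U f)) = _
  have h := trace_unitaryDiag_mul U U f 1
  rw [map_one, mul_one] at h
  rw [localTrace_localEmbed, h]
  refine Finset.sum_congr rfl fun i _ => ?_
  simp only [Pi.one_apply, mul_one]
  rw [← Complex.ofReal_sum, sum_norm_sq_row, Complex.ofReal_one, mul_one]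

theorem localTrace_localDiag_mul (U W : Matrix.unitaryGroup (Λ → Fin N) ℂ)
    (f : (Λ → Fin N) → ℂ) (g : (Λ → Fin N) → ℝ) :
    localTrace Λ (localDiag d U f * localDiag d W (fun j => (g j : ℂ))) =
      ∑ i, f i * ((∑ j, overlap U W i j * g j : ℝ) : ℂ) := by
  change localTrace Λ (localEmbed d N Λ (unitaryDiag U f) * localEmbed d N Λ (unitaryDiag W _)) = _
  rw [← map_mul, localTrace_localEmbed, trace_unitaryDiag_mul]
  push_cast
  simp only [overlap, Complex.ofReal_pow]
  rfl

/-- The partition function `tr e^A`. -/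
def partitionFn (Λ : Finset (Fin d → ℤ)) (A : ConfigOp d N) : ℝ :=
  (localTrace Λ (NormedSpace.exp A)).re

theorem localTrace_exp_localDiag (U : Matrix.unitaryGroup (Λ → Fin N) ℂ)
    (k : (Λ → Fin N) → ℝ) :
    localTrace Λ (NormedSpace.exp (localDiag d U (fun i => (k i : ℂ)))) =
      ((∑ i, Real.exp (k i) : ℝ) : ℂ) := by
  rw [exp_localDiag, localTrace_localDiag, Complex.ofReal_sum]

theorem localTrace_exp {A : ConfigOp d N} (hA : A ∈ (localEmbed d N Λ).range)
    (hsa : IsSelfAdjoint A) :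
    localTrace Λ (NormedSpace.exp A) = (partitionFn Λ A : ℂ) := by
  obtain ⟨U, a, rfl⟩ := exists_localDiag hA hsa
  rw [partitionFn, localTrace_exp_localDiag, Complex.ofReal_re]

theorem partitionFn_pos {A : ConfigOp d N} (hA : A ∈ (localEmbed d N Λ).range)
    (hsa : IsSelfAdjoint A) : 0 < partitionFn Λ A := by
  obtain ⟨U, a, rfl⟩ := exists_localDiag hA hsa
  rw [partitionFn, localTrace_exp_localDiag, Complex.ofReal_re]
  exact Finset.sum_pos (fun i _ => Real.exp_pos _) Finset.univ_nonempty

/-- In the eigenbasis of the first operator, the `i`-th diagonal entry of the difference is `a i`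
minus the overlap average of `b`. Unitary conjugation preserves the norm, and the norm bounds every
matrix element. -/
theorem localDiag_conj_le (U W : Matrix.unitaryGroup (Λ → Fin N) ℂ)
    (a b : (Λ → Fin N) → ℝ) (i : Λ → Fin N) :
    a i ≤ ∑ j, overlap U W i j * b j +
      ‖localDiag d U (fun i => (a i : ℂ)) - localDiag d W (fun i => (b i : ℂ))‖ := by
  set X := unitaryDiag U (fun i => (a i : ℂ)) - unitaryDiag W (fun i => (b i : ℂ)) with hX
  have h1 : (star (U : Matrix (Λ → Fin N) (Λ → Fin N) ℂ) * X * U) i i =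
      ((a i - ∑ j, overlap U W i j * b j : ℝ) : ℂ) := by
    rw [hX, mul_sub, sub_mul, Matrix.sub_apply, conj_unitaryDiag_diag, conj_unitaryDiag_diag]
    simp only [overlap]
    have h0 : (star U * U : Matrix.unitaryGroup (Λ → Fin N) ℂ) = 1 :=
      Unitary.star_mul_self U
    rw [h0, Finset.sum_eq_single i]
    · push_cast
      simp
    · intro j _ hj
      simp [Matrix.one_apply_ne hj.symm]
    · simp
  have hU : localEmbed d N Λ (U : Matrix (Λ → Fin N) (Λ → Fin N) ℂ) ∈ unitary (ConfigOp d N) :=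
    ⟨by rw [← map_star, ← map_mul, Unitary.star_mul_self_of_mem U.2, map_one],
      by rw [← map_star, ← map_mul, Unitary.mul_star_self_of_mem U.2, map_one]⟩
  have h2 : ‖localEmbed d N Λ (star (U : Matrix (Λ → Fin N) (Λ → Fin N) ℂ) * X * U)‖ =
      ‖localEmbed d N Λ X‖ := by
    rw [map_mul, map_mul, map_star, CStarRing.norm_mul_mem_unitary _ hU,
      CStarRing.norm_mem_unitary_mul _ (Unitary.star_mem hU)]
  have h3 := norm_matElem_le (localEmbed d N Λ
    (star (U : Matrix (Λ → Fin N) (Λ → Fin N) ℂ) * X * U)) (extendConfig Λ i) (extendConfig Λ i)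
  have h4 : matElem (localEmbed d N Λ (star (U : Matrix (Λ → Fin N) (Λ → Fin N) ℂ) * X * U))
      (extendConfig Λ i) (extendConfig Λ i) =
      (star (U : Matrix (Λ → Fin N) (Λ → Fin N) ℂ) * X * U) i i := by
    classical
    refine (matElem_localOp Λ _ _ _).trans ?_
    rw [patch_restrict, if_pos rfl, restrict_extend]
  rw [h4, h1, h2, hX, map_sub, Complex.norm_real] at h3
  have h5 := le_trans (le_abs_self _) h3
  change a i ≤ _ + ‖localEmbed d N Λ _ - localEmbed d N Λ _‖
  exact sub_le_iff_le_add'.1 h5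

/-- The Peierls-Bogoliubov bound: `log tr e^A` is a 1-Lipschitz function of `A`. -/
theorem partitionFn_le {A B : ConfigOp d N} (hA : A ∈ (localEmbed d N Λ).range)
    (hB : B ∈ (localEmbed d N Λ).range) (hAsa : IsSelfAdjoint A) (hBsa : IsSelfAdjoint B) :
    partitionFn Λ A ≤ Real.exp ‖A - B‖ * partitionFn Λ B := by
  obtain ⟨U, a, rfl⟩ := exists_localDiag hA hAsa
  obtain ⟨W, b, rfl⟩ := exists_localDiag hB hBsa
  rw [partitionFn, partitionFn, localTrace_exp_localDiag, localTrace_exp_localDiag,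
    Complex.ofReal_re, Complex.ofReal_re]
  have key := localDiag_conj_le (d := d) U W a b
  set δ := ‖localDiag d U (fun i => (a i : ℂ)) - localDiag d W (fun i => (b i : ℂ))‖
  -- Jensen's inequality for the row of overlaps. The columns also sum to one, so summing over `i`
  -- reassembles the trace of the exponential of the second operator.
  have h1 : ∀ i, Real.exp (a i) ≤ Real.exp δ * ∑ j, overlap U W i j *
      Real.exp (b j) := by
    intro i
    have hj := convexOn_exp.map_sum_le (t := Finset.univ)
      (w := fun j => overlap U W i j) (p := b)
      (fun j _ => overlap_nonneg U W i j) (sum_overlap_right U W i) (fun _ _ => Set.mem_univ _)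
    simp only [smul_eq_mul] at hj
    calc Real.exp (a i) ≤ Real.exp (∑ j, overlap U W i j * b j + δ) :=
          Real.exp_le_exp.2 (key i)
      _ = Real.exp δ * Real.exp (∑ j, overlap U W i j * b j) := by
          rw [add_comm, Real.exp_add]
      _ ≤ _ := mul_le_mul_of_nonneg_left hj (Real.exp_pos _).le
  calc ∑ i, Real.exp (a i) ≤ ∑ i, Real.exp δ * ∑ j, overlap U W i j *
      Real.exp (b j) := Finset.sum_le_sum fun i _ => h1 i
    _ = Real.exp δ * ∑ j, ∑ i, overlap U W i j * Real.exp (b j) := by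
        rw [← Finset.mul_sum, Finset.sum_comm]
    _ = Real.exp δ * ∑ j, Real.exp (b j) := by
        simp only [← Finset.sum_mul, sum_overlap_left, one_mul]

theorem abs_log_partitionFn_sub_le {A B : ConfigOp d N} (hA : A ∈ (localEmbed d N Λ).range)
    (hB : B ∈ (localEmbed d N Λ).range) (hAsa : IsSelfAdjoint A) (hBsa : IsSelfAdjoint B) :
    |Real.log (partitionFn Λ A) - Real.log (partitionFn Λ B)| ≤ ‖A - B‖ := by
  have h : ∀ {A B : ConfigOp d N}, A ∈ (localEmbed d N Λ).range → B ∈ (localEmbed d N Λ).range →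
      IsSelfAdjoint A → IsSelfAdjoint B →
      Real.log (partitionFn Λ A) - Real.log (partitionFn Λ B) ≤ ‖A - B‖ := by
    intro A B hA hB hAsa hBsa
    have h1 := Real.log_le_log (partitionFn_pos hA hAsa) (partitionFn_le hA hB hAsa hBsa)
    rw [Real.log_mul (Real.exp_pos _).ne' (partitionFn_pos hB hBsa).ne', Real.log_exp] at h1
    linarith
  rw [abs_le]
  have h2 := h hB hA hBsa hAsa
  rw [norm_sub_rev] at h2
  exact ⟨by linarith, h hA hB hAsa hBsa⟩

/-- The weights with which `e^{-H}` charges the eigenvalues of `K`. -/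
theorem exists_spectral_weights {K H : ConfigOp d N} (hK : K ∈ (localEmbed d N Λ).range)
    (hH : H ∈ (localEmbed d N Λ).range) (hKsa : IsSelfAdjoint K) (hHsa : IsSelfAdjoint H) :
    ∃ k w : (Λ → Fin N) → ℝ, (∀ i, 0 ≤ w i) ∧
      (∀ (r : ℝ) (B : Set ℝ), localTrace Λ (spectralProj B ((r : ℂ) • K) * NormedSpace.exp (-H)) =
        ((∑ i, B.indicator (fun _ => 1) (r * k i) * w i : ℝ) : ℂ)) ∧
      (Commute K H →
        (∀ α : ℝ, partitionFn Λ (-H + (α : ℂ) • K) = ∑ i, w i * Real.exp (α * k i)) ∧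
        (∀ c y : ℝ, partitionFn Λ (-H - (c : ℂ) • (K - (y : ℂ) • 1) ^ 2) =
          ∑ i, w i * Real.exp (-(c * (k i - y) ^ 2)))) := by
  obtain ⟨U, k, rfl⟩ := exists_localDiag hK hKsa
  obtain ⟨W, h, hW⟩ := exists_localDiag (neg_mem hH) hHsa.neg
  -- These are the diagonal elements of `e^{-H}` in an eigenbasis of `K`. They need no commutation.
  set w : (Λ → Fin N) → ℝ := fun i => ∑ j, overlap U W i j * Real.exp (h j) with hw
  have htr : ∀ f : (Λ → Fin N) → ℂ, localTrace Λ (localDiag d U f * NormedSpace.exp (-H)) =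
      ∑ i, f i * (w i : ℂ) := by
    intro f
    rw [hW, exp_localDiag, localTrace_localDiag_mul]
  -- Commutation enters here: the exponential of the sum splits into a function of `K` times
  -- `e^{-H}`.
  have hexp : ∀ f : (Λ → Fin N) → ℝ,
      Commute (localDiag d U (fun i => (f i : ℂ))) (-H) →
      partitionFn Λ (-H + localDiag d U (fun i => (f i : ℂ))) = ∑ i, w i * Real.exp (f i) := by
    intro f hcomm
    let _ : NormedAlgebra ℚ (ConfigOp d N) := NormedAlgebra.restrictScalars ℚ ℂ _
    rw [partitionFn, add_comm, NormedSpace.exp_add_of_commute hcomm, exp_localDiag, htr]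
    rw [Complex.re_sum]
    refine Finset.sum_congr rfl fun i _ => ?_
    rw [← Complex.ofReal_mul, Complex.ofReal_re, mul_comm]
  refine ⟨k, w, fun i => Finset.sum_nonneg fun j _ =>
    mul_nonneg (overlap_nonneg U W i j) (Real.exp_pos _).le, fun r B => ?_, fun hcomm =>
    ⟨fun α => ?_, fun c y => ?_⟩⟩
  · have h1 : (r : ℂ) • localDiag d U (fun i => (k i : ℂ)) =
        localDiag d U (fun i => ((r * k i : ℝ) : ℂ)) := by
      rw [← map_smul]; congr 1; funext i; simp
    rw [h1, spectralProj_localDiag, htr, Complex.ofReal_sum]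
    refine Finset.sum_congr rfl fun i _ => ?_
    by_cases hi : r * k i ∈ B <;> simp [hi]
  · have h1 : (α : ℂ) • localDiag d U (fun i => (k i : ℂ)) =
        localDiag d U (fun i => ((α * k i : ℝ) : ℂ)) := by
      rw [← map_smul]; congr 1; funext i; simp
    have h2 : Commute (localDiag d U (fun i => ((α * k i : ℝ) : ℂ))) (-H) := by
      rw [← h1]; exact (hcomm.smul_left _).neg_right
    rw [h1, hexp _ h2]
  · have h1 : -((c : ℂ) • (localDiag d U (fun i => (k i : ℂ)) - (y : ℂ) • 1) ^ 2) =
        localDiag d U (fun i => ((-(c * (k i - y) ^ 2) : ℝ) : ℂ)) := by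
      rw [← map_one (localDiag d U), ← map_smul, ← map_sub, ← map_pow, ← map_smul, ← map_neg]
      congr 1; funext i; simp
    have h2 : Commute (localDiag d U (fun i => ((-(c * (k i - y) ^ 2) : ℝ) : ℂ))) (-H) := by
      rw [← h1]
      exact ((((hcomm.sub_left ((Commute.one_left _).smul_left _)).pow_left 2).smul_left
        _).neg_left).neg_right
    rw [sub_eq_add_neg, h1, hexp _ h2]

end TraceInequality

/-! ### Energy cost of cutting a region into pieces -/

section TileApproximation

namespace Interaction

variable {d N : ℕ} {𝔄 : StarSubalgebra ℂ (Matrix (Fin N) (Fin N) ℂ)}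

/-- The contribution of `X` to `‖Ψ‖`. -/
def weight (Ψ : Interaction d 𝔄) (X : Finset (Fin d → ℤ)) : ℝ :=
  {X : Finset (Fin d → ℤ) | 0 ∈ X}.indicator (fun X => ((X.card : ℝ))⁻¹ * ‖Ψ.term X‖) X

/-- `‖Ψ‖ = ∑_{X ∋ 0} |X|⁻¹ ‖ψ_X‖`. -/
def normValue (Ψ : Interaction d 𝔄) : ℝ := ∑' X, Ψ.weight X

theorem weight_nonneg (Ψ : Interaction d 𝔄) (X : Finset (Fin d → ℤ)) : 0 ≤ Ψ.weight X :=
  Set.indicator_nonneg (fun _ _ => by positivity) _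

theorem normValue_nonneg (Ψ : Interaction d 𝔄) : 0 ≤ Ψ.normValue :=
  tsum_nonneg Ψ.weight_nonneg

theorem summable_weight {Ψ : Interaction d 𝔄} (hΨ : Ψ.NormFinite) : Summable Ψ.weight :=
  summable_subtype_iff_indicator.1 hΨ

theorem norm_term_map_le (Ψ : Interaction d 𝔄) (x : Fin d → ℤ) (X : Finset (Fin d → ℤ)) :
    ‖Ψ.term (X.map (addRightEmbedding x))‖ ≤ ‖Ψ.term X‖ := by
  rw [← Ψ.translation]; exact norm_latticeTranslate_le _ _

/-- Translating by `-x` brings `x` to the origin, where the summand is one of those in the norm of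
the interaction. -/
theorem inv_card_mul_norm_le_weight (Ψ : Interaction d 𝔄) {x : Fin d → ℤ}
    {X : Finset (Fin d → ℤ)} (hx : x ∈ X) :
    ((X.card : ℝ))⁻¹ * ‖Ψ.term X‖ ≤ Ψ.weight (X.map (addRightEmbedding (-x))) := by
  have h0 : (0 : Fin d → ℤ) ∈ X.map (addRightEmbedding (-x)) :=
    Finset.mem_map.2 ⟨x, hx, by simp⟩
  have h1 : (X.map (addRightEmbedding (-x))).map (addRightEmbedding x) = X := by
    ext y; simp
  rw [weight, Set.indicator_of_mem (s := {X : Finset (Fin d → ℤ) | 0 ∈ X}) h0, Finset.card_map]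
  refine mul_le_mul_of_nonneg_left ?_ (by positivity)
  conv_lhs => rw [← h1]
  exact Ψ.norm_term_map_le _ _

/-- Double counting: a nonempty `X` is met once at each of its `|X|` sites, each time with weight
`|X|⁻¹`. -/
theorem sum_norm_term_eq (Ψ : Interaction d 𝔄) (Λ : Finset (Fin d → ℤ))
    (S : Finset (Finset (Fin d → ℤ))) (hS : ∀ X ∈ S, X ⊆ Λ ∧ X.Nonempty) :
    ∑ X ∈ S, ‖Ψ.term X‖ =
      ∑ x ∈ Λ, ∑ X ∈ S.filter (fun X => x ∈ X), ((X.card : ℝ))⁻¹ * ‖Ψ.term X‖ := by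
  simp only [Finset.sum_filter]
  rw [Finset.sum_comm]
  refine Finset.sum_congr rfl fun X hX => ?_
  rw [← Finset.sum_filter, Finset.sum_const, Finset.filter_mem_eq_inter,
    Finset.inter_eq_right.2 (hS X hX).1, nsmul_eq_mul, ← mul_assoc, mul_inv_cancel₀, one_mul]
  have := (hS X hX).2.card_pos
  positivity

theorem sum_inv_card_le (Ψ : Interaction d 𝔄) (x : Fin d → ℤ)
    (S : Finset (Finset (Fin d → ℤ))) :
    ∑ X ∈ S.filter (fun X => x ∈ X), ((X.card : ℝ))⁻¹ * ‖Ψ.term X‖ ≤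
      ∑ Y ∈ (S.filter (fun X => x ∈ X)).map
        (Finset.mapEmbedding (addRightEmbedding (-x))).toEmbedding, Ψ.weight Y := by
  rw [Finset.sum_map]
  exact Finset.sum_le_sum fun X hX =>
    Ψ.inv_card_mul_norm_le_weight (Finset.mem_filter.1 hX).2

/-- The cost of replacing `K_Λ` by the sum of the Hamiltonians of disjoint subregions, when the
sites of `D` only see, up to `ε`, the subregion that they belong to. -/
theorem norm_hamiltonian_sub_sum_le {Ψ : Interaction d 𝔄} (hΨ : Ψ.NormFinite) {ε : ℝ}
    (hε : 0 ≤ ε) (F : Finset (Finset (Fin d → ℤ)))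
    (hF : ∀ t, Disjoint t F → ∑ X ∈ t, Ψ.weight X ≤ ε) (Λ : Finset (Fin d → ℤ))
    {ι : Type*} (I : Finset ι) (C : ι → Finset (Fin d → ℤ))
    (hC : (I : Set ι).PairwiseDisjoint C) (hCΛ : ∀ j ∈ I, C j ⊆ Λ)
    (D : Finset (Fin d → ℤ)) (hDΛ : D ⊆ Λ)
    (hD : ∀ x ∈ D, ∀ X : Finset (Fin d → ℤ), x ∈ X → X.map (addRightEmbedding (-x)) ∈ F →
      ∃ j ∈ I, X ⊆ C j) :
    ‖Ψ.hamiltonian Λ - ∑ j ∈ I, Ψ.hamiltonian (C j)‖ ≤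
      Λ.card * ε + (Λ.card - D.card) * Ψ.normValue + (1 + I.card) * ‖Ψ.term ∅‖ := by
  classical
  -- The empty set lies in every subregion and would be counted once for each, so its term is
  -- treated apart.
  have hpow : ∀ Λ : Finset (Fin d → ℤ),
      Ψ.hamiltonian Λ = ∑ X ∈ Λ.powerset.erase ∅, Ψ.term X + Ψ.term ∅ := by
    intro Λ
    rw [hamiltonian, Finset.sum_erase_add _ _ (Finset.empty_mem_powerset Λ)]
  set G := I.biUnion (fun j => (C j).powerset.erase ∅) with hG
  have hGsum : ∑ X ∈ G, Ψ.term X = ∑ j ∈ I, ∑ X ∈ (C j).powerset.erase ∅, Ψ.term X := by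
    refine Finset.sum_biUnion fun i hi j hj hij => ?_
    refine Finset.disjoint_left.2 fun X hX hX' => ?_
    simp only [Finset.mem_erase, Finset.mem_powerset] at hX hX'
    obtain ⟨y, hy⟩ := Finset.nonempty_iff_ne_empty.2 hX.1
    exact Finset.disjoint_left.1 (hC hi hj hij) (hX.2 hy) (hX'.2 hy)
  have hGsub : G ⊆ Λ.powerset.erase ∅ := by
    intro X hX
    simp only [hG, Finset.mem_biUnion, Finset.mem_erase, Finset.mem_powerset] at hX ⊢
    obtain ⟨j, hj, h1, h2⟩ := hX
    exact ⟨h1, h2.trans (hCΛ j hj)⟩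
  -- The nonempty sets contained in no single piece: exactly the bonds that are cut.
  set S := Λ.powerset.erase ∅ \ G with hSdef
  have hdecomp : Ψ.hamiltonian Λ - ∑ j ∈ I, Ψ.hamiltonian (C j) =
      ∑ X ∈ S, Ψ.term X + (1 - (I.card : ℂ)) • Ψ.term ∅ := by
    simp only [hpow, Finset.sum_add_distrib]
    rw [← hGsum, ← Finset.sum_sdiff hGsub, Finset.sum_const, sub_smul, one_smul,
      Nat.cast_smul_eq_nsmul]
    abel
  have hS : ∀ X ∈ S, X ⊆ Λ ∧ X.Nonempty := by
    intro X hX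
    have := (Finset.mem_sdiff.1 hX).1
    simp only [Finset.mem_erase, Finset.mem_powerset] at this
    exact ⟨this.2, Finset.nonempty_iff_ne_empty.2 this.1⟩
  have hsite : ∀ x, ∑ X ∈ S.filter (fun X => x ∈ X), ((X.card : ℝ))⁻¹ * ‖Ψ.term X‖ ≤
      Ψ.normValue := fun x => (Ψ.sum_inv_card_le x S).trans
    ((summable_weight hΨ).sum_le_tsum _ fun _ _ => Ψ.weight_nonneg _)
  -- Around a site of `D`, a set whose shape is in `F` fits into one piece. The cut bonds through
  -- that site thus have shapes outside `F`, of total weight at most `ε`. Other sites pay the full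
  -- norm.
  have hsiteD : ∀ x ∈ D, ∑ X ∈ S.filter (fun X => x ∈ X), ((X.card : ℝ))⁻¹ * ‖Ψ.term X‖ ≤
      ε := by
    intro x hx
    refine (Ψ.sum_inv_card_le x S).trans (hF _ ?_)
    refine Finset.disjoint_left.2 fun Y hY hYF => ?_
    obtain ⟨X, hX, rfl⟩ := Finset.mem_map.1 hY
    obtain ⟨hXS, hxX⟩ := Finset.mem_filter.1 hX
    obtain ⟨j, hj, hXC⟩ := hD x hx X hxX hYF
    refine (Finset.mem_sdiff.1 hXS).2 ?_
    simp only [hG, Finset.mem_biUnion, Finset.mem_erase, Finset.mem_powerset]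
    exact ⟨j, hj, ⟨x, hxX⟩ |> Finset.nonempty_iff_ne_empty.1, hXC⟩
  have h1 : ‖∑ X ∈ S, Ψ.term X‖ ≤ Λ.card * ε + (Λ.card - D.card) * Ψ.normValue := by
    calc ‖∑ X ∈ S, Ψ.term X‖ ≤ ∑ X ∈ S, ‖Ψ.term X‖ := norm_sum_le _ _
      _ = _ := Ψ.sum_norm_term_eq Λ S hS
      _ = ∑ x ∈ Λ \ D, ∑ X ∈ S.filter (fun X => x ∈ X), ((X.card : ℝ))⁻¹ * ‖Ψ.term X‖ +
          ∑ x ∈ D, ∑ X ∈ S.filter (fun X => x ∈ X), ((X.card : ℝ))⁻¹ * ‖Ψ.term X‖ :=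
        (Finset.sum_sdiff hDΛ).symm
      _ ≤ ∑ x ∈ Λ \ D, Ψ.normValue + ∑ x ∈ D, ε :=
        add_le_add (Finset.sum_le_sum fun x _ => hsite x) (Finset.sum_le_sum hsiteD)
      _ = (Λ.card - D.card) * Ψ.normValue + D.card * ε := by
        rw [Finset.sum_const, Finset.sum_const, nsmul_eq_mul, nsmul_eq_mul,
          Finset.card_sdiff_of_subset hDΛ, Nat.cast_sub (Finset.card_le_card hDΛ)]
      _ ≤ _ := by
        have : (D.card : ℝ) ≤ Λ.card := by exact_mod_cast Finset.card_le_card hDΛ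
        nlinarith [mul_le_mul_of_nonneg_right this hε]
  rw [hdecomp]
  refine (norm_add_le _ _).trans (add_le_add h1 ?_)
  rw [norm_smul]
  refine mul_le_mul_of_nonneg_right ?_ (norm_nonneg _)
  refine (norm_sub_le _ _).trans ?_
  simp

theorem norm_hamiltonian_le {Ψ : Interaction d 𝔄} (hΨ : Ψ.NormFinite)
    (Λ : Finset (Fin d → ℤ)) :
    ‖Ψ.hamiltonian Λ‖ ≤ Λ.card * Ψ.normValue + ‖Ψ.term ∅‖ := by
  have hz : ‖Ψ.hamiltonian Λ - Ψ.term ∅‖ ≤ Λ.card * Ψ.normValue := by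
    rw [hamiltonian, ← Finset.sum_erase_add _ _ (Finset.empty_mem_powerset Λ), add_sub_cancel_right]
    refine (norm_sum_le _ _).trans ?_
    rw [Ψ.sum_norm_term_eq Λ _ fun X hX => ⟨Finset.mem_powerset.1 (Finset.mem_erase.1 hX).2,
      Finset.nonempty_iff_ne_empty.2 (Finset.mem_erase.1 hX).1⟩, ← nsmul_eq_mul,
      ← Finset.sum_const]
    exact Finset.sum_le_sum fun x _ => (Ψ.sum_inv_card_le x _).trans
      ((summable_weight hΨ).sum_le_tsum _ fun _ _ => Ψ.weight_nonneg _)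
  calc ‖Ψ.hamiltonian Λ‖ = ‖(Ψ.hamiltonian Λ - Ψ.term ∅) + Ψ.term ∅‖ := by rw [sub_add_cancel]
    _ ≤ _ := (norm_add_le _ _).trans (add_le_add_left hz _)

theorem isSelfAdjoint_hamiltonian (Ψ : Interaction d 𝔄) (Λ : Finset (Fin d → ℤ)) :
    IsSelfAdjoint (Ψ.hamiltonian Λ) :=
  isSelfAdjoint_sum _ fun X _ => Ψ.selfAdjoint X

theorem hamiltonian_map (Ψ : Interaction d 𝔄) (x : Fin d → ℤ) (Λ : Finset (Fin d → ℤ)) :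
    Ψ.hamiltonian (Λ.map (addRightEmbedding x)) = latticeTranslate x (Ψ.hamiltonian Λ) := by
  rw [hamiltonian, hamiltonian, latticeTranslate_sum]
  symm
  refine Finset.sum_bij' (fun X _ => X.map (addRightEmbedding x))
    (fun X _ => X.map (addRightEmbedding (-x))) ?_ ?_ ?_ ?_ ?_
  · intro X hX
    exact Finset.mem_powerset.2 (Finset.map_subset_map.2 (Finset.mem_powerset.1 hX))
  · intro X hX
    refine Finset.mem_powerset.2 fun y hy => ?_
    obtain ⟨z, hz, rfl⟩ := Finset.mem_map.1 hy
    obtain ⟨w, hw, rfl⟩ := Finset.mem_map.1 (Finset.mem_powerset.1 hX hz)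
    simpa using hw
  · intro X _; ext y; simp
  · intro X _; ext y; simp
  · intro X _; exact Ψ.translation x X

end Interaction

end TileApproximation

/-! ### Tilings of large cubes -/

section Tiling

variable {d : ℕ}

theorem mem_cube {a : Fin d → ℤ} {m : ℕ} {x : Fin d → ℤ} :
    x ∈ cube a m ↔ ∀ i, a i ≤ x i ∧ x i < a i + m := by
  simp [cube]

theorem card_cube (a : Fin d → ℤ) (m : ℕ) : (cube a m).card = m ^ d := by
  simp [cube]

theorem cube_add (a x : Fin d → ℤ) (m : ℕ) :
    cube (a + x) m = (cube a m).map (addRightEmbedding x) := by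
  ext y
  rw [Finset.mem_map, mem_cube]
  constructor
  · intro h
    refine ⟨y - x, mem_cube.2 fun i => ?_, by simp⟩
    have := h i
    simp only [Pi.add_apply, Pi.sub_apply] at this ⊢
    omega
  · rintro ⟨z, hz, rfl⟩ i
    have := mem_cube.1 hz i
    simp only [Pi.add_apply, addRightEmbedding_apply]
    omega

/-- The tile with index `j` in the tiling of the lattice by cubes of side `m`. -/
def tile (m : ℕ) (j : Fin d → ℤ) : Finset (Fin d → ℤ) := cube ((m : ℤ) • j) m

theorem tile_eq_map (m : ℕ) (j : Fin d → ℤ) :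
    tile m j = (cube 0 m).map (addRightEmbedding ((m : ℤ) • j)) := by
  rw [tile, ← cube_add, zero_add]

theorem tile_subset {m q n : ℕ} (h : m * q ≤ n) {j : Fin d → ℤ} (hj : j ∈ cube 0 q) :
    tile m j ⊆ cube 0 n := by
  intro x hx
  refine mem_cube.2 fun i => ?_
  have h1 := mem_cube.1 hx i
  have h2 := mem_cube.1 hj i
  simp only [Pi.smul_apply, smul_eq_mul, Pi.zero_apply, zero_add] at h1 h2 ⊢
  have h3 : (m : ℤ) * j i + m ≤ m * q := by
    have : (m : ℤ) * (j i + 1) ≤ m * q := mul_le_mul_of_nonneg_left (by omega) (by positivity)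
    linarith
  have h4 : (m : ℤ) * q ≤ n := by exact_mod_cast h
  have h5 : 0 ≤ (m : ℤ) * j i := mul_nonneg (by positivity) h2.1
  omega

/-- Coordinatewise floor division by `m` recovers the index from any site of the tile. -/
theorem eq_of_mem_tile {m : ℕ} {j j' x : Fin d → ℤ} (hj : x ∈ tile m j) (hj' : x ∈ tile m j') :
    j = j' := by
  have key : ∀ {j : Fin d → ℤ}, x ∈ tile m j → ∀ i, x i / m = j i := by
    intro j hj i
    have h1 := mem_cube.1 hj i
    simp only [Pi.smul_apply, smul_eq_mul] at h1
    have hm : (0 : ℤ) < m := by omega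
    rw [Int.ediv_eq_iff_of_pos hm]
    constructor <;> nlinarith
  funext i
  rw [← key hj i, ← key hj' i]

theorem pairwiseDisjoint_tile (m : ℕ) (I : Set (Fin d → ℤ)) : I.PairwiseDisjoint (tile m) :=
  fun _ _ _ _ hij => Finset.disjoint_left.2 fun _ h h' => hij (eq_of_mem_tile h h')

/-- The sites of the tile `j` at distance at least `R` from its complement. -/
def tileInterior (m R : ℕ) (j : Fin d → ℤ) : Finset (Fin d → ℤ) :=
  cube ((m : ℤ) • j + fun _ => (R : ℤ)) (m - 2 * R)

theorem tileInterior_subset (m R : ℕ) (j : Fin d → ℤ) : tileInterior m R j ⊆ tile m j := by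
  intro x hx
  refine mem_cube.2 fun i => ?_
  have h1 := mem_cube.1 hx i
  simp only [Pi.add_apply] at h1
  omega

theorem mem_tile_of_near {m R : ℕ} {j x y : Fin d → ℤ} (hx : x ∈ tileInterior m R j)
    (hy : ∀ i, |y i - x i| ≤ R) : y ∈ tile m j := by
  refine mem_cube.2 fun i => ?_
  have h1 := mem_cube.1 hx i
  have h2 := abs_le.1 (hy i)
  simp only [Pi.add_apply] at h1
  omega

theorem tendsto_natDiv_mul_div {m : ℕ} (hm : 0 < m) :
    Tendsto (fun n : ℕ => ((n / m : ℕ) : ℝ) * m / n) atTop (𝓝 1) := by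
  have hm' : (0 : ℝ) < m := by exact_mod_cast hm
  have h := (tendsto_nat_floor_mul_div_atTop (R := ℝ) (a := (m : ℝ)⁻¹) (by positivity)).comp
    tendsto_natCast_atTop_atTop
  have h2 := h.mul_const (m : ℝ)
  rw [inv_mul_cancel₀ hm'.ne'] at h2
  refine h2.congr fun n => ?_
  simp only [Function.comp]
  rw [inv_mul_eq_div, Nat.floor_div_eq_div]
  ring

/-- The fraction of the sites of a large cube that are covered by tiles. -/
theorem tendsto_coverage (d : ℕ) {m : ℕ} (hm : 0 < m) :
    Tendsto (fun n : ℕ => (((n / m) ^ d : ℕ) : ℝ) * (m : ℝ) ^ d / (n : ℝ) ^ d) atTop (𝓝 1) := by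
  have h := (tendsto_natDiv_mul_div hm).pow d
  rw [one_pow] at h
  refine h.congr fun n => ?_
  rw [div_pow, mul_pow]
  push_cast
  rfl

namespace Interaction

variable {N : ℕ} {𝔄 : StarSubalgebra ℂ (Matrix (Fin N) (Fin N) ℂ)}

/-- The sum of the Hamiltonians of the `q^d` tiles of side `m` in the cube of side `m q`. -/
def tiled (Ψ : Interaction d 𝔄) (m q : ℕ) : ConfigOp d N :=
  ∑ j ∈ cube 0 q, Ψ.hamiltonian (tile m j)

theorem norm_hamiltonian_sub_tiled_le {Ψ : Interaction d 𝔄} (hΨ : Ψ.NormFinite) {ε : ℝ}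
    (hε : 0 < ε) : ∃ R : ℕ, ∀ m q n : ℕ, m * q ≤ n →
      ‖Ψ.hamiltonian (cube 0 n) - Ψ.tiled m q‖ ≤ (n : ℝ) ^ d * ε +
        ((n : ℝ) ^ d - ((q ^ d : ℕ) : ℝ) * ((m - 2 * R : ℕ) : ℝ) ^ d) * Ψ.normValue +
          (1 + ((q ^ d : ℕ) : ℝ)) * ‖Ψ.term ∅‖ := by
  classical
  -- Finitely many shapes carry all but `ε` of the norm. Their common reach `R` is independent of
  -- the sizes of tiles and cube, so only sites within about `R` of a tile boundary, or outside all
  -- tiles, pay more than `ε`.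
  obtain ⟨F, hF⟩ := summable_iff_vanishing_norm.1 (summable_weight hΨ) ε hε
  obtain ⟨R, hR⟩ : ∃ R : ℕ, ∀ Y ∈ F, ∀ y ∈ Y, ∀ i, |y i| ≤ R := by
    refine ⟨∑ Y ∈ F, ∑ y ∈ Y, ∑ i, (y i).natAbs, fun Y hY y hy i => ?_⟩
    have h1 : (y i).natAbs ≤ ∑ i, (y i).natAbs :=
      Finset.single_le_sum (f := fun i => (y i).natAbs) (fun _ _ => Nat.zero_le _)
        (Finset.mem_univ i)
    have h2 : ∑ i, (y i).natAbs ≤ ∑ y ∈ Y, ∑ i, (y i).natAbs :=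
      Finset.single_le_sum (f := fun y : Fin d → ℤ => ∑ i, (y i).natAbs)
        (fun _ _ => Nat.zero_le _) hy
    have h3 : ∑ y ∈ Y, ∑ i, (y i).natAbs ≤ ∑ Y ∈ F, ∑ y ∈ Y, ∑ i, (y i).natAbs :=
      Finset.single_le_sum (f := fun Y : Finset (Fin d → ℤ) => ∑ y ∈ Y, ∑ i, (y i).natAbs)
        (fun _ _ => Nat.zero_le _) hY
    rw [Int.abs_eq_natAbs]
    exact_mod_cast h1.trans (h2.trans h3)
  refine ⟨R, fun m q n hmq => ?_⟩
  set D := (cube (0 : Fin d → ℤ) q).biUnion (tileInterior m R) with hDdef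
  have hcard : D.card = q ^ d * (m - 2 * R) ^ d := by
    rw [hDdef, Finset.card_biUnion]
    · simp only [tileInterior, card_cube, Finset.sum_const, smul_eq_mul]
    · intro i _ j _ hij
      exact Finset.disjoint_left.2 fun x hx hx' =>
        hij (eq_of_mem_tile (tileInterior_subset m R _ hx) (tileInterior_subset m R _ hx'))
  have h := norm_hamiltonian_sub_sum_le hΨ hε.le F
    (fun t ht => (le_abs_self _).trans (hF t ht).le) (cube 0 n) (cube 0 q) (tile m)
    (pairwiseDisjoint_tile m _) (fun j hj => tile_subset hmq hj) D
    (Finset.biUnion_subset.2 fun j hj => (tileInterior_subset m R j).trans (tile_subset hmq hj))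
    (fun x hx X _ hXF => by
      obtain ⟨j, hj, hxj⟩ := Finset.mem_biUnion.1 hx
      refine ⟨j, hj, fun y hy => mem_tile_of_near hxj fun i => ?_⟩
      have := hR _ hXF (y - x) (Finset.mem_map.2 ⟨y, hy, by simp [sub_eq_add_neg]⟩) i
      simpa using this)
  rw [hcard, card_cube, card_cube] at h
  push_cast at h ⊢
  exact h

/-- A large cube is well approximated by a union of large independent tiles. -/
theorem eventually_norm_sub_tiled_le (hd : 0 < d) {Ψ : Interaction d 𝔄} (hΨ : Ψ.NormFinite)
    {ε : ℝ} (hε : 0 < ε) : ∀ᶠ m : ℕ in atTop, ∀ᶠ n : ℕ in atTop,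
      ‖Ψ.hamiltonian (cube 0 n) - Ψ.tiled m (n / m)‖ ≤ ε * (n : ℝ) ^ d := by
  obtain ⟨R, hR⟩ := norm_hamiltonian_sub_tiled_le hΨ (half_pos hε)
  -- This is the cost per site after `n → ∞` at fixed `m`: half of `ε`, the boundary fraction of a
  -- tile, and one empty-set term per tile. The last two vanish as `m` grows.
  have hlim : Tendsto (fun m : ℕ => ε / 2 + (1 - (((m - 2 * R : ℕ) : ℝ) / m) ^ d) * Ψ.normValue +
      (0 + 1 / (m : ℝ) ^ d) * ‖Ψ.term ∅‖) atTop
      (𝓝 (ε / 2 + (1 - 1 ^ d) * Ψ.normValue + (0 + 0) * ‖Ψ.term ∅‖)) := by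
    have h1 : Tendsto (fun m : ℕ => ((m - 2 * R : ℕ) : ℝ) / m) atTop (𝓝 1) := by
      have h2 : Tendsto (fun m : ℕ => 1 - ((2 * R : ℕ) : ℝ) / m) atTop (𝓝 (1 - 0)) :=
        tendsto_const_nhds.sub (tendsto_const_div_atTop_nhds_zero_nat _)
      rw [sub_zero] at h2
      refine h2.congr' ?_
      filter_upwards [eventually_ge_atTop (2 * R + 1)] with m hm
      have hm0 : (m : ℝ) ≠ 0 := by
        have : 0 < m := by omega
        positivity
      rw [Nat.cast_sub (by omega), sub_div, div_self hm0]
    have h3 : Tendsto (fun m : ℕ => 1 / (m : ℝ) ^ d) atTop (𝓝 0) := by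
      refine tendsto_const_nhds.div_atTop ?_
      exact (tendsto_pow_atTop hd.ne').comp tendsto_natCast_atTop_atTop
    exact ((tendsto_const_nhds).add ((tendsto_const_nhds.sub (h1.pow d)).mul_const _)).add
      ((tendsto_const_nhds.add h3).mul_const _)
  have hlt : ε / 2 + (1 - 1 ^ d) * Ψ.normValue + (0 + 0) * ‖Ψ.term ∅‖ < ε := by
    simp only [one_pow, sub_self, zero_mul, add_zero]; linarith
  filter_upwards [hlim.eventually (gt_mem_nhds hlt), eventually_gt_atTop 0] with m hm hm0
  have hm0' : (0 : ℝ) < m := by exact_mod_cast hm0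
  have hlim2 : Tendsto (fun n : ℕ => ε / 2 +
      (1 - ((((n / m) ^ d : ℕ) : ℝ) * (m : ℝ) ^ d / (n : ℝ) ^ d) *
        (((m - 2 * R : ℕ) : ℝ) / m) ^ d) * Ψ.normValue +
      (1 / (n : ℝ) ^ d + ((((n / m) ^ d : ℕ) : ℝ) * (m : ℝ) ^ d / (n : ℝ) ^ d) / (m : ℝ) ^ d) *
        ‖Ψ.term ∅‖) atTop
      (𝓝 (ε / 2 + (1 - 1 * (((m - 2 * R : ℕ) : ℝ) / m) ^ d) * Ψ.normValue +
      (0 + 1 / (m : ℝ) ^ d) * ‖Ψ.term ∅‖)) := by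
    have h1 := tendsto_coverage d hm0
    have h3 : Tendsto (fun m : ℕ => 1 / (m : ℝ) ^ d) atTop (𝓝 0) := by
      refine tendsto_const_nhds.div_atTop ?_
      exact (tendsto_pow_atTop hd.ne').comp tendsto_natCast_atTop_atTop
    exact ((tendsto_const_nhds).add ((tendsto_const_nhds.sub (h1.mul_const _)).mul_const _)).add
      ((h3.add (h1.div_const _)).mul_const _)
  rw [one_mul] at hlim2
  filter_upwards [hlim2.eventually (gt_mem_nhds hm), eventually_gt_atTop 0] with n hn hn0
  have hn0' : (0 : ℝ) < (n : ℝ) ^ d := by positivity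
  refine (hR m (n / m) n (Nat.mul_div_le n m)).trans ?_
  refine le_trans (le_of_eq ?_) (mul_le_mul_of_nonneg_right hn.le hn0'.le)
  rw [div_pow]
  field_simp

end Interaction

end Tiling

/-! ### Factorised partition functions and comparison of volumes -/

section TiledPartitionFunction

variable {d N : ℕ} {𝔄 : StarSubalgebra ℂ (Matrix (Fin N) (Fin N) ℂ)}

namespace Interaction

/-- The generator `-H_Λ + α K_Λ`. -/
def generator (Φ Ψ : Interaction d 𝔄) (Λ : Finset (Fin d → ℤ)) (α : ℝ) : ConfigOp d N :=
  -Φ.hamiltonian Λ + (α : ℂ) • Ψ.hamiltonian Λ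

theorem isSelfAdjoint_ofReal_smul {A : ConfigOp d N} (hA : IsSelfAdjoint A) (α : ℝ) :
    IsSelfAdjoint ((α : ℂ) • A) :=
  IsSelfAdjoint.smul (by rw [isSelfAdjoint_iff]; simp) hA

theorem generator_mem (Φ Ψ : Interaction d 𝔄) (Λ : Finset (Fin d → ℤ)) (α : ℝ) :
    Φ.generator Ψ Λ α ∈ localAlg 𝔄 Λ :=
  add_mem (neg_mem (Φ.hamiltonian_mem Λ)) (SMulMemClass.smul_mem _ (Ψ.hamiltonian_mem Λ))

theorem isSelfAdjoint_generator (Φ Ψ : Interaction d 𝔄) (Λ : Finset (Fin d → ℤ)) (α : ℝ) :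
    IsSelfAdjoint (Φ.generator Ψ Λ α) :=
  (Φ.isSelfAdjoint_hamiltonian Λ).neg.add
    (isSelfAdjoint_ofReal_smul (Ψ.isSelfAdjoint_hamiltonian Λ) α)

theorem generator_tile (Φ Ψ : Interaction d 𝔄) (m : ℕ) (j : Fin d → ℤ) (α : ℝ) :
    Φ.generator Ψ (tile m j) α =
      latticeTranslate ((m : ℤ) • j) (Φ.generator Ψ (cube 0 m) α) := by
  rw [generator, generator, tile_eq_map, hamiltonian_map, hamiltonian_map, latticeTranslate_add,
    latticeTranslate_smul, latticeTranslate_neg]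

theorem tiled_mem (Ψ : Interaction d 𝔄) {m q n : ℕ} (h : m * q ≤ n) :
    Ψ.tiled m q ∈ localAlg 𝔄 (cube 0 n) :=
  sum_mem fun _ hj => localAlg_mono 𝔄 (tile_subset h hj) (Ψ.hamiltonian_mem _)

theorem isSelfAdjoint_tiled (Ψ : Interaction d 𝔄) (m q : ℕ) : IsSelfAdjoint (Ψ.tiled m q) :=
  isSelfAdjoint_sum _ fun _ _ => Ψ.isSelfAdjoint_hamiltonian _

/-- Within one tile this is the translated commutation at side `m`; different tiles have disjoint
supports. -/
theorem commute_tiled {Φ Ψ : Interaction d 𝔄} {m : ℕ}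
    (h : Commute (Ψ.hamiltonian (cube 0 m)) (Φ.hamiltonian (cube 0 m))) (q : ℕ) :
    Commute (Ψ.tiled m q) (Φ.tiled m q) := by
  refine Commute.sum_left _ _ _ fun i _ => Commute.sum_right _ _ _ fun j _ => ?_
  by_cases hij : i = j
  · subst hij
    rw [tile_eq_map, hamiltonian_map, hamiltonian_map, Commute, SemiconjBy,
      ← latticeTranslate_mul, ← latticeTranslate_mul, h.eq]
  · exact commute_of_mem_range (pairwiseDisjoint_tile m Set.univ (Set.mem_univ i)
      (Set.mem_univ j) hij) (localAlg_le_range 𝔄 _ (Ψ.hamiltonian_mem _))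
      (localAlg_le_range 𝔄 _ (Φ.hamiltonian_mem _))

end Interaction

variable [NeZero N]

/-- By induction: exponents on disjoint regions commute, so the exponential is a product, over which
the trace factorises. -/
theorem localTrace_exp_sum {ι : Type*} (I : Finset ι) (C : ι → Finset (Fin d → ℤ))
    (hC : (I : Set ι).PairwiseDisjoint C) (A : ι → ConfigOp d N)
    (hA : ∀ j ∈ I, A j ∈ localAlg 𝔄 (C j)) :
    localTrace (I.biUnion C) (NormedSpace.exp (∑ j ∈ I, A j)) =
      ∏ j ∈ I, localTrace (C j) (NormedSpace.exp (A j)) := by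
  classical
  let _ : NormedAlgebra ℚ (ConfigOp d N) := NormedAlgebra.restrictScalars ℚ ℂ _
  induction I using Finset.induction_on with
  | empty => simp [localTrace_one]
  | insert j I hj ih =>
    have hdisj : Disjoint (C j) (I.biUnion C) := by
      rw [Finset.disjoint_biUnion_right]
      exact fun i hi => hC (Finset.mem_insert_self j I) (Finset.mem_insert_of_mem hi)
        (fun h => hj (h ▸ hi))
    have h1 : A j ∈ localAlg 𝔄 (C j) := hA j (Finset.mem_insert_self j I)
    have h2 : ∑ i ∈ I, A i ∈ localAlg 𝔄 (I.biUnion C) := sum_mem fun i hi =>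
      localAlg_mono 𝔄 (Finset.subset_biUnion_of_mem C hi) (hA i (Finset.mem_insert_of_mem hi))
    rw [Finset.sum_insert hj, Finset.prod_insert hj, Finset.biUnion_insert,
      NormedSpace.exp_add_of_commute (commute_of_mem_range hdisj (localAlg_le_range 𝔄 _ h1)
        (localAlg_le_range 𝔄 _ h2)),
      localTrace_mul hdisj (exp_mem_of_le_range le_rfl (localAlg_le_range 𝔄 _ h1))
        (exp_mem_of_le_range le_rfl (localAlg_le_range 𝔄 _ h2)),
      ih (hC.subset (by simp)) fun i hi => hA i (Finset.mem_insert_of_mem hi)]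

/-- Each additional site carries the identity and contributes its unnormalised trace `N`. -/
theorem localTrace_of_subset {Λ Λ' : Finset (Fin d → ℤ)} (h : Λ ⊆ Λ') {A : ConfigOp d N}
    (hA : A ∈ (localEmbed d N Λ).range) :
    localTrace Λ' A = localTrace Λ A * (N : ℂ) ^ (Λ'.card - Λ.card) := by
  classical
  have h1 := localTrace_mul (Finset.disjoint_sdiff (s := Λ) (t := Λ')) hA
    (one_mem (localEmbed d N (Λ' \ Λ)).range)
  rwa [mul_one, Finset.union_sdiff_of_subset h, localTrace_one,
    Finset.card_sdiff_of_subset h] at h1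

namespace Interaction

/-- The partition function `tr e^{-H_{Λ(n)} + α K_{Λ(n)}}`. -/
def cubePartition (Φ Ψ : Interaction d 𝔄) (n : ℕ) (α : ℝ) : ℝ :=
  partitionFn (cube 0 n) (Φ.generator Ψ (cube 0 n) α)

theorem cubePartition_pos (Φ Ψ : Interaction d 𝔄) (n : ℕ) (α : ℝ) :
    0 < Φ.cubePartition Ψ n α :=
  partitionFn_pos (localAlg_le_range 𝔄 _ (Φ.generator_mem Ψ _ α)) (Φ.isSelfAdjoint_generator Ψ _ α)

theorem localTrace_exp_generator (Φ Ψ : Interaction d 𝔄) (n : ℕ) (α : ℝ) :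
    localTrace (cube 0 n) (NormedSpace.exp (Φ.generator Ψ (cube 0 n) α)) =
      (Φ.cubePartition Ψ n α : ℂ) :=
  localTrace_exp (localAlg_le_range 𝔄 _ (Φ.generator_mem Ψ _ α)) (Φ.isSelfAdjoint_generator Ψ _ α)

/-- Independence of the tiles: the partition function of the tiled system. -/
theorem partitionFn_tiled (Φ Ψ : Interaction d 𝔄) {m q n : ℕ} (h : m * q ≤ n) (α : ℝ) :
    partitionFn (cube 0 n) (-Φ.tiled m q + (α : ℂ) • Ψ.tiled m q) =
      Φ.cubePartition Ψ m α ^ (q ^ d) * (N : ℝ) ^ (n ^ d - q ^ d * m ^ d) := by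
  have h1 : -Φ.tiled m q + (α : ℂ) • Ψ.tiled m q =
      ∑ j ∈ cube 0 q, Φ.generator Ψ (tile m j) α := by
    simp only [generator, tiled, Finset.sum_add_distrib, Finset.smul_sum, Finset.sum_neg_distrib]
  have hsub : (cube (0 : Fin d → ℤ) q).biUnion (tile m) ⊆ cube 0 n :=
    Finset.biUnion_subset.2 fun j hj => tile_subset h hj
  have hcard : ((cube (0 : Fin d → ℤ) q).biUnion (tile m)).card = q ^ d * m ^ d := by
    rw [Finset.card_biUnion (pairwiseDisjoint_tile m _)]
    simp only [tile, card_cube, Finset.sum_const, smul_eq_mul]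
  have hmem : ∑ j ∈ cube 0 q, Φ.generator Ψ (tile m j) α ∈
      localAlg 𝔄 ((cube (0 : Fin d → ℤ) q).biUnion (tile m)) := sum_mem fun j hj =>
    localAlg_mono 𝔄 (Finset.subset_biUnion_of_mem (tile m) hj) (Φ.generator_mem Ψ _ α)
  have htile : ∀ j, localTrace (tile m j) (NormedSpace.exp (Φ.generator Ψ (tile m j) α)) =
      (Φ.cubePartition Ψ m α : ℂ) := by
    intro j
    rw [generator_tile, ← latticeTranslate_exp, tile_eq_map, localTrace_latticeTranslate,
      localTrace_exp_generator]
  rw [partitionFn, h1, localTrace_of_subset hsub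
    (exp_mem_of_le_range le_rfl (localAlg_le_range 𝔄 _ hmem)),
    localTrace_exp_sum (𝔄 := 𝔄) _ _ (pairwiseDisjoint_tile m _) _
      fun j _ => Φ.generator_mem Ψ _ α, hcard, card_cube]
  simp only [htile, Finset.prod_const, card_cube]
  rw [← Complex.ofReal_natCast, ← Complex.ofReal_pow, ← Complex.ofReal_pow, ← Complex.ofReal_mul,
    Complex.ofReal_re]

/-- The finite-volume free energy density. -/
def freeEnergy (Φ Ψ : Interaction d 𝔄) (n : ℕ) (α : ℝ) : ℝ :=
  Real.log (Φ.cubePartition Ψ n α) / (n : ℝ) ^ d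

theorem abs_log_cubePartition_sub_le {Φ Ψ : Interaction d 𝔄} {ε : ℝ} {m n : ℕ} (α : ℝ)
    (hΦ : ‖Φ.hamiltonian (cube 0 n) - Φ.tiled m (n / m)‖ ≤ ε * (n : ℝ) ^ d)
    (hΨ : ‖Ψ.hamiltonian (cube 0 n) - Ψ.tiled m (n / m)‖ ≤ ε * (n : ℝ) ^ d) :
    |Real.log (Φ.cubePartition Ψ n α) - (((n / m) ^ d : ℕ) * Real.log (Φ.cubePartition Ψ m α) +
      ((n ^ d - (n / m) ^ d * m ^ d : ℕ) : ℝ) * Real.log N)| ≤ ε * (1 + |α|) * (n : ℝ) ^ d := by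
  have hmq : m * (n / m) ≤ n := Nat.mul_div_le n m
  -- The comparison term is exactly the logarithm of the tiled partition function, so only the
  -- Lipschitz bound remains.
  have h1 : ((n / m) ^ d : ℕ) * Real.log (Φ.cubePartition Ψ m α) +
      ((n ^ d - (n / m) ^ d * m ^ d : ℕ) : ℝ) * Real.log N =
      Real.log (partitionFn (cube 0 n) (-Φ.tiled m (n / m) + (α : ℂ) • Ψ.tiled m (n / m))) := by
    have hN : (N : ℝ) ≠ 0 := by exact_mod_cast NeZero.ne N
    rw [partitionFn_tiled Φ Ψ hmq, Real.log_mul (pow_pos (Φ.cubePartition_pos Ψ m α) _).ne'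
      (pow_ne_zero _ hN), Real.log_pow, Real.log_pow]
  rw [h1, cubePartition]
  refine (abs_log_partitionFn_sub_le (localAlg_le_range 𝔄 _ (Φ.generator_mem Ψ _ α))
    (localAlg_le_range 𝔄 _ (add_mem (neg_mem (Φ.tiled_mem hmq))
      (SMulMemClass.smul_mem _ (Ψ.tiled_mem hmq)))) (Φ.isSelfAdjoint_generator Ψ _ α)
    ((Φ.isSelfAdjoint_tiled _ _).neg.add
      (isSelfAdjoint_ofReal_smul (Ψ.isSelfAdjoint_tiled _ _) α))).trans ?_
  have h2 : Φ.generator Ψ (cube 0 n) α - (-Φ.tiled m (n / m) + (α : ℂ) • Ψ.tiled m (n / m)) =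
      -(Φ.hamiltonian (cube 0 n) - Φ.tiled m (n / m)) +
        (α : ℂ) • (Ψ.hamiltonian (cube 0 n) - Ψ.tiled m (n / m)) := by
    rw [generator, smul_sub]; abel
  rw [h2]
  refine (norm_add_le _ _).trans ?_
  rw [norm_neg, norm_smul, Complex.norm_real, Real.norm_eq_abs]
  nlinarith [mul_le_mul_of_nonneg_left hΨ (abs_nonneg α)]

/-- Large finite volumes determine the free energy of still larger ones. -/
theorem eventually_abs_freeEnergy_sub_le (hd : 0 < d) {Φ Ψ : Interaction d 𝔄}
    (hΦ : Φ.NormFinite) (hΨ : Ψ.NormFinite) {ε : ℝ} (hε : 0 < ε) :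
    ∀ᶠ m : ℕ in atTop, ∀ α : ℝ, ∀ᶠ n : ℕ in atTop,
      |Φ.freeEnergy Ψ n α - Φ.freeEnergy Ψ m α| ≤ ε * (1 + |α|) := by
  -- The side `m` is fixed before `α`: the operator estimates do not involve `α`, which enters only
  -- through the factor `1 + |α|`. How large `n` must be may depend on `α`.
  filter_upwards [eventually_norm_sub_tiled_le hd hΦ (half_pos hε),
    eventually_norm_sub_tiled_le hd hΨ (half_pos hε), eventually_gt_atTop 0] with m h1 h2 hm α
  have hlim : Tendsto (fun n : ℕ => |(((n / m) ^ d : ℕ) : ℝ) * (m : ℝ) ^ d / (n : ℝ) ^ d *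
      Φ.freeEnergy Ψ m α + (1 - (((n / m) ^ d : ℕ) : ℝ) * (m : ℝ) ^ d / (n : ℝ) ^ d) *
        Real.log N - Φ.freeEnergy Ψ m α|) atTop (𝓝 |1 * Φ.freeEnergy Ψ m α + (1 - 1) *
        Real.log N - Φ.freeEnergy Ψ m α|) := by
    have h := tendsto_coverage d hm
    exact (((h.mul_const _).add ((tendsto_const_nhds.sub h).mul_const _)).sub_const _).abs
  have hz : |1 * Φ.freeEnergy Ψ m α + (1 - 1) * Real.log N - Φ.freeEnergy Ψ m α| <
      ε / 2 * (1 + |α|) := by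
    simp only [one_mul, sub_self, zero_mul, add_zero, abs_zero]
    positivity
  filter_upwards [h1, h2, eventually_gt_atTop 0, hlim.eventually (gt_mem_nhds hz)]
    with n h1 h2 hn h3
  have hn' : (0 : ℝ) < (n : ℝ) ^ d := by positivity
  have hm' : (0 : ℝ) < (m : ℝ) ^ d := by positivity
  have h4 := abs_log_cubePartition_sub_le α h1 h2
  have h5 : (((n / m) ^ d * m ^ d : ℕ)) ≤ n ^ d := by
    rw [← mul_pow]; exact Nat.pow_le_pow_left (Nat.div_mul_le_self n m) d
  rw [Nat.cast_sub h5] at h4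
  have h6 : Φ.freeEnergy Ψ n α - ((((n / m) ^ d : ℕ) : ℝ) * (m : ℝ) ^ d / (n : ℝ) ^ d *
      Φ.freeEnergy Ψ m α + (1 - (((n / m) ^ d : ℕ) : ℝ) * (m : ℝ) ^ d / (n : ℝ) ^ d) *
        Real.log N) = (Real.log (Φ.cubePartition Ψ n α) -
        (((n / m) ^ d : ℕ) * Real.log (Φ.cubePartition Ψ m α) +
      (((n ^ d : ℕ) : ℝ) - ((n / m) ^ d * m ^ d : ℕ)) * Real.log N)) / (n : ℝ) ^ d := by
    rw [freeEnergy, freeEnergy]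
    push_cast
    field_simp
  have h7 : |Φ.freeEnergy Ψ n α - ((((n / m) ^ d : ℕ) : ℝ) * (m : ℝ) ^ d / (n : ℝ) ^ d *
      Φ.freeEnergy Ψ m α + (1 - (((n / m) ^ d : ℕ) : ℝ) * (m : ℝ) ^ d / (n : ℝ) ^ d) *
        Real.log N)| ≤ ε / 2 * (1 + |α|) := by
    rw [h6, abs_div, abs_of_pos hn', div_le_iff₀ hn']
    exact h4
  have h8 := abs_add_le (Φ.freeEnergy Ψ n α -
    ((((n / m) ^ d : ℕ) : ℝ) * (m : ℝ) ^ d / (n : ℝ) ^ d *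
      Φ.freeEnergy Ψ m α + (1 - (((n / m) ^ d : ℕ) : ℝ) * (m : ℝ) ^ d / (n : ℝ) ^ d) *
        Real.log N)) ((((n / m) ^ d : ℕ) : ℝ) * (m : ℝ) ^ d / (n : ℝ) ^ d *
      Φ.freeEnergy Ψ m α + (1 - (((n / m) ^ d : ℕ) : ℝ) * (m : ℝ) ^ d / (n : ℝ) ^ d) *
        Real.log N - Φ.freeEnergy Ψ m α)
  rw [sub_add_sub_cancel] at h8
  linarith

end Interaction

end TiledPartitionFunction

/-! ### Legendre duality and the abstract large deviation principle -/

section LegendreLDP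

/-- The entropy `s(x) = inf_α (P(α) - P(0) - α x)`. -/
def entropyFn (P : ℝ → ℝ) (x : ℝ) : EReal := ⨅ α : ℝ, ((P α - P 0 - α * x : ℝ) : EReal)

theorem entropyFn_le (P : ℝ → ℝ) (x α : ℝ) :
    entropyFn P x ≤ ((P α - P 0 - α * x : ℝ) : EReal) := iInf_le _ α

theorem entropyFn_nonpos (P : ℝ → ℝ) (x : ℝ) : entropyFn P x ≤ 0 := by
  simpa using entropyFn_le P x 0

theorem exists_lt_of_entropyFn_lt {P : ℝ → ℝ} {x : ℝ} {y : EReal} (h : entropyFn P x < y) :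
    ∃ α : ℝ, ((P α - P 0 - α * x : ℝ) : EReal) < y := iInf_lt_iff.1 h

theorem concaveEReal_entropyFn (P : ℝ → ℝ) : ConcaveEReal (entropyFn P) := by
  intro x y a b ha hb hab
  refine le_iInf fun α => ?_
  have ha' : (0 : EReal) ≤ (a : EReal) := by exact_mod_cast ha.le
  have hb' : (0 : EReal) ≤ (b : EReal) := by exact_mod_cast hb.le
  refine (add_le_add (mul_le_mul_of_nonneg_left (entropyFn_le P x α) ha')
    (mul_le_mul_of_nonneg_left (entropyFn_le P y α) hb')).trans (le_of_eq ?_)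
  rw [← EReal.coe_mul, ← EReal.coe_mul, ← EReal.coe_add]
  congr 1
  have : b = 1 - a := by linarith
  subst this
  ring

/-- The entropy is an infimum of affine functions: a strict upper bound on it is witnessed by one of
them and persists nearby. -/
theorem lowerSemicontinuous_neg_entropyFn (P : ℝ → ℝ) :
    LowerSemicontinuous fun x => -entropyFn P x := by
  intro x y hy
  obtain ⟨α, hα⟩ := exists_lt_of_entropyFn_lt (EReal.lt_neg_comm.1 hy)
  have hc : Continuous fun x : ℝ => ((P α - P 0 - α * x : ℝ) : EReal) :=
    continuous_coe_real_ereal.comp (by fun_prop)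
  filter_upwards [hc.continuousAt.eventually (gt_mem_nhds hα)] with z hz
  exact EReal.lt_neg_comm.1 ((entropyFn_le P z α).trans_lt hz)

/-- The two slopes `α = 1` and `α = -1` already confine a level set to a bounded interval. -/
theorem isCompact_level_entropyFn (P : ℝ → ℝ) (a : ℝ) :
    IsCompact {x | -entropyFn P x ≤ (a : EReal)} := by
  refine (isCompact_Icc (a := -(P (-1) - P 0 + a)) (b := P 1 - P 0 + a)).of_isClosed_subset
    ((lowerSemicontinuous_neg_entropyFn P).isClosed_preimage _) fun x hx => ?_
  have h1 : ∀ α : ℝ, -a ≤ P α - P 0 - α * x := by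
    intro α
    have h2 : ((-a : ℝ) : EReal) ≤ entropyFn P x := by
      rw [EReal.coe_neg]; exact EReal.neg_le_of_neg_le hx
    exact_mod_cast h2.trans (entropyFn_le P x α)
  constructor
  · have := h1 (-1); linarith
  · have := h1 1; linarith

/-- Fenchel-Moreau: a finite convex `P` is continuous, so any value below `P α` is attained at `α`
by an affine minorant. Its slope is the near-optimal `x`. -/
theorem iSup_add_entropyFn {P : ℝ → ℝ} (hP : ConvexOn ℝ Set.univ P) (α : ℝ) :
    ⨆ x : ℝ, (((α * x : ℝ) : EReal) + entropyFn P x) = ((P α - P 0 : ℝ) : EReal) := by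
  refine le_antisymm (iSup_le fun x => ?_) (le_of_forall_lt_imp_le_of_dense fun y hy => ?_)
  · refine (add_le_add_right (entropyFn_le P x α) _).trans (le_of_eq ?_)
    rw [← EReal.coe_add]; congr 1; ring
  · obtain ⟨r, hr1, hr2⟩ := EReal.lt_iff_exists_real_btwn.1 hy
    have hr2' : r < P α - P 0 := by exact_mod_cast hr2
    obtain ⟨x, t, h1, h2⟩ : ∃ x t : ℝ, (∀ β, x * β + t ≤ P β) ∧ x * α + t = r + P 0 := by
      have hcont : Continuous P := by
        have := hP.continuousOn_interior
        rwa [interior_univ, continuousOn_univ] at this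
      obtain ⟨c, c', h1, h2⟩ := hP.exists_affine_le_of_lt_real (x := α) (a := r + P 0)
        (Set.mem_univ α) (by linarith) isClosed_univ
        (hcont.lowerSemicontinuous.lowerSemicontinuousOn _)
      exact ⟨c, c', fun β => h1 β (Set.mem_univ β), h2⟩
    refine le_trans ?_ (le_iSup _ x)
    have h3 : ((t - P 0 : ℝ) : EReal) ≤ entropyFn P x := le_iInf fun β => by
      have := h1 β
      exact_mod_cast (by linarith : t - P 0 ≤ P β - P 0 - β * x)
    refine hr1.le.trans (le_trans ?_ (add_le_add_right h3 _))
    rw [← EReal.coe_add]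
    exact_mod_cast (by linarith : r ≤ α * x + (t - P 0))

theorem inv_mul_log_le {v a : ℝ} (hv : 0 < v) {p : ℝ≥0∞}
    (h : p ≤ ENNReal.ofReal (Real.exp (v * a))) :
    ((v⁻¹ : ℝ) : EReal) * ENNReal.log p ≤ (a : EReal) := by
  have h1 : ENNReal.log p ≤ ((v * a : ℝ) : EReal) := by
    refine (ENNReal.log_le_log h).trans (le_of_eq ?_)
    rw [ENNReal.log_ofReal_of_pos (Real.exp_pos _), Real.log_exp]
  have h2 : (0 : EReal) ≤ ((v⁻¹ : ℝ) : EReal) := by exact_mod_cast (inv_pos.2 hv).le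
  refine (mul_le_mul_of_nonneg_left h1 h2).trans (le_of_eq ?_)
  rw [← EReal.coe_mul, inv_mul_cancel_left₀ hv.ne']

theorem le_inv_mul_log {v a : ℝ} (hv : 0 < v) {p : ℝ≥0∞}
    (h : ENNReal.ofReal (Real.exp (v * a)) ≤ p) :
    (a : EReal) ≤ ((v⁻¹ : ℝ) : EReal) * ENNReal.log p := by
  have h1 : ((v * a : ℝ) : EReal) ≤ ENNReal.log p := by
    refine le_trans (le_of_eq ?_) (ENNReal.log_le_log h)
    rw [ENNReal.log_ofReal_of_pos (Real.exp_pos _), Real.log_exp]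
  have h2 : (0 : EReal) ≤ ((v⁻¹ : ℝ) : EReal) := by exact_mod_cast (inv_pos.2 hv).le
  refine le_trans (le_of_eq ?_) (mul_le_mul_of_nonneg_left h1 h2)
  rw [← EReal.coe_mul, inv_mul_cancel_left₀ hv.ne']

/-- Exponential Chebyshev bounds on half-lines imply an exponential bound on closed sets. -/
theorem eventually_measure_closed_le {μ : ℕ → ProbabilityMeasure ℝ} {v : ℕ → ℝ}
    (hv : Tendsto v atTop atTop) {P : ℝ → ℝ}
    (hU : ∀ α y ε : ℝ, 0 < ε → ∀ᶠ n in atTop,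
      (μ n : Measure ℝ).real {x | y ≤ α * x} ≤ Real.exp (v n * (P α - P 0 - y + ε)))
    {C : Set ℝ} (hC : IsClosed C) {a b : ℝ} (hab : a < b)
    (ha : ∀ x ∈ C, entropyFn P x < (a : EReal)) :
    ∀ᶠ n in atTop, (μ n : Measure ℝ).real C ≤ Real.exp (v n * b) := by
  -- The thresholds make the bounds `hU` with slopes `1`, `-1` and error `1` equal to `e^{v a}` on
  -- both tails.
  set y₁ := P 1 - P 0 + 1 - a with hy₁
  set y₂ := P (-1) - P 0 + 1 - a with hy₂
  choose! α hα using fun x hx => exists_lt_of_entropyFn_lt (ha x hx)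
  have hα' : ∀ x ∈ C, 0 < a - (P (α x) - P 0 - α x * x) := fun x hx => by
    have : P (α x) - P 0 - α x * x < a := by exact_mod_cast hα x hx
    linarith
  -- Half the slack at `x`: one half widens the half-line to a neighbourhood of `x`, the other is
  -- the error in `hU`. Together they give exactly the exponent `a`.
  set g : ℝ → ℝ := fun x => (a - (P (α x) - P 0 - α x * x)) / 2 with hg
  have hcpt : IsCompact (C ∩ Set.Icc (-y₂) y₁) := isCompact_Icc.inter_left hC
  obtain ⟨t, htC, ht⟩ := hcpt.elim_nhds_subcover (fun x => {x' | α x * x - g x ≤ α x * x'})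
    (fun x hx => by
      have hc : Continuous fun x' : ℝ => α x * x' := by fun_prop
      have h1 : α x * x - g x < α x * x := by
        have := hα' x hx.1
        simp only [hg]; linarith
      filter_upwards [hc.continuousAt.eventually (lt_mem_nhds h1)] with z hz
      exact hz.le)
  have hcover : C ⊆ ({x | y₁ ≤ 1 * x} ∪ {x | y₂ ≤ (-1) * x}) ∪
      ⋃ x ∈ t, {x' | α x * x - g x ≤ α x * x'} := by
    intro x hx
    by_cases h1 : y₁ ≤ 1 * x
    · exact Or.inl (Or.inl h1)
    by_cases h2 : y₂ ≤ (-1) * x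
    · exact Or.inl (Or.inr h2)
    · refine Or.inr (ht ⟨hx, ?_, ?_⟩) <;> linarith
  -- The gap `b - a` absorbs the number of half-lines in the cover.
  have hbig : ∀ᶠ n in atTop, (2 + (t.card : ℝ)) ≤ Real.exp (v n * (b - a)) := by
    have : Tendsto (fun n => Real.exp (v n * (b - a))) atTop atTop :=
      Real.tendsto_exp_atTop.comp (hv.atTop_mul_const (by linarith))
    exact this.eventually_ge_atTop _
  have hfin : ∀ᶠ n in atTop, ∀ x ∈ t, (μ n : Measure ℝ).real {x' | α x * x - g x ≤ α x * x'} ≤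
      Real.exp (v n * a) := by
    refine (Finset.eventually_all t).2 fun x hx => ?_
    have hgx : 0 < g x := half_pos (hα' x (htC x hx).1)
    filter_upwards [hU (α x) (α x * x - g x) (g x) hgx] with n hn
    refine hn.trans (le_of_eq ?_)
    congr 2
    simp only [hg]; ring
  filter_upwards [hU 1 y₁ 1 one_pos, hU (-1) y₂ 1 one_pos, hfin, hbig] with n h1 h2 h3 h4
  have h1' : (μ n : Measure ℝ).real {x | y₁ ≤ 1 * x} ≤ Real.exp (v n * a) :=
    h1.trans (le_of_eq (by congr 2; rw [hy₁]; ring))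
  have h2' : (μ n : Measure ℝ).real {x | y₂ ≤ (-1) * x} ≤ Real.exp (v n * a) :=
    h2.trans (le_of_eq (by congr 2; rw [hy₂]; ring))
  calc (μ n : Measure ℝ).real C ≤ (μ n : Measure ℝ).real (({x | y₁ ≤ 1 * x} ∪
        {x | y₂ ≤ (-1) * x}) ∪ ⋃ x ∈ t, {x' | α x * x - g x ≤ α x * x'}) :=
        measureReal_mono hcover
    _ ≤ (Real.exp (v n * a) + Real.exp (v n * a)) + ∑ x ∈ t, Real.exp (v n * a) := by
        refine (measureReal_union_le _ _).trans (add_le_add ((measureReal_union_le _ _).trans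
          (add_le_add h1' h2')) ((measureReal_biUnion_finset_le _ _).trans
          (Finset.sum_le_sum h3)))
    _ = (2 + t.card) * Real.exp (v n * a) := by
        rw [Finset.sum_const, nsmul_eq_mul]; ring
    _ ≤ Real.exp (v n * (b - a)) * Real.exp (v n * a) :=
        mul_le_mul_of_nonneg_right h4 (Real.exp_pos _).le
    _ = Real.exp (v n * b) := by rw [← Real.exp_add]; congr 1; ring

/-- Chebyshev bounds on half-lines and matching local lower bounds give the large deviation
principle with a Legendre transform as rate function. -/
theorem largeDeviationPrinciple_of_bounds {μ : ℕ → ProbabilityMeasure ℝ} {v : ℕ → ℝ}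
    (hmono : Monotone v) (hv : Tendsto v atTop atTop) {P : ℝ → ℝ}
    (hU : ∀ α y ε : ℝ, 0 < ε → ∀ᶠ n in atTop,
      (μ n : Measure ℝ).real {x | y ≤ α * x} ≤ Real.exp (v n * (P α - P 0 - y + ε)))
    (hL : ∀ x b : ℝ, (∀ α, b ≤ P α - P 0 - α * x) → ∀ ε : ℝ, 0 < ε → ∀ᶠ n in atTop,
      Real.exp (v n * (b - ε)) ≤ (μ n : Measure ℝ).real (Metric.ball x ε)) :
    LargeDeviationPrinciple μ v (fun x => -entropyFn P x) where
  scale_mono := hmono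
  scale_tendsto := hv
  nonneg x := by
    have := entropyFn_nonpos P x
    exact EReal.neg_nonneg.2 this
  lowerSemicontinuous := lowerSemicontinuous_neg_entropyFn P
  compact_levels := isCompact_level_entropyFn P
  upper C hC := by
    refine le_of_forall_gt_imp_ge_of_dense fun c hc => ?_
    obtain ⟨b, hb1, hb2⟩ := EReal.lt_iff_exists_real_btwn.1 hc
    obtain ⟨a, ha1, ha2⟩ := EReal.lt_iff_exists_real_btwn.1 hb1
    have ha : ∀ x ∈ C, entropyFn P x < (a : EReal) := by
      intro x hx
      refine lt_of_le_of_lt ?_ ha1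
      rw [EReal.le_neg]
      exact iInf₂_le x hx
    refine le_trans (limsup_le_of_le (by isBoundedDefault) ?_) hb2.le
    filter_upwards [eventually_measure_closed_le hv hU hC (by exact_mod_cast ha2) ha,
      hv.eventually_gt_atTop 0] with n h1 h2
    refine inv_mul_log_le h2 ?_
    rw [← ofReal_measureReal]
    exact ENNReal.ofReal_le_ofReal h1
  lower O hO := by
    refine le_of_forall_lt_imp_le_of_dense fun c hc => ?_
    rw [EReal.lt_neg_comm] at hc
    obtain ⟨x, hx⟩ := iInf_lt_iff.1 hc
    obtain ⟨hxO, hx⟩ := iInf_lt_iff.1 hx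
    rw [EReal.neg_lt_neg_iff] at hx
    obtain ⟨b, hb1, hb2⟩ := EReal.lt_iff_exists_real_btwn.1 hx
    obtain ⟨b', hb1', hb2'⟩ := EReal.lt_iff_exists_real_btwn.1 hb1
    obtain ⟨r, hr, hrO⟩ := Metric.isOpen_iff.1 hO x hxO
    have hbb : b' < b := by exact_mod_cast hb2'
    set ε := min r (b - b') with hε
    have hε0 : 0 < ε := lt_min hr (by linarith)
    refine le_trans hb1'.le (le_liminf_of_le (by isBoundedDefault) ?_)
    filter_upwards [hL x b (fun α => by exact_mod_cast hb2.le.trans (entropyFn_le P x α)) ε hε0,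
      hv.eventually_gt_atTop 0] with n h1 h2
    refine le_inv_mul_log h2 ?_
    rw [← ofReal_measureReal]
    refine ENNReal.ofReal_le_ofReal ((Real.exp_le_exp.2 ?_).trans (h1.trans
      (measureReal_mono ((Metric.ball_subset_ball (min_le_left _ _)).trans hrO))))
    have : ε ≤ b - b' := min_le_right _ _
    exact mul_le_mul_of_nonneg_left (by linarith) h2.le

end LegendreLDP

/-! ### Convexity, tilting and tangents for exponential sums -/

section ExponentialSums

/-- After each family of exponentials is normalised to total weight one, convexity of `exp` applied
term by term replaces Hölder's inequality. -/
theorem convexOn_log_sum_exp {ι : Type*} [Fintype ι] {k w : ι → ℝ} (hw : ∀ i, 0 ≤ w i)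
    (hpos : ∀ α : ℝ, 0 < ∑ i, w i * Real.exp (α * k i)) :
    ConvexOn ℝ Set.univ fun α : ℝ => Real.log (∑ i, w i * Real.exp (α * k i)) := by
  refine ⟨convex_univ, fun α _ β _ a b ha hb hab => ?_⟩
  simp only [smul_eq_mul]
  set S : ℝ → ℝ := fun α => ∑ i, w i * Real.exp (α * k i)
  change Real.log (S (a * α + b * β)) ≤ a * Real.log (S α) + b * Real.log (S β)
  have hnorm : ∀ α, ∑ i, w i * Real.exp (α * k i - Real.log (S α)) = 1 := by
    intro α
    have hS : Real.exp (Real.log (S α)) = S α := Real.exp_log (hpos α)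
    simp only [Real.exp_sub, hS, ← mul_div_assoc]
    rw [← Finset.sum_div]
    exact div_self (hpos α).ne'
  rw [Real.log_le_iff_le_exp (hpos _)]
  set L := a * Real.log (S α) + b * Real.log (S β) with hL
  have h1 : ∀ i, w i * Real.exp ((a * α + b * β) * k i) ≤ Real.exp L *
      (a * (w i * Real.exp (α * k i - Real.log (S α))) +
        b * (w i * Real.exp (β * k i - Real.log (S β)))) := by
    intro i
    have h2 := convexOn_exp.2 (Set.mem_univ (α * k i - Real.log (S α)))
      (Set.mem_univ (β * k i - Real.log (S β))) ha hb hab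
    simp only [smul_eq_mul] at h2
    have h3 : Real.exp ((a * α + b * β) * k i) = Real.exp L *
        Real.exp (a * (α * k i - Real.log (S α)) + b * (β * k i - Real.log (S β))) := by
      rw [← Real.exp_add]; congr 1; rw [hL]; ring
    rw [h3]
    calc w i * (Real.exp L * Real.exp (a * (α * k i - Real.log (S α)) +
          b * (β * k i - Real.log (S β))))
        = (w i * Real.exp L) * Real.exp (a * (α * k i - Real.log (S α)) +
          b * (β * k i - Real.log (S β))) := by ring
      _ ≤ (w i * Real.exp L) * (a * Real.exp (α * k i - Real.log (S α)) +
          b * Real.exp (β * k i - Real.log (S β))) :=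
        mul_le_mul_of_nonneg_left h2 (mul_nonneg (hw i) (Real.exp_pos _).le)
      _ = _ := by ring
  calc S (a * α + b * β) ≤ ∑ i, Real.exp L *
      (a * (w i * Real.exp (α * k i - Real.log (S α))) +
        b * (w i * Real.exp (β * k i - Real.log (S β)))) := Finset.sum_le_sum fun i _ => h1 i
    _ = Real.exp L * (a * ∑ i, w i * Real.exp (α * k i - Real.log (S α)) +
        b * ∑ i, w i * Real.exp (β * k i - Real.log (S β))) := by
      rw [← Finset.mul_sum, Finset.sum_add_distrib, Finset.mul_sum, Finset.mul_sum]
    _ = Real.exp L := by rw [hnorm, hnorm, mul_one, mul_one, hab, mul_one]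

theorem differentiable_log_sum_exp {ι : Type*} [Fintype ι] {k w : ι → ℝ}
    (hpos : ∀ α : ℝ, 0 < ∑ i, w i * Real.exp (α * k i)) :
    Differentiable ℝ fun α : ℝ => Real.log (∑ i, w i * Real.exp (α * k i)) := by
  have h : Differentiable ℝ fun α : ℝ => ∑ i, w i * Real.exp (α * k i) := by fun_prop
  exact h.log fun α => (hpos α).ne'

/-- The upper-tail Chernoff bound for exponential sums. -/
theorem sum_filter_exp_le {ι : Type*} [Fintype ι] {k w : ι → ℝ} (hw : ∀ i, 0 ≤ w i)
    (α t y : ℝ) :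
    ∑ i with y ≤ t * k i, w i * Real.exp (α * k i) ≤
      Real.exp (-y) * ∑ i, w i * Real.exp ((α + t) * k i) := by
  rw [Finset.mul_sum]
  refine (Finset.sum_le_sum fun i hi => ?_).trans (Finset.sum_le_sum_of_subset_of_nonneg
    (Finset.filter_subset _ _) fun i _ _ =>
      mul_nonneg (Real.exp_pos _).le (mul_nonneg (hw i) (Real.exp_pos _).le))
  have h1 : y ≤ t * k i := (Finset.mem_filter.1 hi).2
  have h2 : Real.exp (α * k i) ≤ Real.exp (-y) * Real.exp ((α + t) * k i) := by
    rw [← Real.exp_add, Real.exp_le_exp]; linarith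
  calc w i * Real.exp (α * k i) ≤ w i * (Real.exp (-y) * Real.exp ((α + t) * k i)) :=
        mul_le_mul_of_nonneg_left h2 (hw i)
    _ = _ := by ring

/-- Concentration of the tilted weights at the derivative of the log-generating function. -/
theorem eventually_half_le_sum_near {G : ℝ → ℝ} {x α : ℝ} (hG : HasDerivAt G x α) {δ : ℝ}
    (hδ : 0 < δ) : ∀ᶠ Q : ℕ in atTop, ∀ {ι : Type} [Fintype ι] (k w : ι → ℝ) (r : ℝ),
      (∀ i, 0 ≤ w i) → 0 < r → (∀ β, ∑ i, w i * Real.exp (β * k i) = r * Real.exp (Q * G β)) →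
      r * Real.exp (Q * G α) / 2 ≤
        ∑ i with |k i - Q * x| < Q * δ, w i * Real.exp (α * k i) := by
  -- Differentiability gives a tilt `t` for which `G` exceeds its tangent by at most `t δ / 2`. The
  -- Chernoff gain is `t δ`, so each tail has relative weight at most `e^{-Q t δ / 2}`.
  obtain ⟨t, ht, h1, h2⟩ : ∃ t > 0, G (α + t) - G α - t * x ≤ t * (δ / 2) ∧
      G (α - t) - G α + t * x ≤ t * (δ / 2) := by
    have h := (hasDerivAt_iff_isLittleO.1 hG).def (half_pos hδ)
    obtain ⟨s, hs, hs'⟩ := Metric.eventually_nhds_iff.1 h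
    refine ⟨s / 2, half_pos hs, ?_, ?_⟩
    · have := hs' (y := α + s / 2) (by
        rw [Real.dist_eq, add_sub_cancel_left, abs_of_pos (half_pos hs)]; linarith)
      rw [Real.norm_eq_abs, Real.norm_eq_abs, add_sub_cancel_left, abs_of_pos (half_pos hs),
        smul_eq_mul] at this
      linarith [le_abs_self (G (α + s / 2) - G α - s / 2 * x)]
    · have := hs' (y := α - s / 2) (by
        rw [Real.dist_eq, sub_sub_cancel_left, abs_neg, abs_of_pos (half_pos hs)]; linarith)
      rw [Real.norm_eq_abs, Real.norm_eq_abs, sub_sub_cancel_left, abs_neg,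
        abs_of_pos (half_pos hs), smul_eq_mul] at this
      linarith [le_abs_self (G (α - s / 2) - G α - -(s / 2) * x)]
  -- A quarter for each of the two tails leaves half of the mass near the mean.
  have hlarge : ∀ᶠ Q : ℕ in atTop, Real.exp (-((Q : ℝ) * (t * (δ / 2)))) ≤ 1 / 4 := by
    have : Tendsto (fun Q : ℕ => Real.exp (-((Q : ℝ) * (t * (δ / 2))))) atTop (𝓝 0) :=
      Real.tendsto_exp_neg_atTop_nhds_zero.comp
        (tendsto_natCast_atTop_atTop.atTop_mul_const (by positivity))
    exact this.eventually_le_const (by norm_num)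
  filter_upwards [hlarge] with Q hQ ι _ k w r hw hr hk
  have hup := sum_filter_exp_le hw (k := k) α t (t * (Q * (x + δ)))
  have hdn := sum_filter_exp_le hw (k := k) α (-t) (-t * (Q * (x - δ)))
  have hQ0 : (0 : ℝ) ≤ Q := Nat.cast_nonneg Q
  have hup' : Real.exp (-(t * (Q * (x + δ)))) * ∑ i, w i * Real.exp ((α + t) * k i) ≤
      r * Real.exp (Q * G α) * (1 / 4) := by
    rw [hk]
    calc Real.exp (-(t * (Q * (x + δ)))) * (r * Real.exp (Q * G (α + t)))
        = r * Real.exp (Q * (G (α + t) - t * x - t * δ)) := by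
          rw [mul_left_comm, ← Real.exp_add]; congr 2; ring
      _ ≤ r * Real.exp (Q * G α + -((Q : ℝ) * (t * (δ / 2)))) := by
          refine mul_le_mul_of_nonneg_left (Real.exp_le_exp.2 ?_) hr.le
          nlinarith [mul_le_mul_of_nonneg_left h1 hQ0]
      _ ≤ _ := by
          rw [Real.exp_add, ← mul_assoc]
          exact mul_le_mul_of_nonneg_left hQ (by positivity)
  have hdn' : Real.exp (-(-t * (Q * (x - δ)))) * ∑ i, w i * Real.exp ((α + -t) * k i) ≤
      r * Real.exp (Q * G α) * (1 / 4) := by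
    rw [hk, ← sub_eq_add_neg]
    calc Real.exp (-(-t * (Q * (x - δ)))) * (r * Real.exp (Q * G (α - t)))
        = r * Real.exp (Q * (G (α - t) + t * x - t * δ)) := by
          rw [mul_left_comm, ← Real.exp_add]; congr 2; ring
      _ ≤ r * Real.exp (Q * G α + -((Q : ℝ) * (t * (δ / 2)))) := by
          refine mul_le_mul_of_nonneg_left (Real.exp_le_exp.2 ?_) hr.le
          nlinarith [mul_le_mul_of_nonneg_left h2 hQ0]
      _ ≤ _ := by
          rw [Real.exp_add, ← mul_assoc]
          exact mul_le_mul_of_nonneg_left hQ (by positivity)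
  have hsplit : ∑ i, w i * Real.exp (α * k i) ≤
      ∑ i with |k i - Q * x| < Q * δ, w i * Real.exp (α * k i) +
      (∑ i with t * (Q * (x + δ)) ≤ t * k i, w i * Real.exp (α * k i) +
        ∑ i with -t * (Q * (x - δ)) ≤ -t * k i, w i * Real.exp (α * k i)) := by
    rw [Finset.sum_filter, Finset.sum_filter, Finset.sum_filter, ← Finset.sum_add_distrib,
      ← Finset.sum_add_distrib]
    refine Finset.sum_le_sum fun i _ => ?_
    have hpos : 0 ≤ w i * Real.exp (α * k i) := mul_nonneg (hw i) (Real.exp_pos _).le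
    by_cases hi : |k i - Q * x| < Q * δ
    · rw [if_pos hi]; split_ifs <;> linarith
    · rw [if_neg hi]
      rcases le_abs.1 (not_lt.1 hi) with h | h
      · rw [if_pos (mul_le_mul_of_nonneg_left (by linarith) ht.le)]
        split_ifs <;> linarith
      · have : -t * (Q * (x - δ)) ≤ -t * k i := by nlinarith
        rw [if_pos this]
        split_ifs <;> linarith
  rw [hk] at hsplit
  linarith

/-- A differentiable function bounded below by a slightly sublinear function has a point at which
its tangent of slope close to `x` almost attains the bound. -/
theorem exists_hasDerivAt_near {F : ℝ → ℝ} (hF : Differentiable ℝ F) {x B η δ : ℝ}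
    (hηδ : η < δ) (hδ : 0 < δ) (hB : ∀ β, B - η * |β| ≤ F β - β * x) :
    ∃ α x', HasDerivAt F x' α ∧ |x' - x| ≤ δ ∧ B - δ ≤ F α - α * x' := by
  set q : ℝ → ℝ := fun β => Real.sqrt (1 + β ^ 2) with hq
  have hqpos : ∀ β, 0 < q β := fun β => Real.sqrt_pos.2 (by positivity)
  have hqsq : ∀ β, q β ^ 2 = 1 + β ^ 2 := fun β => Real.sq_sqrt (by positivity)
  have hq1 : ∀ β, 1 ≤ q β := fun β => Real.one_le_sqrt.2 (by nlinarith [sq_nonneg β])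
  have hqabs : ∀ β, |β| ≤ q β := fun β => Real.abs_le_sqrt (by linarith)
  -- The added term grows like `δ |β|` and beats the loss `η |β|`, so `h` has a minimiser. Its slope
  -- is at most `δ` in modulus, which keeps the derivative of `F` there within `δ` of `x`.
  set h : ℝ → ℝ := fun β => F β - β * x + δ * q β with hh
  have hq' : ∀ β, HasDerivAt q (β / q β) β := by
    intro β
    have h1 : HasDerivAt (fun β : ℝ => 1 + β ^ 2) (2 * β) β := by
      simpa using (hasDerivAt_pow 2 β).const_add 1
    have h2 := h1.sqrt (by positivity)
    convert h2 using 1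
    change β / q β = 2 * β / (2 * q β)
    rw [mul_div_mul_left _ _ two_ne_zero]
  have hcont : Continuous h := by
    have h1 : Continuous q := by fun_prop
    have h2 := hF.continuous
    fun_prop
  have hlow : ∀ β, B + (δ - η) * |β| ≤ h β := by
    intro β
    have h1 := hB β
    have h2 := mul_le_mul_of_nonneg_left (hqabs β) hδ.le
    simp only [hh]; linarith
  have hlim : Tendsto h (cocompact ℝ) atTop := by
    refine tendsto_atTop_mono hlow (tendsto_atTop_add_const_left _ _ ?_)
    exact (tendsto_norm_cocompact_atTop (E := ℝ)).const_mul_atTop (by linarith)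
  obtain ⟨α, hα⟩ := hcont.exists_forall_le hlim
  have hd : HasDerivAt h (deriv F α - 1 * x + δ * (α / q α)) α :=
    ((hF α).hasDerivAt.sub ((hasDerivAt_id α).mul_const x)).add ((hq' α).const_mul δ)
  have hz : deriv F α - 1 * x + δ * (α / q α) = 0 :=
    IsLocalMin.hasDerivAt_eq_zero (Eventually.of_forall hα) hd
  refine ⟨α, deriv F α, (hF α).hasDerivAt, ?_, ?_⟩
  · have h1 : deriv F α - x = -(δ * (α / q α)) := by linarith
    rw [h1, abs_neg, abs_mul, abs_div, abs_of_pos hδ, abs_of_pos (hqpos α)]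
    exact mul_le_of_le_one_right hδ.le ((div_le_one (hqpos α)).2 (hqabs α))
  · have h1 : deriv F α = x - δ * (α / q α) := by linarith
    have h2 : B ≤ h α := by
      have := hlow α
      nlinarith [mul_nonneg (sub_nonneg.2 hηδ.le) (abs_nonneg α)]
    have h3 : α * (α / q α) = q α - 1 / q α := by
      field_simp
      rw [hqsq]; ring
    have h4 : 1 / q α ≤ 1 := (div_le_one (hqpos α)).2 (hq1 α)
    have h5 : F α - α * deriv F α = h α - δ * (1 / q α) := by
      rw [h1]
      simp only [hh]
      linear_combination δ * h3
    rw [h5]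
    nlinarith

end ExponentialSums

/-! ### Infinite-volume free energy, penalties and the Chernoff bound -/

section Thermodynamics

variable {d N : ℕ} {𝔄 : StarSubalgebra ℂ (Matrix (Fin N) (Fin N) ℂ)}

namespace Interaction

theorem norm_hamiltonian_cube_le {Ψ : Interaction d 𝔄} (hΨ : Ψ.NormFinite) {n : ℕ} (hn : 0 < n) :
    ‖Ψ.hamiltonian (cube 0 n)‖ ≤ (Ψ.normValue + ‖Ψ.term ∅‖) * (n : ℝ) ^ d := by
  have h1 := norm_hamiltonian_le hΨ (cube 0 n)
  rw [card_cube] at h1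
  have h2 : (1 : ℝ) ≤ (n : ℝ) ^ d := one_le_pow₀ (by exact_mod_cast hn)
  push_cast at h1
  nlinarith [mul_le_mul_of_nonneg_left h2 (norm_nonneg (Ψ.term ∅))]

/-- The Gaussian-penalized generator `-H - (c/v) (K - v x)²`. -/
theorem norm_penalized_sub_le {H K H' K' : ConfigOp d N} {v x c M η : ℝ} (hv : 0 < v)
    (hc : 0 ≤ c) (hη : η ≤ 1) (hK : ‖K‖ ≤ M * v)
    (hHH : ‖H - H'‖ ≤ η * v) (hKK : ‖K - K'‖ ≤ η * v) :
    ‖(-H' - ((c / v : ℝ) : ℂ) • (K' - ((v * x : ℝ) : ℂ) • 1) ^ 2) -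
      (-H - ((c / v : ℝ) : ℂ) • (K - ((v * x : ℝ) : ℂ) • 1) ^ 2)‖ ≤
      η * (1 + c * (2 * (M + |x|) + 1)) * v := by
  set X := K - ((v * x : ℝ) : ℂ) • (1 : ConfigOp d N) with hX
  set Y := K' - ((v * x : ℝ) : ℂ) • (1 : ConfigOp d N) with hY
  -- A difference of squares written without commuting the factors. They have sizes of order `v` and
  -- `η v`, so the prefactor `c / v` leaves an error of order `η v`.
  have h1 : (-H' - ((c / v : ℝ) : ℂ) • Y ^ 2) - (-H - ((c / v : ℝ) : ℂ) • X ^ 2) =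
      (H - H') + ((c / v : ℝ) : ℂ) • (X * (X - Y) + (X - Y) * Y) := by
    rw [show X * (X - Y) + (X - Y) * Y = X ^ 2 - Y ^ 2 by noncomm_ring, smul_sub]
    abel
  have hXY : ‖X - Y‖ ≤ η * v := by
    rw [hX, hY, sub_sub_sub_cancel_right]; exact hKK
  have h1norm : ‖(1 : ConfigOp d N)‖ ≤ 1 := ContinuousLinearMap.norm_id_le
  have hXn : ‖X‖ ≤ (M + |x|) * v := by
    refine (norm_sub_le _ _).trans ?_
    rw [norm_smul, Complex.norm_real, Real.norm_eq_abs, abs_mul, abs_of_pos hv]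
    nlinarith [mul_le_mul_of_nonneg_left h1norm (mul_nonneg hv.le (abs_nonneg x))]
  have hYn : ‖Y‖ ≤ (M + |x| + 1) * v := by
    have h2 : ‖Y‖ ≤ ‖X‖ + ‖X - Y‖ := by
      have := norm_sub_le X (X - Y)
      rwa [sub_sub_cancel] at this
    nlinarith
  have h3 : ‖X * (X - Y) + (X - Y) * Y‖ ≤ (2 * (M + |x|) + 1) * v * (η * v) := by
    have h4 := norm_mul_le X (X - Y)
    have h5 := norm_mul_le (X - Y) Y
    have h6 : ‖X‖ * ‖X - Y‖ ≤ (M + |x|) * v * (η * v) :=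
      mul_le_mul hXn hXY (norm_nonneg _) ((norm_nonneg _).trans hXn)
    have h7 : ‖X - Y‖ * ‖Y‖ ≤ (η * v) * ((M + |x| + 1) * v) :=
      mul_le_mul hXY hYn (norm_nonneg _) ((norm_nonneg _).trans hXY)
    refine (norm_add_le _ _).trans ?_
    linarith
  rw [h1]
  refine (norm_add_le _ _).trans ?_
  rw [norm_smul, Complex.norm_real, Real.norm_eq_abs, abs_of_nonneg (by positivity)]
  have h8 := mul_le_mul_of_nonneg_left h3 (by positivity : 0 ≤ c / v)
  have h9 : c / v * ((2 * (M + |x|) + 1) * v * (η * v)) = η * (c * (2 * (M + |x|) + 1)) * v := by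
    field_simp
  rw [h9] at h8
  linarith

variable [NeZero N]

/-- The sequence is Cauchy, because all large volumes are compared with one fixed side `m`. -/
theorem exists_tendsto_freeEnergy (hd : 0 < d) {Φ Ψ : Interaction d 𝔄}
    (hΦ : Φ.NormFinite) (hΨ : Ψ.NormFinite) (α : ℝ) :
    ∃ p : ℝ, Tendsto (fun n => Φ.freeEnergy Ψ n α) atTop (𝓝 p) := by
  refine cauchySeq_tendsto_of_complete (Metric.cauchySeq_iff.2 fun ε hε => ?_)
  have hα : 0 < 1 + |α| := by positivity
  obtain ⟨m, hm⟩ := (eventually_abs_freeEnergy_sub_le hd hΦ hΨ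
    (ε := ε / (3 * (1 + |α|))) (by positivity)).exists
  obtain ⟨n₀, hn₀⟩ := eventually_atTop.1 (hm α)
  have he : ε / (3 * (1 + |α|)) * (1 + |α|) = ε / 3 := by field_simp
  refine ⟨n₀, fun i hi j hj => ?_⟩
  have h1 := hn₀ i hi
  have h2 := hn₀ j hj
  rw [he] at h1 h2
  rw [Real.dist_eq, abs_lt]
  have h1' := abs_le.1 h1
  have h2' := abs_le.1 h2
  constructor <;> linarith

/-- The spectral data of `K_{Λ(n)}` weighted by `e^{-H_{Λ(n)}}`. -/
structure IsSpectralData (Φ Ψ : Interaction d 𝔄) (n : ℕ) {ι : Type} [Fintype ι]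
    (k w : ι → ℝ) : Prop where
  nonneg : ∀ i, 0 ≤ w i
  projection : ∀ (r : ℝ) (B : Set ℝ), localTrace (cube 0 n)
    (spectralProj B ((r : ℂ) • Ψ.hamiltonian (cube 0 n)) *
      NormedSpace.exp (-Φ.hamiltonian (cube 0 n))) =
        ((∑ i, B.indicator (fun _ => 1) (r * k i) * w i : ℝ) : ℂ)
  partition : ∀ α : ℝ, Φ.cubePartition Ψ n α = ∑ i, w i * Real.exp (α * k i)
  gaussian : ∀ c y : ℝ, partitionFn (cube 0 n) (-Φ.hamiltonian (cube 0 n) -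
    (c : ℂ) • (Ψ.hamiltonian (cube 0 n) - (y : ℂ) • 1) ^ 2) =
      ∑ i, w i * Real.exp (-(c * (k i - y) ^ 2))

theorem exists_isSpectralData {Φ Ψ : Interaction d 𝔄} {n : ℕ}
    (h : Commute (Ψ.hamiltonian (cube 0 n)) (Φ.hamiltonian (cube 0 n))) :
    ∃ k w : (cube (0 : Fin d → ℤ) n → Fin N) → ℝ, Φ.IsSpectralData Ψ n k w := by
  obtain ⟨k, w, h1, h2, h3⟩ := exists_spectral_weights
    (localAlg_le_range 𝔄 _ (Ψ.hamiltonian_mem (cube 0 n)))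
    (localAlg_le_range 𝔄 _ (Φ.hamiltonian_mem (cube 0 n)))
    (Ψ.isSelfAdjoint_hamiltonian _) (Φ.isSelfAdjoint_hamiltonian _)
  exact ⟨k, w, h1, h2, (h3 h).1, (h3 h).2⟩

theorem convexOn_freeEnergy {Φ Ψ : Interaction d 𝔄} {n : ℕ}
    (h : Commute (Ψ.hamiltonian (cube 0 n)) (Φ.hamiltonian (cube 0 n))) :
    ConvexOn ℝ Set.univ (Φ.freeEnergy Ψ n) := by
  obtain ⟨k, w, hs⟩ := exists_isSpectralData h
  have h1 := (convexOn_log_sum_exp hs.nonneg fun α => by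
    rw [← hs.partition]; exact Φ.cubePartition_pos Ψ n α).smul
      (c := ((n : ℝ) ^ d)⁻¹) (by positivity)
  have h2 : Φ.freeEnergy Ψ n = fun α =>
      ((n : ℝ) ^ d)⁻¹ • Real.log (∑ i, w i * Real.exp (α * k i)) := by
    funext α
    rw [freeEnergy, hs.partition, smul_eq_mul, inv_mul_eq_div]
  rw [h2]
  exact h1

theorem differentiable_log_cubePartition {Φ Ψ : Interaction d 𝔄} {n : ℕ}
    (h : Commute (Ψ.hamiltonian (cube 0 n)) (Φ.hamiltonian (cube 0 n))) :
    Differentiable ℝ fun α => Real.log (Φ.cubePartition Ψ n α) := by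
  obtain ⟨k, w, hs⟩ := exists_isSpectralData h
  simp only [hs.partition]
  exact differentiable_log_sum_exp fun α => by
    rw [← hs.partition]; exact Φ.cubePartition_pos Ψ n α

theorem convexOn_of_tendsto_freeEnergy {Φ Ψ : Interaction d 𝔄}
    (hcomm : ∀ n : ℕ, Commute (Ψ.hamiltonian (cube 0 n)) (Φ.hamiltonian (cube 0 n)))
    {P : ℝ → ℝ} (hP : ∀ α, Tendsto (fun n => Φ.freeEnergy Ψ n α) atTop (𝓝 (P α))) :
    ConvexOn ℝ Set.univ P :=
  ⟨convex_univ, fun α _ β _ _ _ ha hb hab => le_of_tendsto_of_tendsto' (hP _)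
    (((hP α).const_smul _).add ((hP β).const_smul _)) fun n =>
      (convexOn_freeEnergy (hcomm n)).2 (Set.mem_univ α) (Set.mem_univ β) ha hb hab⟩

/-- One `m` serves all `α`. This is essential later, when the tangent point `α` is known only after
`m` is fixed. -/
theorem eventually_abs_limit_sub_freeEnergy_le (hd : 0 < d) {Φ Ψ : Interaction d 𝔄}
    (hΦ : Φ.NormFinite) (hΨ : Ψ.NormFinite) {P : ℝ → ℝ}
    (hP : ∀ α, Tendsto (fun n => Φ.freeEnergy Ψ n α) atTop (𝓝 (P α))) {ε : ℝ} (hε : 0 < ε) :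
    ∀ᶠ m : ℕ in atTop, ∀ α : ℝ, |P α - Φ.freeEnergy Ψ m α| ≤ ε * (1 + |α|) := by
  filter_upwards [eventually_abs_freeEnergy_sub_le hd hΦ hΨ hε] with m hm α
  exact le_of_tendsto ((hP α).sub_const _).abs (hm α)

theorem cubePartition_eq_exp (Φ Ψ : Interaction d 𝔄) {n : ℕ} (hn : 0 < n) (α : ℝ) :
    Φ.cubePartition Ψ n α = Real.exp ((n : ℝ) ^ d * Φ.freeEnergy Ψ n α) := by
  have : (n : ℝ) ^ d ≠ 0 := by positivity
  rw [freeEnergy, mul_div_cancel₀ _ this, Real.exp_log (Φ.cubePartition_pos Ψ n α)]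

theorem eventually_cubePartition_le {Φ Ψ : Interaction d 𝔄} {P : ℝ → ℝ}
    (hP : ∀ α, Tendsto (fun n => Φ.freeEnergy Ψ n α) atTop (𝓝 (P α))) (α : ℝ) {ε : ℝ}
    (hε : 0 < ε) : ∀ᶠ n : ℕ in atTop,
      Φ.cubePartition Ψ n α ≤ Real.exp ((n : ℝ) ^ d * (P α + ε)) := by
  filter_upwards [(hP α).eventually (gt_mem_nhds (lt_add_of_pos_right (P α) hε)),
    eventually_gt_atTop 0] with n h1 h2
  rw [cubePartition_eq_exp Φ Ψ h2]
  exact Real.exp_le_exp.2 (mul_le_mul_of_nonneg_left h1.le (by positivity))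

theorem eventually_le_cubePartition {Φ Ψ : Interaction d 𝔄} {P : ℝ → ℝ}
    (hP : ∀ α, Tendsto (fun n => Φ.freeEnergy Ψ n α) atTop (𝓝 (P α))) (α : ℝ) {ε : ℝ}
    (hε : 0 < ε) : ∀ᶠ n : ℕ in atTop,
      Real.exp ((n : ℝ) ^ d * (P α - ε)) ≤ Φ.cubePartition Ψ n α := by
  filter_upwards [(hP α).eventually (lt_mem_nhds (sub_lt_self (P α) hε)),
    eventually_gt_atTop 0] with n h1 h2
  rw [cubePartition_eq_exp Φ Ψ h2]
  exact Real.exp_le_exp.2 (mul_le_mul_of_nonneg_left h1.le (by positivity))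

/-- The Chernoff bound for the density of `K`. -/
theorem eventually_halfline_weight_le {Φ Ψ : Interaction d 𝔄} {P : ℝ → ℝ}
    (hP : ∀ α, Tendsto (fun n => Φ.freeEnergy Ψ n α) atTop (𝓝 (P α))) (α y : ℝ) {ε : ℝ}
    (hε : 0 < ε) : ∀ᶠ n : ℕ in atTop, ∀ {ι : Type} [Fintype ι] (k w : ι → ℝ),
      Φ.IsSpectralData Ψ n k w →
      ∑ i with y ≤ α * (((n : ℝ) ^ d)⁻¹ * k i), w i ≤
        Real.exp ((n : ℝ) ^ d * (P α - y + ε)) := by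
  filter_upwards [eventually_cubePartition_le hP α hε, eventually_gt_atTop 0] with n h1 h2 ι _ k w hs
  have hv : (0 : ℝ) < (n : ℝ) ^ d := by positivity
  have h3 := sum_filter_exp_le hs.nonneg (k := k) 0 α ((n : ℝ) ^ d * y)
  simp only [zero_mul, Real.exp_zero, mul_one, zero_add] at h3
  rw [← hs.partition] at h3
  have h4 : ∀ i, y ≤ α * (((n : ℝ) ^ d)⁻¹ * k i) ↔ (n : ℝ) ^ d * y ≤ α * k i := by
    intro i
    rw [show α * (((n : ℝ) ^ d)⁻¹ * k i) = (α * k i) / (n : ℝ) ^ d by ring, le_div_iff₀ hv, mul_comm]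
  simp only [h4]
  refine h3.trans ((mul_le_mul_of_nonneg_left h1 (Real.exp_pos _).le).trans (le_of_eq ?_))
  rw [← Real.exp_add]; congr 1; ring

end Interaction

end Thermodynamics

/-! ### The lower bound by tilting and Gaussian penalties -/

section LowerBound

variable {d N : ℕ} [NeZero N] {𝔄 : StarSubalgebra ℂ (Matrix (Fin N) (Fin N) ℂ)}

namespace Interaction

/-- The independent tiles put enough Gaussian-penalized weight near `x`. -/
theorem eventually_le_partitionFn_penalized_tiled (hd : 0 < d) {Φ Ψ : Interaction d 𝔄}
    (hcomm : ∀ n : ℕ, Commute (Ψ.hamiltonian (cube 0 n)) (Φ.hamiltonian (cube 0 n)))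
    {m : ℕ} (hm : 0 < m) {x A δ c α x' : ℝ} (hδ : 0 < δ) (hc : 0 ≤ c)
    (hder : HasDerivAt (Φ.freeEnergy Ψ m) x' α) (hx' : |x' - x| ≤ δ)
    (hA : A ≤ Φ.freeEnergy Ψ m α - α * x') : ∀ᶠ n : ℕ in atTop,
      Real.exp ((n : ℝ) ^ d * (A - 2 * δ - 9 * c * δ ^ 2)) ≤
        partitionFn (cube 0 n) (-Φ.tiled m (n / m) - ((c / (n : ℝ) ^ d : ℝ) : ℂ) •
          (Ψ.tiled m (n / m) - (((n : ℝ) ^ d * x : ℝ) : ℂ) • 1) ^ 2) := by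
  have hm' : (0 : ℝ) < (m : ℝ) ^ d := by positivity
  -- Within a window of relative width `δ'`, removing the tilt `e^{α k}` costs only a further `δ`
  -- per covered site.
  set δ' := δ / (1 + |α|) with hδ'
  have hα1 : 0 < 1 + |α| := by positivity
  have hδ'0 : 0 < δ' := by positivity
  have hδ'1 : δ' ≤ δ := div_le_self hδ.le (by linarith [abs_nonneg α])
  have hδ'2 : |α| * δ' ≤ δ := by
    rw [hδ', ← mul_div_assoc, div_le_iff₀ hα1]
    nlinarith [abs_nonneg α]
  have hG : HasDerivAt (fun α => Real.log (Φ.cubePartition Ψ m α)) ((m : ℝ) ^ d * x') α := by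
    have h1 := hder.const_mul ((m : ℝ) ^ d)
    have h2 : (fun α => (m : ℝ) ^ d * Φ.freeEnergy Ψ m α) =
        fun α => Real.log (Φ.cubePartition Ψ m α) := by
      funext β; rw [freeEnergy, mul_div_cancel₀ _ hm'.ne']
    rwa [h2] at h1
  have hQ : Tendsto (fun n : ℕ => (n / m) ^ d) atTop atTop :=
    (tendsto_pow_atTop hd.ne').comp (Nat.tendsto_div_const_atTop hm.ne')
  have hcov := tendsto_coverage d hm
  have hc1 : ∀ᶠ n : ℕ in atTop,
      |(((n / m) ^ d : ℕ) : ℝ) * (m : ℝ) ^ d / (n : ℝ) ^ d - 1| * |x'| < δ := by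
    have h1 := ((hcov.sub_const 1).abs).mul_const |x'|
    rw [sub_self, abs_zero, zero_mul] at h1
    exact h1.eventually (gt_mem_nhds hδ)
  have hc2 : ∀ᶠ n : ℕ in atTop, A - 2 * δ < (((n / m) ^ d : ℕ) : ℝ) * (m : ℝ) ^ d / (n : ℝ) ^ d *
      (A - δ) - Real.log 2 / (n : ℝ) ^ d := by
    have h3 : Tendsto (fun n : ℕ => Real.log 2 / (n : ℝ) ^ d) atTop (𝓝 0) :=
      tendsto_const_nhds.div_atTop ((tendsto_pow_atTop hd.ne').comp tendsto_natCast_atTop_atTop)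
    have h1 := (hcov.mul_const (A - δ)).sub h3
    rw [one_mul, sub_zero] at h1
    exact h1.eventually (lt_mem_nhds (by linarith))
  -- Concentration is applied with the number of tiles as the number of independent copies, and the
  -- logarithm of one tile's partition function as `G`.
  filter_upwards [hQ.eventually (eventually_half_le_sum_near hG (mul_pos hm' hδ'0)), hc1, hc2,
    eventually_gt_atTop 0] with n hGE hc1 hc2 hn
  have hv : (0 : ℝ) < (n : ℝ) ^ d := by positivity
  have hmq : m * (n / m) ≤ n := Nat.mul_div_le n m
  obtain ⟨k, w, hw, -, h3⟩ := exists_spectral_weights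
    (localAlg_le_range 𝔄 _ (Ψ.tiled_mem hmq)) (localAlg_le_range 𝔄 _ (Φ.tiled_mem hmq))
    (Ψ.isSelfAdjoint_tiled _ _) (Φ.isSelfAdjoint_tiled _ _)
  obtain ⟨hpart, hgauss⟩ := h3 (commute_tiled (hcomm m) _)
  rw [hgauss]
  set Q : ℕ := (n / m) ^ d with hQdef
  set r : ℝ := (N : ℝ) ^ (n ^ d - Q * m ^ d) with hr
  have hN : (1 : ℝ) ≤ N := by exact_mod_cast NeZero.one_le
  have hr1 : 1 ≤ r := one_le_pow₀ hN
  have hk : ∀ β, ∑ i, w i * Real.exp (β * k i) =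
      r * Real.exp (Q * Real.log (Φ.cubePartition Ψ m β)) := by
    intro β
    rw [← hpart, partitionFn_tiled Φ Ψ hmq, mul_comm, ← Real.log_pow,
      Real.exp_log (pow_pos (Φ.cubePartition_pos Ψ m β) _)]
  have hnear := hGE k w r hw (by linarith) hk
  set v : ℝ := (n : ℝ) ^ d with hvdef
  set u : ℝ := (Q : ℝ) * (m : ℝ) ^ d with hu
  have hu0 : 0 ≤ u := by positivity
  have huv : u ≤ v := by
    have : Q * m ^ d ≤ n ^ d := by
      rw [hQdef, ← mul_pow]; exact Nat.pow_le_pow_left (Nat.div_mul_le_self n m) d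
    rw [hu, hvdef]; exact_mod_cast this
  have hX : (Q : ℝ) * ((m : ℝ) ^ d * x') = u * x' := by rw [hu]; ring
  have hD : (Q : ℝ) * ((m : ℝ) ^ d * δ') = u * δ' := by rw [hu]; ring
  have hlogZ : (Q : ℝ) * Real.log (Φ.cubePartition Ψ m α) = u * Φ.freeEnergy Ψ m α := by
    rw [freeEnergy, hu]; field_simp
  rw [hX, hD, hlogZ] at hnear
  -- The distance from `k i` to `v x` has three parts of size at most `δ v`: the concentration
  -- window, the uncovered sites, and the gap between `x'` and `x`. Hence the penalty is at most `9
  -- c δ² v`.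
  have hterm : ∀ i, |k i - u * x'| < u * δ' → Real.exp (-(u * (α * x' + δ)) - 9 * c * δ ^ 2 * v) *
      (w i * Real.exp (α * k i)) ≤ w i * Real.exp (-(c / v * (k i - v * x) ^ 2)) := by
    intro i hi
    have h1 : α * k i ≤ u * (α * x' + δ) := by
      have h2 : α * (k i - u * x') ≤ |α| * (u * δ') :=
        (le_abs_self _).trans (by
          rw [abs_mul]; exact mul_le_mul_of_nonneg_left hi.le (abs_nonneg α))
      nlinarith [mul_le_mul_of_nonneg_left hδ'2 hu0]
    have h2 : |k i - v * x| ≤ 3 * δ * v := by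
      have h3 : |u * x' - v * x'| ≤ δ * v := by
        have : u * x' - v * x' = (u / v - 1) * x' * v := by field_simp
        rw [this, abs_mul, abs_mul, abs_of_pos hv]
        exact mul_le_mul_of_nonneg_right hc1.le hv.le
      have h4 : |v * x' - v * x| ≤ δ * v := by
        rw [← mul_sub, abs_mul, abs_of_pos hv, mul_comm]
        exact mul_le_mul_of_nonneg_right hx' hv.le
      have h5 : u * δ' ≤ δ * v := by nlinarith
      have h6 : k i - v * x = (k i - u * x') + (u * x' - v * x') + (v * x' - v * x) := by ring
      rw [h6]
      refine (abs_add_le _ _).trans ?_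
      have := abs_add_le (k i - u * x') (u * x' - v * x')
      linarith
    have h7 : c / v * (k i - v * x) ^ 2 ≤ 9 * c * δ ^ 2 * v := by
      have h8 : (k i - v * x) ^ 2 ≤ (3 * δ * v) ^ 2 := sq_le_sq' (by linarith [abs_le.1 h2])
        (abs_le.1 h2).2
      refine (mul_le_mul_of_nonneg_left h8 (by positivity)).trans (le_of_eq ?_)
      field_simp
      norm_num
    rw [mul_left_comm, ← Real.exp_add]
    exact mul_le_mul_of_nonneg_left (Real.exp_le_exp.2 (by linarith)) (hw i)
  calc Real.exp (v * (A - 2 * δ - 9 * c * δ ^ 2))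
      ≤ Real.exp (-(u * (α * x' + δ)) - 9 * c * δ ^ 2 * v) *
        (r * Real.exp (u * Φ.freeEnergy Ψ m α) / 2) := by
        have h2 : Real.exp (v * (A - 2 * δ - 9 * c * δ ^ 2)) ≤
            Real.exp (-(u * (α * x' + δ)) - 9 * c * δ ^ 2 * v) *
              (1 * Real.exp (u * Φ.freeEnergy Ψ m α) / 2) := by
          have h3 : (1 : ℝ) * Real.exp (u * Φ.freeEnergy Ψ m α) / 2 =
              Real.exp (u * Φ.freeEnergy Ψ m α - Real.log 2) := by
            rw [Real.exp_sub, Real.exp_log two_pos, one_mul]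
          rw [h3, ← Real.exp_add, Real.exp_le_exp]
          have h4 : v * (A - 2 * δ) ≤ u * (A - δ) - Real.log 2 := by
            have h5 := mul_le_mul_of_nonneg_left hc2.le hv.le
            have h6 : v * (u / v * (A - δ) - Real.log 2 / v) = u * (A - δ) - Real.log 2 := by
              field_simp
            rwa [h6] at h5
          have h7 := mul_le_mul_of_nonneg_left hA hu0
          linarith
        refine h2.trans (mul_le_mul_of_nonneg_left ?_ (Real.exp_pos _).le)
        exact div_le_div_of_nonneg_right (mul_le_mul_of_nonneg_right hr1 (Real.exp_pos _).le)
          two_pos.le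
    _ ≤ Real.exp (-(u * (α * x' + δ)) - 9 * c * δ ^ 2 * v) *
        ∑ i with |k i - u * x'| < u * δ', w i * Real.exp (α * k i) :=
        mul_le_mul_of_nonneg_left hnear (Real.exp_pos _).le
    _ ≤ ∑ i with |k i - u * x'| < u * δ', w i * Real.exp (-(c / v * (k i - v * x) ^ 2)) := by
        rw [Finset.mul_sum]
        exact Finset.sum_le_sum fun i hi => hterm i (Finset.mem_filter.1 hi).2
    _ ≤ ∑ i, w i * Real.exp (-(c / v * (k i - v * x) ^ 2)) :=
        Finset.sum_le_sum_of_subset_of_nonneg (Finset.filter_subset _ _) fun i _ _ =>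
          mul_nonneg (hw i) (Real.exp_pos _).le

/-- The local lower bound for the density of `K`. -/
theorem eventually_le_local_weight (hd : 0 < d) {Φ Ψ : Interaction d 𝔄}
    (hΦ : Φ.NormFinite) (hΨ : Ψ.NormFinite)
    (hcomm : ∀ n : ℕ, Commute (Ψ.hamiltonian (cube 0 n)) (Φ.hamiltonian (cube 0 n)))
    {P : ℝ → ℝ} (hP : ∀ α, Tendsto (fun n => Φ.freeEnergy Ψ n α) atTop (𝓝 (P α)))
    {x b : ℝ} (hb : ∀ α, b ≤ P α - P 0 - α * x) {ε : ℝ} (hε : 0 < ε) :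
    ∀ᶠ n : ℕ in atTop, ∀ {ι : Type} [Fintype ι] (k w : ι → ℝ), Φ.IsSpectralData Ψ n k w →
      Real.exp ((n : ℝ) ^ d * (P 0 + b - ε)) ≤
        ∑ i with |((n : ℝ) ^ d)⁻¹ * k i - x| < ε, w i := by
  have hb0 : b ≤ 0 := by simpa using hb 0
  set M := Ψ.normValue + ‖Ψ.term ∅‖ with hM
  have hM0 : 0 ≤ M := add_nonneg Ψ.normValue_nonneg (norm_nonneg _)
  -- With `c ε² = 1 - b + ε`, the penalised weight outside the `ε`-ball is at most `e^{v (P 0 + b -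
  -- ε)}`, even against the crude total `e^{v (P 0 + 1)}`.
  set c := (1 - b + ε) / ε ^ 2 with hc
  have hc0 : 0 ≤ c := div_nonneg (by linarith) (by positivity)
  have hcε : c * ε ^ 2 = 1 - b + ε := div_mul_cancel₀ _ (by positivity)
  -- The total loss per site is `δ/2 + η + 3δ + 9 c δ²`, at most `(5 + 9 c) δ` once `δ ≤ 1` and `η ≤
  -- δ/2`.
  set δ := min 1 (ε / (2 * (5 + 9 * c))) with hδ
  have hδ0 : 0 < δ := lt_min one_pos (by positivity)
  have hδ1 : δ ≤ 1 := min_le_left _ _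
  have hδ2 : δ * (5 + 9 * c) ≤ ε / 2 := by
    have h1 : δ ≤ ε / (2 * (5 + 9 * c)) := min_le_right _ _
    rw [le_div_iff₀ (by positivity)] at h1
    linarith
  set C₁ := 1 + c * (2 * (M + |x|) + 1) with hC₁
  have hC₁1 : 1 ≤ C₁ := by
    have : 0 ≤ c * (2 * (M + |x|) + 1) := by positivity
    linarith
  -- `C₁` is the Lipschitz constant of the penalised generator from `norm_penalized_sub_le`; this
  -- choice makes the tiling error `δ/2` per site.
  set η := δ / (2 * C₁) with hη
  have hη0 : 0 < η := by positivity
  have hηC : η * C₁ = δ / 2 := by rw [hη]; field_simp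
  have hηδ : η ≤ δ / 2 := by
    rw [← hηC]; exact le_mul_of_one_le_right hη0.le hC₁1
  obtain ⟨m, hmF, hmΦ, hmΨ, hm⟩ := ((eventually_abs_limit_sub_freeEnergy_le hd hΦ hΨ hP hη0).and
    ((eventually_norm_sub_tiled_le hd hΦ hη0).and ((eventually_norm_sub_tiled_le hd hΨ hη0).and
      (eventually_gt_atTop 0)))).exists
  have hdiff : Differentiable ℝ (Φ.freeEnergy Ψ m) :=
    (differentiable_log_cubePartition (hcomm m)).div_const _
  obtain ⟨α, x', hder, hx', hval⟩ := exists_hasDerivAt_near hdiff (x := x) (B := P 0 + b - η)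
    (η := η) (δ := δ) (by linarith) hδ0 (fun β => by
      have h1 := (abs_le.1 (hmF β)).2
      have h2 := hb β
      linarith)
  have hbig : ∀ᶠ n : ℕ in atTop, 2 ≤ Real.exp ((n : ℝ) ^ d * (ε / 2)) := by
    have : Tendsto (fun n : ℕ => Real.exp ((n : ℝ) ^ d * (ε / 2))) atTop atTop :=
      Real.tendsto_exp_atTop.comp (((tendsto_pow_atTop hd.ne').comp
        tendsto_natCast_atTop_atTop).atTop_mul_const (by positivity))
    exact this.eventually_ge_atTop _
  filter_upwards [eventually_le_partitionFn_penalized_tiled hd hcomm hm hδ0 hc0 hder hx' hval,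
    hmΦ, hmΨ, eventually_cubePartition_le hP 0 one_pos, hbig, eventually_gt_atTop 0]
    with n h1 h2 h3 h4 h5 hn ι _ k w hs
  have hmq : m * (n / m) ≤ n := Nat.mul_div_le n m
  set v : ℝ := (n : ℝ) ^ d with hvdef
  have hv : 0 < v := by positivity
  have hmem : ∀ {H K : ConfigOp d N}, H ∈ localAlg 𝔄 (cube 0 n) → K ∈ localAlg 𝔄 (cube 0 n) →
      -H - ((c / v : ℝ) : ℂ) • (K - ((v * x : ℝ) : ℂ) • 1) ^ 2 ∈
        (localEmbed d N (cube 0 n)).range := fun hH hK =>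
    localAlg_le_range 𝔄 _ (sub_mem (neg_mem hH) (SMulMemClass.smul_mem _ (pow_mem (sub_mem hK
      (SMulMemClass.smul_mem _ (one_mem _))) 2)))
  have hsa : ∀ {H K : ConfigOp d N}, IsSelfAdjoint H → IsSelfAdjoint K →
      IsSelfAdjoint (-H - ((c / v : ℝ) : ℂ) • (K - ((v * x : ℝ) : ℂ) • 1) ^ 2) := fun hH hK =>
    hH.neg.sub (isSelfAdjoint_ofReal_smul
      ((hK.sub (isSelfAdjoint_ofReal_smul (IsSelfAdjoint.one _) _)).pow 2) _)
  -- The passage from tiles to the true cube compares only partition functions, so tiled and true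
  -- operators need not commute.
  have h6 := partitionFn_le (hmem (Φ.tiled_mem hmq) (Ψ.tiled_mem hmq))
    (hmem (Φ.hamiltonian_mem _) (Ψ.hamiltonian_mem _))
    (hsa (Φ.isSelfAdjoint_tiled m (n / m)) (Ψ.isSelfAdjoint_tiled m (n / m)))
    (hsa (Φ.isSelfAdjoint_hamiltonian _) (Ψ.isSelfAdjoint_hamiltonian _))
  have h7 := norm_penalized_sub_le (x := x) hv hc0 (by linarith : η ≤ 1)
    (norm_hamiltonian_cube_le hΨ hn) h2 h3
  rw [← hM, ← hC₁, hηC] at h7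
  rw [hs.gaussian] at h6
  have h8 : Real.exp (v * (P 0 + b - ε / 2)) ≤
      ∑ i, w i * Real.exp (-(c / v * (k i - v * x) ^ 2)) := by
    have h9 := (h1.trans h6).trans (mul_le_mul_of_nonneg_right (Real.exp_le_exp.2 h7)
      (Finset.sum_nonneg fun i _ => mul_nonneg (hs.nonneg i) (Real.exp_pos _).le))
    have h10 := mul_le_mul_of_nonneg_left h9 (Real.exp_pos (-(δ / 2 * v))).le
    rw [← mul_assoc, ← Real.exp_add, ← Real.exp_add, neg_add_cancel, Real.exp_zero, one_mul] at h10
    refine le_trans (Real.exp_le_exp.2 ?_) h10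
    have h11 : c * δ ^ 2 ≤ c * δ := mul_le_mul_of_nonneg_left
      (by rw [sq]; exact mul_le_of_le_one_left hδ0.le hδ1) hc0
    have h12 : P 0 + b - ε / 2 ≤ -(δ / 2) + (P 0 + b - η - δ - 2 * δ - 9 * c * δ ^ 2) := by
      linarith
    refine (mul_le_mul_of_nonneg_left h12 hv.le).trans (le_of_eq ?_)
    ring
  -- Inside the ball the penalty factor is at most one; outside it is at most `e^{-c ε² v}`.
  have h9 : ∑ i, w i * Real.exp (-(c / v * (k i - v * x) ^ 2)) ≤
      ∑ i with |v⁻¹ * k i - x| < ε, w i + Real.exp (-(v * (1 - b + ε))) * ∑ i, w i := by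
    rw [Finset.mul_sum, Finset.sum_filter, ← Finset.sum_add_distrib]
    refine Finset.sum_le_sum fun i _ => ?_
    have hwi := hs.nonneg i
    by_cases hi : |v⁻¹ * k i - x| < ε
    · rw [if_pos hi]
      have h10 : Real.exp (-(c / v * (k i - v * x) ^ 2)) ≤ 1 := by
        rw [Real.exp_le_one_iff, neg_nonpos]; positivity
      exact (mul_le_of_le_one_right hwi h10).trans
        (le_add_of_nonneg_right (mul_nonneg (Real.exp_pos _).le hwi))
    · rw [if_neg hi, zero_add, mul_comm]
      refine mul_le_mul_of_nonneg_right (Real.exp_le_exp.2 (neg_le_neg ?_)) hwi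
      have h10 : ε ^ 2 ≤ (v⁻¹ * k i - x) ^ 2 := by
        rw [← sq_abs (v⁻¹ * k i - x)]
        exact pow_le_pow_left₀ hε.le (not_lt.1 hi) 2
      have h11 : c / v * (k i - v * x) ^ 2 = v * (c * (v⁻¹ * k i - x) ^ 2) := by
        field_simp
      rw [h11, ← hcε]
      exact mul_le_mul_of_nonneg_left (mul_le_mul_of_nonneg_left h10 hc0) hv.le
  have h10 : ∑ i, w i ≤ Real.exp (v * (P 0 + 1)) := by
    rw [hs.partition] at h4
    simpa using h4
  have h11 : Real.exp (-(v * (1 - b + ε))) * ∑ i, w i ≤ Real.exp (v * (P 0 + b - ε)) := by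
    refine (mul_le_mul_of_nonneg_left h10 (Real.exp_pos _).le).trans (le_of_eq ?_)
    rw [← Real.exp_add]; congr 1; ring
  have h12 : 2 * Real.exp (v * (P 0 + b - ε)) ≤ Real.exp (v * (P 0 + b - ε / 2)) := by
    refine (mul_le_mul_of_nonneg_right h5 (Real.exp_pos _).le).trans (le_of_eq ?_)
    rw [← Real.exp_add]; congr 1; ring
  linarith

end Interaction

end LowerBound

/-! ### The distribution of the density in a state -/

section Distribution

variable {d N : ℕ} {𝔄 : StarSubalgebra ℂ (Matrix (Fin N) (Fin N) ℂ)}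

theorem QuasiLocalState.eq_re_of_projection (ω : QuasiLocalState d 𝔄) {q : quasiLocal d 𝔄}
    (hq : star q * q = q) : ω.toFun q = ((ω.toFun q).re : ℂ) ∧ 0 ≤ (ω.toFun q).re := by
  have h := ω.nonneg q
  rw [hq] at h
  exact ⟨Complex.ext rfl (by simpa using h.2), h.1⟩

theorem star_spectralProj_mul_self {Λ : Finset (Fin d → ℤ)} (B : Set ℝ) {T : ConfigOp d N}
    (hT : T ∈ (localEmbed d N Λ).range) (hsa : IsSelfAdjoint T) :
    star (spectralProj B T) * spectralProj B T = spectralProj B T := by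
  obtain ⟨U, k, rfl⟩ := exists_localDiag hT hsa
  rw [spectralProj_localDiag, ← map_star, ← map_mul]
  congr 1
  funext i
  by_cases h : k i ∈ B <;> simp [h]

/-- The set `S` of eigenvalues does not depend on `B`, so a linear functional of the projections is
a finite sum of point masses and countable additivity is automatic. -/
theorem exists_spectralProj_eq_sum {Λ : Finset (Fin d → ℤ)} {T : ConfigOp d N}
    (hT : T ∈ (localEmbed d N Λ).range) (hsa : IsSelfAdjoint T) :
    ∃ S : Finset ℝ, ∀ B : Set ℝ, spectralProj B T =
      ∑ x ∈ S, (((B.indicator (fun _ => 1) x : ℝ)) : ℂ) • spectralProj {x} T := by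
  classical
  obtain ⟨U, k, rfl⟩ := exists_localDiag hT hsa
  refine ⟨Finset.univ.image k, fun B => ?_⟩
  simp only [spectralProj_localDiag]
  simp only [← map_smul, ← map_sum]
  congr 1
  funext i
  rw [Finset.sum_apply, Finset.sum_eq_single (k i)]
  · by_cases h : k i ∈ B <;> simp [h]
  · intro y _ hy
    simp [Ne.symm hy]
  · intro h
    exact absurd (Finset.mem_image_of_mem k (Finset.mem_univ i)) h

theorem spectralProj_univ {Λ : Finset (Fin d → ℤ)} {T : ConfigOp d N}
    (hT : T ∈ (localEmbed d N Λ).range) (hsa : IsSelfAdjoint T) :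
    spectralProj Set.univ T = 1 := by
  obtain ⟨U, k, rfl⟩ := exists_localDiag hT hsa
  rw [spectralProj_localDiag, ← map_one (localDiag d U)]
  congr 1
  funext i
  simp

theorem exists_discrete_probabilityMeasure (S : Finset ℝ) (p : ℝ → ℝ) (hp : ∀ x ∈ S, 0 ≤ p x)
    (hsum : ∑ x ∈ S, p x = 1) : ∃ μ : ProbabilityMeasure ℝ, ∀ A : Set ℝ, MeasurableSet A →
      (μ : Measure ℝ).real A = ∑ x ∈ S, A.indicator (fun _ => 1) x * p x := by
  have key : ∀ A : Set ℝ, MeasurableSet A →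
      (∑ x ∈ S, ENNReal.ofReal (p x) • Measure.dirac x) A =
        ENNReal.ofReal (∑ x ∈ S, A.indicator (fun _ => 1) x * p x) := by
    intro A hA
    rw [ENNReal.ofReal_sum_of_nonneg fun x hx => mul_nonneg
      (Set.indicator_nonneg (fun _ _ => zero_le_one) _) (hp x hx), Measure.finsetSum_apply]
    refine Finset.sum_congr rfl fun x _ => ?_
    rw [Measure.smul_apply, Measure.dirac_apply' _ hA, smul_eq_mul]
    by_cases h : x ∈ A <;> simp [h]
  refine ⟨⟨∑ x ∈ S, ENNReal.ofReal (p x) • Measure.dirac x, ⟨?_⟩⟩, fun A hA => ?_⟩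
  · rw [key _ MeasurableSet.univ]
    simp [hsum]
  · rw [measureReal_def]
    change ((∑ x ∈ S, ENNReal.ofReal (p x) • Measure.dirac x) A).toReal = _
    rw [key A hA, ENNReal.toReal_ofReal]
    exact Finset.sum_nonneg fun x hx => mul_nonneg
      (Set.indicator_nonneg (fun _ _ => zero_le_one) _) (hp x hx)

namespace Interaction

theorem density_mem_localAlg (Ψ : Interaction d 𝔄) (Λ : Finset (Fin d → ℤ)) :
    ((((Λ.card : ℝ)⁻¹ : ℝ) : ℂ) • Ψ.hamiltonian Λ) ∈ localAlg 𝔄 Λ :=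
  SMulMemClass.smul_mem _ (Ψ.hamiltonian_mem Λ)

theorem isSelfAdjoint_density (Ψ : Interaction d 𝔄) (Λ : Finset (Fin d → ℤ)) :
    IsSelfAdjoint ((((Λ.card : ℝ)⁻¹ : ℝ) : ℂ) • Ψ.hamiltonian Λ) :=
  isSelfAdjoint_ofReal_smul (Ψ.isSelfAdjoint_hamiltonian Λ) _

/-- The decoupling bound covers only local observables; closedness of the local algebra keeps the
functional calculus inside it. -/
theorem densityProj_mem_localAlg (Ψ : Interaction d 𝔄) (Λ : Finset (Fin d → ℤ)) (B : Set ℝ) :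
    (Ψ.densityProj Λ B : ConfigOp d N) ∈ localAlg 𝔄 Λ :=
  StarAlgebra.elemental.le_of_mem (isClosed_of_le_range _ (localAlg_le_range 𝔄 Λ))
    (Ψ.density_mem_localAlg Λ) (cfc_mem_elemental _ _)

theorem star_densityProj_mul_self (Ψ : Interaction d 𝔄) (Λ : Finset (Fin d → ℤ)) (B : Set ℝ) :
    star (Ψ.densityProj Λ B) * Ψ.densityProj Λ B = Ψ.densityProj Λ B :=
  Subtype.ext (star_spectralProj_mul_self B (localAlg_le_range 𝔄 Λ (Ψ.density_mem_localAlg Λ))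
    (Ψ.isSelfAdjoint_density Λ))

theorem isPositive_densityProj (Ψ : Interaction d 𝔄) (Λ : Finset (Fin d → ℤ)) (B : Set ℝ) :
    (Ψ.densityProj Λ B : ConfigOp d N).IsPositive := by
  rw [← ContinuousLinearMap.nonneg_iff_isPositive]
  have h : star (Ψ.densityProj Λ B : ConfigOp d N) * (Ψ.densityProj Λ B : ConfigOp d N) =
      (Ψ.densityProj Λ B : ConfigOp d N) := congrArg Subtype.val (Ψ.star_densityProj_mul_self Λ B)
  rw [← h]
  exact star_mul_self_nonneg _

/-- The distribution of the density of `K_Λ` in a state. -/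
theorem exists_distribution (Ψ : Interaction d 𝔄) (ω : QuasiLocalState d 𝔄)
    (Λ : Finset (Fin d → ℤ)) : ∃ μ : ProbabilityMeasure ℝ, ∀ A : Set ℝ, MeasurableSet A →
      ω.toFun (Ψ.densityProj Λ A) = (((μ : Measure ℝ).real A : ℝ) : ℂ) := by
  have hT := localAlg_le_range 𝔄 Λ (Ψ.density_mem_localAlg Λ)
  have hsa := Ψ.isSelfAdjoint_density Λ
  obtain ⟨S, hS⟩ := exists_spectralProj_eq_sum hT hsa
  have hS' : ∀ B : Set ℝ, Ψ.densityProj Λ B =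
      ∑ x ∈ S, (((B.indicator (fun _ => 1) x : ℝ)) : ℂ) • Ψ.densityProj Λ {x} := by
    intro B
    refine Subtype.ext ?_
    refine (hS B).trans ?_
    rw [AddSubmonoidClass.coe_finsetSum]
    rfl
  set p : ℝ → ℝ := fun x => (ω.toFun (Ψ.densityProj Λ {x})).re with hp
  have hpx : ∀ x, ω.toFun (Ψ.densityProj Λ {x}) = (p x : ℂ) := fun x =>
    (ω.eq_re_of_projection (Ψ.star_densityProj_mul_self Λ {x})).1
  have hval : ∀ B : Set ℝ, ω.toFun (Ψ.densityProj Λ B) =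
      ((∑ x ∈ S, B.indicator (fun _ => 1) x * p x : ℝ) : ℂ) := by
    intro B
    rw [hS' B, map_sum, Complex.ofReal_sum]
    refine Finset.sum_congr rfl fun x _ => ?_
    rw [map_smul, hpx, smul_eq_mul, Complex.ofReal_mul]
  have hone : Ψ.densityProj Λ Set.univ = 1 := Subtype.ext (spectralProj_univ hT hsa)
  have hsum : ∑ x ∈ S, p x = 1 := by
    have h := hval Set.univ
    rw [hone, ω.map_one] at h
    simp only [Set.indicator_univ, one_mul] at h
    exact_mod_cast h.symm
  obtain ⟨μ, hμ⟩ := exists_discrete_probabilityMeasure S p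
    (fun x _ => (ω.eq_re_of_projection (Ψ.star_densityProj_mul_self Λ {x})).2) hsum
  exact ⟨μ, fun A hA => by rw [hμ A hA, hval]⟩

variable [NeZero N]

theorem gibbs_densityProj {Φ Ψ : Interaction d 𝔄} {n : ℕ} {ι : Type} [Fintype ι] {k w : ι → ℝ}
    (hs : Φ.IsSpectralData Ψ n k w) (B : Set ℝ) [DecidablePred (· ∈ B)] :
    (gibbs Φ (cube 0 n) (Ψ.densityProj (cube 0 n) B)).re =
      (∑ i with ((n : ℝ) ^ d)⁻¹ * k i ∈ B, w i) / Φ.cubePartition Ψ n 0 := by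
  have h1 := hs.projection (((cube (0 : Fin d → ℤ) n).card : ℝ))⁻¹ B
  have h2 : localTrace (cube 0 n) (NormedSpace.exp (-Φ.hamiltonian (cube 0 n))) =
      (Φ.cubePartition Ψ n 0 : ℂ) := by
    rw [← localTrace_exp_generator, generator, Complex.ofReal_zero, zero_smul, add_zero]
  have h3 : gibbs Φ (cube 0 n) (Ψ.densityProj (cube 0 n) B) = _ / _ := congrArg₂ (· / ·) h1 h2
  rw [h3, ← Complex.ofReal_div, Complex.ofReal_re, card_cube, Finset.sum_filter]
  congr 1
  refine Finset.sum_congr rfl fun i _ => ?_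
  push_cast
  by_cases h : ((n : ℝ) ^ d)⁻¹ * k i ∈ B <;> simp [h]

end Interaction

end Distribution

/-! ### From Gibbs weights to the decoupled state -/

section Comparison

variable {d N : ℕ} [NeZero N] {𝔄 : StarSubalgebra ℂ (Matrix (Fin N) (Fin N) ℂ)}

open scoped Classical in
/-- Up to subexponential factors, a decoupled state has the finite-volume Gibbs distribution. -/
theorem Interaction.eventually_distribution_comparison {Φ Ψ : Interaction d 𝔄}
    {ω : QuasiLocalState d 𝔄} (hω : GibbsDecoupled Φ ω) {P : ℝ → ℝ}
    (hP : ∀ α, Tendsto (fun n => Φ.freeEnergy Ψ n α) atTop (𝓝 (P α)))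
    {μ : ℕ → ProbabilityMeasure ℝ} (hμ : ∀ (n : ℕ) (A : Set ℝ), MeasurableSet A →
      ω.toFun (Ψ.densityProj (cube 0 n) A) = (((μ n : Measure ℝ).real A : ℝ) : ℂ))
    (ε : ℝ) (hε : 0 < ε) : ∀ᶠ n : ℕ in atTop, ∀ {ι : Type} [Fintype ι] (k w : ι → ℝ),
      Φ.IsSpectralData Ψ n k w → ∀ B : Set ℝ, MeasurableSet B →
        Real.exp ((n : ℝ) ^ d * (-P 0 - ε)) * ∑ i with ((n : ℝ) ^ d)⁻¹ * k i ∈ B, w i ≤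
            (μ n : Measure ℝ).real B ∧
          (μ n : Measure ℝ).real B ≤ Real.exp ((n : ℝ) ^ d * (-P 0 + ε)) *
            ∑ i with ((n : ℝ) ^ d)⁻¹ * k i ∈ B, w i := by
  obtain ⟨c, -, hc, hbound⟩ := hω
  -- The error `ε` is shared equally between the decoupling constant and the normalisation by the
  -- partition function.
  filter_upwards [hc.eventually (gt_mem_nhds (half_pos hε)),
    eventually_cubePartition_le hP 0 (half_pos hε), eventually_le_cubePartition hP 0 (half_pos hε),
    eventually_gt_atTop 0] with n h1 h2 h3 hn ι _ k w hs B hB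
  have hv : (0 : ℝ) < (n : ℝ) ^ d := by positivity
  rw [div_lt_iff₀ hv] at h1
  have h4 := hbound n 0 (Ψ.densityProj (cube 0 n) B) (Ψ.densityProj_mem_localAlg _ B)
    (Ψ.isPositive_densityProj _ B)
  rw [gibbs_densityProj hs, hμ n B hB, Complex.ofReal_re] at h4
  set p := (μ n : Measure ℝ).real B
  set S := ∑ i with ((n : ℝ) ^ d)⁻¹ * k i ∈ B, w i
  set Z := Φ.cubePartition Ψ n 0
  have hZ : 0 < Z := Φ.cubePartition_pos Ψ n 0
  have hp : 0 ≤ p := measureReal_nonneg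
  rw [le_div_iff₀ hZ, div_le_iff₀ hZ] at h4
  constructor
  · have h5 : S ≤ Real.exp ((n : ℝ) ^ d * (P 0 + ε)) * p := by
      calc S ≤ Real.exp (c n) * p * Z := h4.2
        _ ≤ Real.exp (ε / 2 * (n : ℝ) ^ d) * p * Real.exp ((n : ℝ) ^ d * (P 0 + ε / 2)) :=
          mul_le_mul (mul_le_mul_of_nonneg_right (Real.exp_le_exp.2 h1.le) hp) h2 hZ.le
            (by positivity)
        _ = _ := by rw [mul_right_comm, ← Real.exp_add]; congr 2; ring
    refine (mul_le_mul_of_nonneg_left h5 (Real.exp_pos _).le).trans (le_of_eq ?_)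
    rw [← mul_assoc, ← Real.exp_add]
    rw [show (n : ℝ) ^ d * (-P 0 - ε) + (n : ℝ) ^ d * (P 0 + ε) = 0 by ring, Real.exp_zero, one_mul]
  · have h5 : Real.exp ((n : ℝ) ^ d * (P 0 - ε)) * p ≤ S := by
      calc Real.exp ((n : ℝ) ^ d * (P 0 - ε)) * p
          = Real.exp (-(ε / 2 * (n : ℝ) ^ d)) * p * Real.exp ((n : ℝ) ^ d * (P 0 - ε / 2)) := by
            rw [mul_right_comm, ← Real.exp_add]; congr 2; ring
        _ ≤ Real.exp (-c n) * p * Z :=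
          mul_le_mul (mul_le_mul_of_nonneg_right (Real.exp_le_exp.2 (neg_le_neg h1.le)) hp) h3
            (Real.exp_pos _).le (by positivity)
        _ ≤ S := h4.1
    refine le_trans (le_of_eq ?_) (mul_le_mul_of_nonneg_left h5 (Real.exp_pos _).le)
    rw [← mul_assoc, ← Real.exp_add]
    rw [show (n : ℝ) ^ d * (-P 0 + ε) + (n : ℝ) ^ d * (P 0 - ε) = 0 by ring, Real.exp_zero, one_mul]

end Comparison

end

/-! ### The main theorem -/

theorem theorem4p2 (d N : ℕ) (hd : 0 < d) [NeZero N]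
    (𝔄 : StarSubalgebra ℂ (Matrix (Fin N) (Fin N) ℂ))
    (Φ Ψ : Interaction d 𝔄) (hΦ : Φ.NormFinite) (hΨ : Ψ.NormFinite)
    (hcomm : ∀ n : ℕ, Commute (Ψ.hamiltonian (cube 0 n)) (Φ.hamiltonian (cube 0 n)))
    (ω : QuasiLocalState d 𝔄) (hω : GibbsDecoupled Φ ω) :
    ∃ (μ : ℕ → ProbabilityMeasure ℝ) (s : ℝ → EReal) (P : ℝ → ℝ),
      -- `μ n` is the distribution of `K_Λ(n) / |Λ(n)|` in the state `ω`
      (∀ (n : ℕ) (A : Set ℝ), MeasurableSet A →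
        ω.toFun (Ψ.densityProj (cube 0 n) A) = (((μ n : Measure ℝ).real A : ℝ) : ℂ)) ∧
      -- the large deviation principle, with rate function `-s`, and `s` concave
      LargeDeviationPrinciple μ (fun n => ((cube (0 : Fin d → ℤ) n).card : ℝ)) (fun x => -s x) ∧
      ConcaveEReal s ∧
      -- `P` is the translated free energy
      (∀ α : ℝ, Tendsto
        (fun n : ℕ => ((cube (0 : Fin d → ℤ) n).card : ℝ)⁻¹ *
          Real.log (localTrace (cube 0 n) (NormedSpace.exp
            (-Φ.hamiltonian (cube 0 n) + (α : ℂ) • Ψ.hamiltonian (cube 0 n)))).re)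
        atTop (𝓝 (P α))) ∧
      -- the two Legendre transforms
      (∀ α : ℝ, ⨆ x : ℝ, (((α * x : ℝ) : EReal) + s x) = ((P α - P 0 : ℝ) : EReal)) ∧
      (∀ x : ℝ, s x = ⨅ α : ℝ, ((P α - P 0 - α * x : ℝ) : EReal)) := by
  classical
  choose μ hμ using fun n : ℕ => Ψ.exists_distribution ω (cube 0 n)
  choose P hP using Interaction.exists_tendsto_freeEnergy hd hΦ hΨ
  have hvol : (fun n : ℕ => ((cube (0 : Fin d → ℤ) n).card : ℝ)) = fun n : ℕ => (n : ℝ) ^ d := by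
    funext n; rw [card_cube]; push_cast; rfl
  have hdec := Interaction.eventually_distribution_comparison hω hP hμ
  refine ⟨μ, entropyFn P, P, hμ, ?_, concaveEReal_entropyFn P, fun α => ?_,
    iSup_add_entropyFn (Interaction.convexOn_of_tendsto_freeEnergy hcomm hP), fun x => rfl⟩
  · rw [hvol]
    refine largeDeviationPrinciple_of_bounds (v := fun n : ℕ => (n : ℝ) ^ d) (fun i j hij => ?_)
      ((tendsto_pow_atTop hd.ne').comp tendsto_natCast_atTop_atTop) (fun α y ε hε => ?_)
      (fun x b hb ε hε => ?_)
    · exact pow_le_pow_left₀ (Nat.cast_nonneg i) (by exact_mod_cast hij) d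
    · filter_upwards [hdec (ε / 2) (half_pos hε),
        Interaction.eventually_halfline_weight_le hP α y (half_pos hε)] with n h1 h2
      obtain ⟨k, w, hs⟩ := Interaction.exists_isSpectralData (hcomm n)
      have h3 := (h1 k w hs {x | y ≤ α * x} (measurableSet_le measurable_const
        (measurable_id.const_mul α))).2
      refine h3.trans ((mul_le_mul_of_nonneg_left (h2 k w hs) (Real.exp_pos _).le).trans
        (le_of_eq ?_))
      rw [← Real.exp_add]; congr 1; ring
    -- The weight bound is used on the ball of radius `ε / 2`: half of the exponential error goes to
    -- it, half to the comparison of distributions.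
    · filter_upwards [hdec (ε / 2) (half_pos hε),
        Interaction.eventually_le_local_weight hd hΦ hΨ hcomm hP hb (half_pos hε)] with n h1 h2
      obtain ⟨k, w, hs⟩ := Interaction.exists_isSpectralData (hcomm n)
      have h3 := (h1 k w hs (Metric.ball x (ε / 2)) measurableSet_ball).1
      refine le_trans ?_ (h3.trans (measureReal_mono (Metric.ball_subset_ball (by linarith))))
      have h4 := mul_le_mul_of_nonneg_left (h2 k w hs)
        (Real.exp_pos ((n : ℝ) ^ d * (-P 0 - ε / 2))).le
      refine le_trans (le_of_eq ?_) h4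
      rw [← Real.exp_add]; congr 1; ring
  · refine (hP α).congr fun n => ?_
    rw [card_cube, Interaction.freeEnergy, inv_mul_eq_div]
    push_cast
    rfl
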